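/- Let $(\mathcal M,g)$ be a vacuum spacetime of signature $(+,-,-,-)$ near a connected piece $\mathscr S$ of null infinity, in coordinates $(u,r,\theta,\varphi)$, $0<\theta<\pi$, where the hypersurfaces $u=\mathrm{const}$ are null, $r$ is an affine parameter along their generators, and $(u,\theta,\varphi)\in\mathscr S$ labels the generators. Let $l=\partial_r$, $n=\partial_u+Q\partial_r+C^\theta\partial_\theta+C^\varphi\partial_\varphi$, $m=\xi^\theta\partial_\theta+\xi^\varphi\partial_\varphi$, $\bar m$ be a null tetrad ($g(l,n)=1$, $g(m,\bar m)=-1$, all other products zero) with spin coefficient $\epsilon=0$. A function is called polyhomogeneous if, as $r\to\infty$, it has an asymptotic expansion $\sum_{k\ge k_0}\sum_{j\le N_k}f_{kj}(u,\theta,\varphi)\,r^{-k}\ln^j r$ with smooth coefficients, valid locally uniformly on $\mathscr S$ and differentiable term by term to all orders. Assume that $Q$, $C^\theta$, $C^\varphi$, $\xi^\theta$, $\xi^\varphi$ are polyhomogeneous with $Q=-\tfrac12+o(1)$, $C^\theta,C^\varphi=o(1)$, $\xi^\theta=\frac{1}{\sqrt2\,r}+o(r^{-1})$, $\xi^\varphi=-\frac{i}{\sqrt2\,r\sin\theta}+o(r^{-1})$,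 where the remainders have expansions starting at $r^{-1}$, $r^{-1}$, $r^{-2}$, $r^{-2}$ (times powers of $\ln r$), respectively. Assume that the spacetime is boost-rotation symmetric: the domain, the metric and the tetrad are invariant under shifts of $\varphi$ (so $\partial_\varphi$ is a Killing vector), and there is a second Killing vector $X$, commuting with $\partial_\varphi$, whose components are polyhomogeneous with $X^u,X^r$ starting at order $r$ and $X^\theta,X^\varphi$ at order $r^0$ (times powers of $\ln r$), and which on null infinity is not merely a supertranslation plus a rotation about the axis, i.e. $X^\theta\not\to0$ along some generator. (Equivalently, $X$ is asymptotic to $(-\kappa u\cos\theta+\alpha(\theta),\ \kappa r\cos\theta,\ -\kappa\sin\theta,\ \omega)$ with a constant $\kappa\ne0$.) Assume finally that the spacetime is "minimal" polyhomogeneous: the Weyl scalar $\Psi_0=-C_{abcd}l^am^bl^cm^d$ has a polyhomogeneous expansion $$\Psi_0=\Psi_0^{4,0}r^{-4}+(\Psi_0^{5,0}+\Psi_0^{5,1}\ln r)r^{-5}+(\Psi_0^{6,0}+\Psi_0^{6,1}\ln r)r^{-6}+\cdots .$$ Then there are constants $C_1,C_2\in\mathbb C$ such that on all of $\mathscr S$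 $$\Psi_0^{4,0}=C_1\csc^2\theta,\qquad \Psi_0^{5,1}=C_2\csc^3\theta .$$ If $C_1\neq0$ (respectively $C_2\ne0$), then $|\Psi_0^{4,0}|$ (respectively $|\Psi_0^{5,1}|$) tends to infinity when points of $\mathscr S$ approach a pole $\theta=0$ or $\theta=\pi$. Moreover null infinity is only local unless these coefficients vanish: if null infinity contains a piece $(u_1,u_2)\times S^2$, $u_1<u_2$, with complete spherical cuts, then $C_1=C_2=0$. Here such a piece means that $\mathscr S\supseteq\{u_1<u<u_2,\ 0<\theta<\pi\}$, that for $u$ in compact subintervals of $(u_1,u_2)$ the chart contains all points with $r$ greater than a bound independent of $\theta,\varphi$, and that there the components of the metric in the coordinates $(u,r\hat n)$, with $\hat n=(\sin\theta\cos\varphi,\sin\theta\sin\varphi,\cos\theta)\in S^2\subset\mathbb R^3$, extend to polyhomogeneous functions over $(u_1,u_2)\times S^2$, poles included, whose expansions start at order $r^0$ (times powers of $\ln r$). -/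

import Mathlib

open scoped ContDiff Topology

noncomputable section

namespace BoostRot

/-! ### Polyhomogeneous expansions -/

section Polyhomogeneous

variable {P F : Type*} [NormedAddCommGroup P] [NormedSpace ℝ P]
  [NormedAddCommGroup F] [NormedSpace ℝ F]

/-- The partial sum `∑_{k = k₀}^{n} ∑_{j = 0}^{N k} c_{k,j}(p) r^{-k} (ln r)^j`. -/
def polySum (k₀ : ℤ) (N : ℤ → ℕ) (c : ℤ → ℕ → P → F) (n : ℤ) (p : P) (r : ℝ) : F :=
  ∑ k ∈ Finset.Icc k₀ n, ∑ j ∈ Finset.range (N k + 1),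
    (r ^ (-k) * Real.log r ^ j) • c k j p

/-- `f(p, r)` has, as `r → ∞` and for `p` in the open set `S` of parameters, the polyhomogeneous
expansion `f = ∑_{k ≥ k₀} ∑_{j ≤ N k} c_{k,j}(p) r^{-k} (ln r)^j`.  The function is smooth for
large `r`, the coefficients are smooth, and the expansion holds to every order, locally uniformly
in `p`, and may be differentiated term by term any number of times in `r` and in `p`.
`N k` bounds the degree in `ln r` of the coefficient of `r^{-k}`. -/
structure HasPolyExpansion (S : Set P) (f : P → ℝ → F) (k₀ : ℤ) (N : ℤ → ℕ)
    (c : ℤ → ℕ → P → F) : Prop where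
  coeff_smooth : ∀ k, k₀ ≤ k → ∀ j, j ≤ N k → ContDiffOn ℝ ∞ (c k j) S
  smooth : ∀ K : Set P, K ⊆ S → IsCompact K → ∃ R : ℝ, ∀ p ∈ K, ∀ r, R < r →
    ContDiffAt ℝ ∞ (Function.uncurry f) (p, r)
  remainder : ∀ K : Set P, K ⊆ S → IsCompact K → ∀ (n : ℤ) (i m : ℕ) (ε : ℝ), 0 < ε →
    ∃ R : ℝ, ∀ p ∈ K, ∀ r, R < r →
      ‖iteratedFDeriv ℝ m
          (fun q => iteratedDeriv i (fun s => f q s - polySum k₀ N c n q s) r) p‖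
        ≤ ε * r ^ (-n - (i : ℤ))

/-- `f` is polyhomogeneous on `S`, with an expansion that starts at the power `r^{-k₀}`. -/
def IsPolyhomogeneous (S : Set P) (f : P → ℝ → F) (k₀ : ℤ) : Prop :=
  ∃ (N : ℤ → ℕ) (c : ℤ → ℕ → P → F), HasPolyExpansion S f k₀ N c

end Polyhomogeneous

/-! ### Curvature of a metric in a coordinate chart of `ℝ⁴` -/

/-- Points of a chart; the coordinates are `(x 0, x 1, x 2, x 3) = (u, r, θ, φ)`. -/
abbrev Pt := Fin 4 → ℝ

/-- Points of null infinity; the coordinates are `(p 0, p 1, p 2) = (u, θ, φ)`. -/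
abbrev Scri := Fin 3 → ℝ

/-- The point with affine parameter `r` on the generator labelled by `p = (u, θ, φ)`. -/
def pt (p : Scri) (r : ℝ) : Pt := ![p 0, r, p 1, p 2]

/-- The partial derivative `∂_a f`. -/
def pd {F : Type*} [NormedAddCommGroup F] [NormedSpace ℝ F] (a : Fin 4) (f : Pt → F) (x : Pt) : F :=
  fderiv ℝ f x (Pi.single a 1)

/-- A metric, by its covariant components. -/
abbrev MetricField := Pt → Matrix (Fin 4) (Fin 4) ℝ

/-- Christoffel symbols `Γ^a_{bc}`. -/
def christoffel (g : MetricField) (a b c : Fin 4) (x : Pt) : ℝ :=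
  (1 / 2) * ∑ d, (g x)⁻¹ a d *
    (pd b (fun y => g y d c) x + pd c (fun y => g y d b) x - pd d (fun y => g y b c) x)

/-- `R^a_{bcd} = ∂_c Γ^a_{db} - ∂_d Γ^a_{cb} + Γ^a_{ce} Γ^e_{db} - Γ^a_{de} Γ^e_{cb}`. -/
def riemannUp (g : MetricField) (a b c d : Fin 4) (x : Pt) : ℝ :=
  pd c (christoffel g a d b) x - pd d (christoffel g a c b) x
    + ∑ e, (christoffel g a c e x * christoffel g e d b x
        - christoffel g a d e x * christoffel g e c b x)

/-- `R_{abcd}`. -/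
def riemann (g : MetricField) (a b c d : Fin 4) (x : Pt) : ℝ :=
  ∑ e, g x a e * riemannUp g e b c d x

/-- `R_{bd} = R^a_{bad}`. -/
def ricci (g : MetricField) (b d : Fin 4) (x : Pt) : ℝ := ∑ a, riemannUp g a b a d x

def scalarCurv (g : MetricField) (x : Pt) : ℝ := ∑ b, ∑ d, (g x)⁻¹ b d * ricci g b d x

/-- The Weyl tensor `C_{abcd}` in dimension four. -/
def weyl (g : MetricField) (a b c d : Fin 4) (x : Pt) : ℝ :=
  riemann g a b c d x
    - (1 / 2) * (g x a c * ricci g b d x - g x a d * ricci g b c x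
        + g x b d * ricci g a c x - g x b c * ricci g a d x)
    + (1 / 6) * scalarCurv g x * (g x a c * g x b d - g x a d * g x b c)

/-- The Lie derivative `(L_X g)_{ab} = X^c ∂_c g_{ab} + g_{cb} ∂_a X^c + g_{ac} ∂_b X^c`. -/
def lieMetric (g : MetricField) (X : Fin 4 → Pt → ℝ) (a b : Fin 4) (x : Pt) : ℝ :=
  ∑ c, (X c x * pd c (fun y => g y a b) x + g x c b * pd a (X c) x + g x a c * pd b (X c) x)

/-- The complex-bilinear extension of the metric to complex vectors. -/
def metricC (g : MetricField) (x : Pt) (v w : Fin 4 → ℂ) : ℂ :=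
  ∑ a, ∑ b, (g x a b : ℂ) * v a * w b

/-! ### Null coordinates and the Newman–Penrose tetrad -/

/-- The vector `l = ∂_r`. -/
def lVec : Fin 4 → ℂ := ![0, 1, 0, 0]

/-- The data of a metric and a null tetrad in coordinates `(u, r, θ, φ)` on `region`:
`l = ∂_r`, `n = ∂_u + Q ∂_r + C^i ∂_i`, `m = ξ^i ∂_i`, where `i = 0, 1` stands for `θ, φ`.
`scri` is the piece of null infinity that is covered.  The angle `φ` runs over the whole line
(the punctured sphere is covered periodically).  The laws are in `NullChart.IsNullChart`. -/
structure NullChart where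
  scri : Set Scri
  region : Set Pt
  g : MetricField
  Q : Pt → ℝ
  C : Fin 2 → Pt → ℝ
  ξ : Fin 2 → Pt → ℂ

namespace NullChart

def nVec (M : NullChart) (x : Pt) : Fin 4 → ℂ := ![1, (M.Q x : ℂ), (M.C 0 x : ℂ), (M.C 1 x : ℂ)]

def mVec (M : NullChart) (x : Pt) : Fin 4 → ℂ := ![0, 0, M.ξ 0 x, M.ξ 1 x]

/-- The complex conjugate of `m`. -/
def mbarVec (M : NullChart) (x : Pt) : Fin 4 → ℂ := fun a => starRingEnd ℂ (M.mVec x a)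

/-- The vector `∇_l m`, with components `∂_r m^a + Γ^a_{rb} m^b`. -/
def nablaLM (M : NullChart) (x : Pt) : Fin 4 → ℂ := fun a =>
  pd 1 (fun y => M.mVec y a) x + ∑ b, (christoffel M.g a 1 b x : ℂ) * M.mVec x b

/-- The Weyl scalar `Ψ₀ = - C_{abcd} l^a m^b l^c m^d` (the sign belongs to the signature
`(+,-,-,-)` and to the curvature convention above). -/
def Psi0 (M : NullChart) (x : Pt) : ℂ :=
  - ∑ a, ∑ b, ∑ c, ∑ d,
      (weyl M.g a b c d x : ℂ) * lVec a * M.mVec x b * lVec c * M.mVec x d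

/-- The chart describes a spacetime near a piece of null infinity: `scri` is a nonempty connected
open set of `(u, θ, φ)` with `0 < θ < π`; `region` is open and contains the ends of the generators
`r ↦ (u, r, θ, φ)`; all fields are smooth; `(l, n, m, m̄)` is a null tetrad of signature
`(+,-,-,-)`, with `m` propagated along `l` in such a way that the spin coefficient `ε` vanishes
(for a tetrad of this form, this says `g(∇_l m, m̄) = 0`). -/
structure IsNullChart (M : NullChart) : Prop where
  scri_open : IsOpen M.scri
  scri_connected : IsConnected M.scri
  scri_theta : ∀ p ∈ M.scri, p 1 ∈ Set.Ioo 0 Real.pi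
  region_open : IsOpen M.region
  rays : ∀ K : Set Scri, K ⊆ M.scri → IsCompact K →
    ∃ R : ℝ, ∀ p ∈ K, ∀ r, R < r → pt p r ∈ M.region
  smooth_g : ∀ a b, ContDiffOn ℝ ∞ (fun x => M.g x a b) M.region
  smooth_Q : ContDiffOn ℝ ∞ M.Q M.region
  smooth_C : ∀ i, ContDiffOn ℝ ∞ (M.C i) M.region
  smooth_ξ : ∀ i, ContDiffOn ℝ ∞ (M.ξ i) M.region
  symm : ∀ x ∈ M.region, (M.g x).IsSymm
  ll : ∀ x ∈ M.region, metricC M.g x lVec lVec = 0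
  ln : ∀ x ∈ M.region, metricC M.g x lVec (M.nVec x) = 1
  nn : ∀ x ∈ M.region, metricC M.g x (M.nVec x) (M.nVec x) = 0
  lm : ∀ x ∈ M.region, metricC M.g x lVec (M.mVec x) = 0
  nm : ∀ x ∈ M.region, metricC M.g x (M.nVec x) (M.mVec x) = 0
  mm : ∀ x ∈ M.region, metricC M.g x (M.mVec x) (M.mVec x) = 0
  mmbar : ∀ x ∈ M.region, metricC M.g x (M.mVec x) (M.mbarVec x) = -1
  epsilon : ∀ x ∈ M.region, metricC M.g x (M.nablaLM x) (M.mbarVec x) = 0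

/-- The vacuum Einstein equations. -/
def IsVacuum (M : NullChart) : Prop := ∀ x ∈ M.region, ∀ a b, ricci M.g a b x = 0

/-- Polyhomogeneous asymptotic flatness: the tetrad components are polyhomogeneous at null infinity
and their leading terms are those of Minkowski space,
`Q → -1/2`, `C^i → 0`, `ξ^θ = 1/(√2 r) + ⋯`, `ξ^φ = -i/(√2 r sin θ) + ⋯`. -/
structure IsPolyhomogeneousFlat (M : NullChart) : Prop where
  Q_exp : IsPolyhomogeneous M.scri (fun p r => M.Q (pt p r) + 1 / 2) 1
  C_exp : ∀ i, IsPolyhomogeneous M.scri (fun p r => M.C i (pt p r)) 1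
  ξθ_exp : IsPolyhomogeneous M.scri
    (fun p r => M.ξ 0 (pt p r) - 1 / ((Real.sqrt 2 * r : ℝ) : ℂ)) 2
  ξφ_exp : IsPolyhomogeneous M.scri
    (fun p r => M.ξ 1 (pt p r) + Complex.I / ((Real.sqrt 2 * r * Real.sin (p 1) : ℝ) : ℂ)) 2

/-- Equality of all coordinates but `φ`. -/
def SameOrbit (x y : Pt) : Prop := x 0 = y 0 ∧ x 1 = y 1 ∧ x 2 = y 2

/-- Axial symmetry, in adapted coordinates and with an adapted tetrad: the domain is invariant
under shifts of `φ`, and nothing depends on `φ`.  In particular `∂_φ` is a Killing vector. -/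
structure IsAxisymmetric (M : NullChart) : Prop where
  scri_inv : ∀ p ∈ M.scri, ∀ φ : ℝ, Function.update p 2 φ ∈ M.scri
  region_inv : ∀ x ∈ M.region, ∀ φ : ℝ, Function.update x 3 φ ∈ M.region
  g_inv : ∀ x ∈ M.region, ∀ y ∈ M.region, SameOrbit x y → M.g x = M.g y
  Q_inv : ∀ x ∈ M.region, ∀ y ∈ M.region, SameOrbit x y → M.Q x = M.Q y
  C_inv : ∀ x ∈ M.region, ∀ y ∈ M.region, SameOrbit x y → ∀ i, M.C i x = M.C i y
  ξ_inv : ∀ x ∈ M.region, ∀ y ∈ M.region, SameOrbit x y → ∀ i, M.ξ i x = M.ξ i y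

/-- `X` is a boost-rotation Killing vector of an axisymmetric spacetime: a Killing vector that
commutes with `∂_φ`, whose tetrad components `a`, `b`, `c` are polyhomogeneous of order `r`
(that is: `X^u`, `X^r` start at order `r` and `X^θ`, `X^φ` at order `1`), and which, on null
infinity, is not a combination of a supertranslation and a rotation about the axis: `X^θ` does not
tend to zero along every generator.  (By the Killing equations the limit of
`(X^u, X^r / r, X^θ, X^φ)` is then `(-κ u cos θ + α(θ), κ cos θ, -κ sin θ, ω)`, `κ ≠ 0`.) -/
structure IsBoostRotationKilling (M : NullChart) (X : Fin 4 → Pt → ℝ) : Prop where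
  smooth : ∀ a, ContDiffOn ℝ ∞ (X a) M.region
  killing : ∀ x ∈ M.region, ∀ a b, lieMetric M.g X a b x = 0
  commutes : ∀ x ∈ M.region, ∀ y ∈ M.region, SameOrbit x y → ∀ a, X a x = X a y
  Xu_exp : IsPolyhomogeneous M.scri (fun p r => X 0 (pt p r)) (-1)
  Xr_exp : IsPolyhomogeneous M.scri (fun p r => X 1 (pt p r)) (-1)
  Xθ_exp : IsPolyhomogeneous M.scri (fun p r => X 2 (pt p r)) 0
  Xφ_exp : IsPolyhomogeneous M.scri (fun p r => X 3 (pt p r)) 0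
  boost : ∃ p ∈ M.scri,
    ¬ Filter.Tendsto (fun r => X 2 (pt p r)) Filter.atTop (𝓝 0)

/-- A boost-rotation symmetric spacetime: axial symmetry together with a boost-rotation
Killing vector. -/
def IsBoostRotationSymmetric (M : NullChart) : Prop :=
  M.IsAxisymmetric ∧ ∃ X : Fin 4 → Pt → ℝ, M.IsBoostRotationKilling X

/-- The `Ψ₀` of a "minimal" polyhomogeneous spacetime,
`Ψ₀ = ψ_{4,0} r⁻⁴ + (ψ_{5,0} + ψ_{5,1} ln r) r⁻⁵ + (ψ_{6,0} + ψ_{6,1} ln r) r⁻⁶ + ⋯`,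
with no restriction on the powers of `ln r` at orders beyond the sixth. -/
def HasMinimalPsi0 (M : NullChart) (ψ : ℤ → ℕ → Scri → ℂ) : Prop :=
  ∃ N : ℤ → ℕ, N 4 = 0 ∧ N 5 = 1 ∧ N 6 = 1 ∧
    HasPolyExpansion M.scri (fun p r => M.Psi0 (pt p r)) 4 N ψ

/-! ### Pieces of null infinity with spherical cuts -/

/-- The point `(u, n)` of `ℝ × S²`, `S² ⊆ ℝ³`, with spherical coordinates `p = (u, θ, φ)`. -/
def sphPt (p : Scri) : Fin 4 → ℝ :=
  ![p 0, Real.sin (p 1) * Real.cos (p 2), Real.sin (p 1) * Real.sin (p 2), Real.cos (p 1)]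

/-- The Jacobian matrix of `(u, r, θ, φ) ↦ (u, r n(θ, φ))`. -/
def sphJac (p : Scri) (r : ℝ) : Matrix (Fin 4) (Fin 4) ℝ :=
  !![1, 0, 0, 0;
     0, Real.sin (p 1) * Real.cos (p 2), r * (Real.cos (p 1) * Real.cos (p 2)),
        -(r * (Real.sin (p 1) * Real.sin (p 2)));
     0, Real.sin (p 1) * Real.sin (p 2), r * (Real.cos (p 1) * Real.sin (p 2)),
        r * (Real.sin (p 1) * Real.cos (p 2));
     0, Real.cos (p 1), -(r * Real.sin (p 1)), 0]

/-- Null infinity contains a piece `(u₁, u₂) × S²` with complete spherical cuts, poles included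
(so it is not merely "local").  The chart covers `(u₁, u₂) × (S² ∖ {poles})`, and near
this piece the metric extends to a polyhomogeneous metric on
`(u₁, u₂) × {r large} × S²`: its components `H_{μν}` in the Cartesian coordinates
`(u, r n)`, `n ∈ S² ⊆ ℝ³`, which are regular at the poles, are bounded polyhomogeneous functions
over `(u₁, u₂) × S²` (expressed through functions of `(u, y)` for `y` in `ℝ³ ∖ {0}`, of which only
the values at `|y| = 1` matter). -/
def HasSphericalPiece (M : NullChart) : Prop :=
  ∃ (u₁ u₂ : ℝ) (H : Fin 4 → Fin 4 → (Fin 4 → ℝ) → ℝ → ℝ), u₁ < u₂ ∧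
    (∀ p : Scri, p 0 ∈ Set.Ioo u₁ u₂ → p 1 ∈ Set.Ioo 0 Real.pi → p ∈ M.scri) ∧
    (∀ μ ν, IsPolyhomogeneous
      {q : Fin 4 → ℝ | q 0 ∈ Set.Ioo u₁ u₂ ∧ ¬ (q 1 = 0 ∧ q 2 = 0 ∧ q 3 = 0)} (H μ ν) 0) ∧
    ∀ v₁ v₂ : ℝ, u₁ < v₁ → v₂ < u₂ →
      ∃ R : ℝ, ∀ p : Scri, p 0 ∈ Set.Icc v₁ v₂ → p 1 ∈ Set.Ioo 0 Real.pi → ∀ r, R < r →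
        pt p r ∈ M.region ∧
        ∀ a b, M.g (pt p r) a b =
          ∑ μ, ∑ ν, sphJac p r μ a * sphJac p r ν b * H μ ν (sphPt p) r

end NullChart

end BoostRot

end

set_option linter.unusedSimpArgs false
set_option linter.unusedSectionVars false

noncomputable section

namespace BoostRot

/-! ### Differential geometry over a ring with commuting derivations -/

/-! The proof is a comparison of orders in `1/r` along the outgoing null generators. Two classes of
functions do the bookkeeping. `Fn.B D k` consists of the functions that are `O(r^{-k+δ})` for every
`δ > 0`, together with their derivatives, so powers of `ln r` are invisible to it. `Fn.L D k`
consists of those whose term at `r^{-k}` carries no logarithm, which is expressed by `∂_r f + (k/r)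
f` being two orders smaller. In these classes the Newman–Penrose equations are linear equations
along the generators. With `Ψ₀ = O(r⁻⁴)`, up to logarithms, they give the decay of all spin
coefficients and of `Ψ₁` and `Ψ₂`.

The Killing equations for the components of `m` reduce at leading order to two statements about `χ =
lim X^θ`, namely `∂_θ χ = - lim X^r / r` (`w_H_L`) and `cot θ χ = - lim X^r / r` (`J_L`). The
equation for `C^θ` gives `∂_u χ = 0`. Hence `χ = κ sin θ`, and `κ ≠ 0` because `X` is not
asymptotically a supertranslation plus a rotation.

A Killing vector preserves the curvature, so `X Ψ₀ = -2 (∂_r X^r + w) Ψ₀ - 4 (m X^u) Ψ₁`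
(`killing_Psi0`). With `X^r ≈ -r cot θ χ`, a term `ψ r^{-k}` of `Ψ₀` contributes `χ (∂_θ ψ + (k - 2)
cot θ ψ) r^{-k}`, while `X^u ∂_u Ψ₀` and `(m X^u) Ψ₁` are of order `r⁻⁵`. At order `r⁻⁴` this gives
`∂_θ ψ + 2 cot θ ψ = 0` for `ψ = Ψ₀^{4,0}`. The same expression is the source of a possible term
`r⁻⁴ ln r` in `Ψ₁` in the Bianchi identity, so `Ψ₁` has no such term, and then `∂_u Ψ₀` has no term
`r⁻⁵ ln r`. The coefficient of `r⁻⁵ ln r` in the Killing equation therefore involves `Ψ₀^{5,1}`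
alone, which gives `∂_θ ψ + 3 cot θ ψ = 0`. The Bianchi identity along `n` removes the dependence on
`u`, and axial symmetry that on `φ`. Integration over the connected set `scri` yields the constants
(`Tetrad.Flat.coefficients`, `exists_constants`).

For complete spherical cuts the coefficients are recovered from the metric of the cuts. With `z =
1/r` one has `r² ∂_r = -∂_z`, and the rescaled metric of the cuts satisfies a closed system in `z`
with source `r⁴ Ψ₀`. The coefficient `Ψ₀^{4,0}` is thus a polynomial in the coefficients of the
metric at the first two orders, and `Ψ₀^{5,1}` is a multiple of the coefficient of `z³ ln z`
(`metric_jets`, `coefficients_of_cut`). If the Cartesian components of the metric extend over the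
poles, these expressions are continuous along a whole meridian, poles included, whereas `C csc^n θ`
is continuous there only for `C = 0`.

The geometry is carried out over an abstract ring with commuting derivations, so that every identity
among tensors becomes a ring identity. The ring is later taken to be the smooth complex functions
near null infinity. -/

/-- A metric with its Levi-Civita connection, over a ring with four commuting derivations. -/
structure Geo (A : Type*) [CommRing A] [Algebra ℂ A] where
  d : Fin 4 → Derivation ℂ A A
  d_comm : ∀ a b f, d a (d b f) = d b (d a f)
  g : Fin 4 → Fin 4 → A
  g_symm : ∀ a b, g a b = g b a
  Γ : Fin 4 → Fin 4 → Fin 4 → A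
  Γ_symm : ∀ a b c, Γ a b c = Γ a c b
  compat : ∀ a b c, d c (g a b) = ∑ e, (Γ e c a * g e b + Γ e c b * g a e)

namespace Geo

variable {A : Type*} [CommRing A] [Algebra ℂ A] (G : Geo A)

/-- The derivative of a function along a vector field. -/
def Dv (V : Fin 4 → A) (f : A) : A := ∑ c, V c * G.d c f

/-- The Lie bracket of vector fields. -/
def br (V W : Fin 4 → A) : Fin 4 → A := fun a => G.Dv V (W a) - G.Dv W (V a)

/-- The covariant derivative along a coordinate vector field. -/
def nabc (c : Fin 4) (V : Fin 4 → A) : Fin 4 → A := fun a => G.d c (V a) + ∑ b, G.Γ a c b * V b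

/-- The covariant derivative `∇_V W`. -/
def nab (V W : Fin 4 → A) : Fin 4 → A := fun a => ∑ c, V c * G.nabc c W a

def gm (V W : Fin 4 → A) : A := ∑ a, ∑ b, G.g a b * V a * W b

/-- The curvature operator `[∇_U, ∇_V] - ∇_[U,V]`. -/
def Riem (U V W : Fin 4 → A) : Fin 4 → A :=
  G.nab U (G.nab V W) - G.nab V (G.nab U W) - G.nab (G.br U V) W

def Rm (U V W Z : Fin 4 → A) : A := G.gm (G.Riem U V W) Z

section linear
variable (U V W : Fin 4 → A) (f h : A)

@[simp] lemma Dv_add : G.Dv V (f + h) = G.Dv V f + G.Dv V h := by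
  simp [Dv, mul_add, Finset.sum_add_distrib]
@[simp] lemma Dv_sub : G.Dv V (f - h) = G.Dv V f - G.Dv V h := by
  simp [Dv, mul_sub, Finset.sum_sub_distrib]
@[simp] lemma Dv_neg : G.Dv V (-f) = -G.Dv V f := by
  simp [Dv, Finset.sum_neg_distrib]
@[simp] lemma Dv_zero : G.Dv V 0 = 0 := by simp [Dv]
@[simp] lemma Dv_one : G.Dv V 1 = 0 := by simp [Dv]
@[simp] lemma Dv_mul : G.Dv V (f * h) = G.Dv V f * h + f * G.Dv V h := by
  simp only [Dv, Derivation.leibniz, smul_eq_mul, Finset.sum_mul, Finset.mul_sum,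
    ← Finset.sum_add_distrib]
  exact Finset.sum_congr rfl fun c _ => by ring
lemma Dv_sum {ι : Type*} (s : Finset ι) (F : ι → A) :
    G.Dv V (∑ i ∈ s, F i) = ∑ i ∈ s, G.Dv V (F i) := by
  simp only [Dv, map_sum, Finset.mul_sum]
  exact Finset.sum_comm
@[simp] lemma Dv_add_left : G.Dv (U + V) f = G.Dv U f + G.Dv V f := by
  simp [Dv, add_mul, Finset.sum_add_distrib]
@[simp] lemma Dv_smul_left : G.Dv (h • V) f = h * G.Dv V f := by
  simp [Dv, Finset.mul_sum, mul_assoc]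

/-- Second derivatives of `f` are symmetric because the coordinate derivations commute, so only the
derivatives of the components of `U` and `V` survive in the commutator. -/
lemma Dv_br : G.Dv (G.br U V) f = G.Dv U (G.Dv V f) - G.Dv V (G.Dv U f) := by
  have key : ∀ X Y : Fin 4 → A, G.Dv X (G.Dv Y f) =
      ∑ c, G.Dv X (Y c) * G.d c f + ∑ c, ∑ e, X c * Y e * G.d c (G.d e f) := by
    intro X Y
    conv_lhs => rw [show G.Dv Y f = ∑ c, Y c * G.d c f from rfl]
    rw [Dv_sum]
    simp only [Dv_mul, Finset.sum_add_distrib]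
    congr 1
    rw [Finset.sum_comm]
    refine Finset.sum_congr rfl fun c _ => ?_
    rw [Dv, Finset.mul_sum]
    exact Finset.sum_congr rfl fun e _ => by ring
  rw [key, key]
  have : ∑ c, ∑ e, V c * U e * G.d c (G.d e f) = ∑ c, ∑ e, U c * V e * G.d c (G.d e f) := by
    rw [Finset.sum_comm]
    exact Finset.sum_congr rfl fun c _ => Finset.sum_congr rfl fun e _ => by
      rw [G.d_comm]; ring
  rw [this, Dv]
  simp only [br, sub_mul, Finset.sum_sub_distrib]
  ring

lemma br_apply (a : Fin 4) : G.br V W a = G.Dv V (W a) - G.Dv W (V a) := rfl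

lemma br_anti : G.br V W = -G.br W V := by
  ext a; simp [br]

@[simp] lemma br_add_right : G.br U (V + W) = G.br U V + G.br U W := by
  ext a; simp [br]; ring
@[simp] lemma br_smul_right : G.br U (f • V) = G.Dv U f • V + f • G.br U V := by
  ext a; simp [br]; ring

lemma jacobi : G.br U (G.br V W) + G.br V (G.br W U) + G.br W (G.br U V) = 0 := by
  ext a
  simp only [Pi.add_apply, br_apply, Dv_br, Dv_sub, Pi.zero_apply]
  ring

@[simp] lemma nabc_add (c : Fin 4) : G.nabc c (V + W) = G.nabc c V + G.nabc c W := by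
  ext a; simp [nabc, mul_add, Finset.sum_add_distrib]; ring
@[simp] lemma nabc_smul (c : Fin 4) : G.nabc c (f • V) = G.d c f • V + f • G.nabc c V := by
  ext a
  simp only [nabc, Pi.smul_apply, smul_eq_mul, Derivation.leibniz, Pi.add_apply, mul_add,
    Finset.mul_sum]
  have : ∀ b, G.Γ a c b * (f * V b) = f * (G.Γ a c b * V b) := fun b => by ring
  simp only [this]
  ring

@[simp] lemma nab_add : G.nab U (V + W) = G.nab U V + G.nab U W := by
  ext a; simp [nab, mul_add, Finset.sum_add_distrib]
@[simp] lemma nab_smul : G.nab U (f • V) = G.Dv U f • V + f • G.nab U V := by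
  ext a
  simp only [nab, nabc_smul, Pi.add_apply, Pi.smul_apply, smul_eq_mul, Dv, Finset.sum_mul,
    Finset.mul_sum, ← Finset.sum_add_distrib]
  exact Finset.sum_congr rfl fun c _ => by ring
@[simp] lemma nab_zero : G.nab U 0 = 0 := by
  have := G.nab_smul U (0 : Fin 4 → A) 0
  simpa using this
@[simp] lemma nab_neg : G.nab U (-V) = -G.nab U V := by
  have := G.nab_smul U V (-1)
  simpa using this
@[simp] lemma nab_sub : G.nab U (V - W) = G.nab U V - G.nab U W := by
  rw [sub_eq_add_neg, nab_add, nab_neg, sub_eq_add_neg]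
@[simp] lemma nab_add_left : G.nab (U + V) W = G.nab U W + G.nab V W := by
  ext a; simp [nab, add_mul, Finset.sum_add_distrib]
@[simp] lemma nab_smul_left : G.nab (f • U) V = f • G.nab U V := by
  ext a; simp [nab, Finset.mul_sum, mul_assoc]
@[simp] lemma nab_zero_left : G.nab 0 V = 0 := by
  ext a; simp [nab]
@[simp] lemma nab_neg_left : G.nab (-U) V = -G.nab U V := by
  ext a; simp [nab, Finset.sum_neg_distrib]
@[simp] lemma nab_sub_left : G.nab (U - V) W = G.nab U W - G.nab V W := by
  rw [sub_eq_add_neg, nab_add_left, nab_neg_left, sub_eq_add_neg]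

lemma gm_symm : G.gm V W = G.gm W V := by
  rw [gm, gm, Finset.sum_comm]
  exact Finset.sum_congr rfl fun a _ => Finset.sum_congr rfl fun b _ => by
    rw [G.g_symm]; ring
@[simp] lemma gm_add_left : G.gm (U + V) W = G.gm U W + G.gm V W := by
  simp only [gm, Pi.add_apply, mul_add, add_mul, Finset.sum_add_distrib]
@[simp] lemma gm_smul_left : G.gm (f • U) W = f * G.gm U W := by
  simp only [gm, Pi.smul_apply, smul_eq_mul, Finset.mul_sum]
  exact Finset.sum_congr rfl fun a _ => Finset.sum_congr rfl fun b _ => by ring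
@[simp] lemma gm_neg_left : G.gm (-U) W = -G.gm U W := by
  have := G.gm_smul_left U W (-1)
  simpa using this
@[simp] lemma gm_zero_left : G.gm 0 W = 0 := by simp [gm]
@[simp] lemma gm_sub_left : G.gm (U - V) W = G.gm U W - G.gm V W := by
  rw [sub_eq_add_neg, gm_add_left, gm_neg_left, sub_eq_add_neg]
@[simp] lemma gm_add_right : G.gm W (U + V) = G.gm W U + G.gm W V := by
  rw [gm_symm, gm_add_left, G.gm_symm U, G.gm_symm V]
@[simp] lemma gm_smul_right : G.gm W (f • U) = f * G.gm W U := by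
  rw [gm_symm, gm_smul_left, G.gm_symm U]
@[simp] lemma gm_sub_right : G.gm W (U - V) = G.gm W U - G.gm W V := by
  rw [gm_symm, gm_sub_left, G.gm_symm U, G.gm_symm V]

lemma nab_torsion : G.nab U V - G.nab V U = G.br U V := by
  ext a
  simp only [nab, nabc, mul_add, Finset.sum_add_distrib, Pi.sub_apply, br, Dv]
  have : ∑ c, U c * ∑ b, G.Γ a c b * V b = ∑ c, V c * ∑ b, G.Γ a c b * U b := by
    simp only [Finset.mul_sum]
    rw [Finset.sum_comm]
    exact Finset.sum_congr rfl fun c _ => Finset.sum_congr rfl fun e _ => by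
      rw [G.Γ_symm]; ring
  rw [this]; ring

lemma d_gm (c : Fin 4) : G.d c (G.gm V W) = G.gm (G.nabc c V) W + G.gm V (G.nabc c W) := by
  have h1 : G.d c (G.gm V W) = ∑ a, ∑ b, (G.d c (G.g a b) * V a * W b
      + G.g a b * G.d c (V a) * W b + G.g a b * V a * G.d c (W b)) := by
    simp only [gm, map_sum, Derivation.leibniz, smul_eq_mul]
    exact Finset.sum_congr rfl fun a _ => Finset.sum_congr rfl fun b _ => by ring
  have h2 : G.gm (G.nabc c V) W = ∑ a, ∑ b, (G.g a b * G.d c (V a) * W b)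
      + ∑ a, ∑ b, ∑ e, G.Γ e c a * G.g e b * V a * W b := by
    have : ∀ a b, G.g a b * G.nabc c V a * W b = G.g a b * G.d c (V a) * W b
        + ∑ e, G.g a b * (G.Γ a c e * V e) * W b := fun a b => by
      rw [nabc, mul_add, add_mul, Finset.mul_sum, Finset.sum_mul]
    simp only [gm, this, Finset.sum_add_distrib]
    congr 1
    have e1 : ∀ F : Fin 4 → Fin 4 → Fin 4 → A,
        ∑ a, ∑ b, ∑ e, F a b e = ∑ e, ∑ b, ∑ a, F a b e := fun F => by
      rw [Finset.sum_comm]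
      rw [Finset.sum_congr rfl fun b _ => Finset.sum_comm]
      rw [Finset.sum_comm]
    rw [e1]
    exact Finset.sum_congr rfl fun a _ => Finset.sum_congr rfl fun b _ =>
      Finset.sum_congr rfl fun e _ => by ring
  have h3 : G.gm V (G.nabc c W) = ∑ a, ∑ b, (G.g a b * V a * G.d c (W b))
      + ∑ a, ∑ b, ∑ e, G.Γ e c b * G.g a e * V a * W b := by
    have : ∀ a b, G.g a b * V a * G.nabc c W b = G.g a b * V a * G.d c (W b)
        + ∑ e, G.g a b * V a * (G.Γ b c e * W e) := fun a b => by
      rw [nabc, mul_add, Finset.mul_sum]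
    simp only [gm, this, Finset.sum_add_distrib]
    congr 1
    refine Finset.sum_congr rfl fun a _ => ?_
    rw [Finset.sum_comm]
    exact Finset.sum_congr rfl fun b _ =>
      Finset.sum_congr rfl fun e _ => by ring
  rw [h1, h2, h3]
  simp only [← Finset.sum_add_distrib]
  refine Finset.sum_congr rfl fun a _ => Finset.sum_congr rfl fun b _ => ?_
  rw [G.compat, Finset.sum_mul, Finset.sum_mul]
  simp only [add_mul, Finset.sum_add_distrib]
  ring

lemma gm_compat : G.Dv U (G.gm V W) = G.gm (G.nab U V) W + G.gm V (G.nab U W) := by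
  have e : ∀ V, G.nab U V = ∑ c, U c • G.nabc c V := fun V => by
    ext a; simp [nab]
  have sl : ∀ (F : Fin 4 → Fin 4 → A) (W : Fin 4 → A),
      G.gm (∑ c, F c) W = ∑ c, G.gm (F c) W := fun F W => by
    simp [Fin.sum_univ_four]
  have sr : ∀ (F : Fin 4 → Fin 4 → A) (W : Fin 4 → A),
      G.gm W (∑ c, F c) = ∑ c, G.gm W (F c) := fun F W => by
    simp [Fin.sum_univ_four]
  rw [e, e, sl, sr, Dv, ← Finset.sum_add_distrib]
  exact Finset.sum_congr rfl fun c _ => by rw [d_gm]; simp; ring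

end linear

/-! ### Symmetries of the curvature and the Bianchi identities -/

section curvature
variable (U V W Z X Y : Fin 4 → A) (f h : A)

lemma Riem_anti : G.Riem U V W = -G.Riem V U W := by
  simp only [Riem]
  rw [G.br_anti U V, nab_neg_left]
  abel

@[simp] lemma Riem_add_left : G.Riem (U + X) V W = G.Riem U V W + G.Riem X V W := by
  simp only [Riem]
  have : G.br (U + X) V = G.br U V + G.br X V := by
    ext a; simp [br]; ring
  rw [this]; simp only [nab_add_left, nab_add]
  abel
@[simp] lemma Riem_smul_left : G.Riem (f • U) V W = f • G.Riem U V W := by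
  simp only [Riem]
  have : G.br (f • U) V = f • G.br U V - G.Dv V f • U := by
    ext a; simp [br]; ring
  rw [this]; simp only [nab_smul_left, nab_smul, nab_sub_left]
  module
@[simp] lemma Riem_add_mid : G.Riem U (V + X) W = G.Riem U V W + G.Riem U X W := by
  rw [Riem_anti, Riem_add_left, G.Riem_anti U V, G.Riem_anti U X]; abel
@[simp] lemma Riem_smul_mid : G.Riem U (f • V) W = f • G.Riem U V W := by
  rw [Riem_anti, Riem_smul_left, G.Riem_anti U V]; module
@[simp] lemma Riem_add_right : G.Riem U V (W + X) = G.Riem U V W + G.Riem U V X := by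
  simp only [Riem, nab_add]; abel
-- Tensoriality in the last argument: the mixed first derivatives of `f` cancel in the commutator,
-- and the second derivatives cancel against the bracket term by `Dv_br`.
@[simp] lemma Riem_smul_right : G.Riem U V (f • W) = f • G.Riem U V W := by
  simp only [Riem, nab_smul, nab_add, Dv_br]
  module

@[simp] lemma Rm_add₁ : G.Rm (U + X) V W Z = G.Rm U V W Z + G.Rm X V W Z := by simp [Rm]
@[simp] lemma Rm_add₂ : G.Rm U (V + X) W Z = G.Rm U V W Z + G.Rm U X W Z := by simp [Rm]
@[simp] lemma Rm_add₃ : G.Rm U V (W + X) Z = G.Rm U V W Z + G.Rm U V X Z := by simp [Rm]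
@[simp] lemma Rm_add₄ : G.Rm U V W (Z + X) = G.Rm U V W Z + G.Rm U V W X := by simp [Rm]
@[simp] lemma Rm_smul₁ : G.Rm (f • U) V W Z = f * G.Rm U V W Z := by simp [Rm]
@[simp] lemma Rm_smul₂ : G.Rm U (f • V) W Z = f * G.Rm U V W Z := by simp [Rm]
@[simp] lemma Rm_smul₃ : G.Rm U V (f • W) Z = f * G.Rm U V W Z := by simp [Rm]
@[simp] lemma Rm_smul₄ : G.Rm U V W (f • Z) = f * G.Rm U V W Z := by simp [Rm]
@[simp] lemma Rm_neg₁ : G.Rm (-U) V W Z = -G.Rm U V W Z := by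
  simpa using G.Rm_smul₁ U V W Z (-1)
@[simp] lemma Rm_neg₂ : G.Rm U (-V) W Z = -G.Rm U V W Z := by
  simpa using G.Rm_smul₂ U V W Z (-1)
@[simp] lemma Rm_neg₃ : G.Rm U V (-W) Z = -G.Rm U V W Z := by
  simpa using G.Rm_smul₃ U V W Z (-1)
@[simp] lemma Rm_neg₄ : G.Rm U V W (-Z) = -G.Rm U V W Z := by
  simpa using G.Rm_smul₄ U V W Z (-1)
@[simp] lemma Rm_sub₁ : G.Rm (U - X) V W Z = G.Rm U V W Z - G.Rm X V W Z := by
  simp [sub_eq_add_neg]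
@[simp] lemma Rm_sub₂ : G.Rm U (V - X) W Z = G.Rm U V W Z - G.Rm U X W Z := by
  simp [sub_eq_add_neg]
@[simp] lemma Rm_sub₃ : G.Rm U V (W - X) Z = G.Rm U V W Z - G.Rm U V X Z := by
  simp [sub_eq_add_neg]
@[simp] lemma Rm_sub₄ : G.Rm U V W (Z - X) = G.Rm U V W Z - G.Rm U V W X := by
  simp [sub_eq_add_neg]
@[simp] lemma Rm_zero₃ : G.Rm U V 0 Z = 0 := by
  simpa using G.Rm_smul₃ U V 0 Z 0

lemma Rm_anti₁₂ : G.Rm U V W Z = -G.Rm V U W Z := by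
  rw [Rm, Riem_anti, gm_neg_left, Rm]

/-- The operator `[U, V]` acts on the function `g(W, Z)` as a commutator of derivatives. Expanding
both sides by metric compatibility leaves exactly the two curvature terms. -/
lemma Rm_anti₃₄ : G.Rm U V W Z = -G.Rm U V Z W := by
  have h1 := congrArg (G.Dv U) (G.gm_compat V W Z)
  have h2 := congrArg (G.Dv V) (G.gm_compat U W Z)
  have h3 := G.gm_compat (G.br U V) W Z
  rw [Dv_br] at h3
  simp only [Dv_add, gm_compat] at h1 h2 h3
  simp only [Rm, Riem, gm_sub_left]
  rw [G.gm_symm (G.nab U (G.nab V Z)), G.gm_symm (G.nab V (G.nab U Z)),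
    G.gm_symm (G.nab (G.br U V) Z)]
  linear_combination h3

/-- This is the Jacobi identity with each bracket rewritten through the torsion-free connection. -/
lemma bianchi_first : G.Riem U V W + G.Riem V W U + G.Riem W U V = 0 := by
  have t := fun X Y : Fin 4 → A => G.nab_torsion X Y
  have j := G.jacobi U V W
  rw [← t U (G.br V W), ← t V (G.br W U), ← t W (G.br U V)] at j
  have r : ∀ X Y Z : Fin 4 → A, G.nab X (G.br Y Z) = G.nab X (G.nab Y Z) - G.nab X (G.nab Z Y) :=
    fun X Y Z => by rw [← t, nab_sub]
  rw [r, r, r] at j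
  simp only [Riem]
  rw [← j]; abel

lemma Rm_cyc : G.Rm U V W Z + G.Rm V W U Z + G.Rm W U V Z = 0 := by
  rw [Rm, Rm, Rm, ← gm_add_left, ← gm_add_left, bianchi_first, gm_zero_left]

/-- The ring is a `ℂ`-algebra, so `2` is invertible. -/
lemma two_cancel {x : A} (hx : 2 * x = 0) : x = 0 := by
  have h : (algebraMap ℂ A (1 / 2)) * (2 : A) = 1 := by
    rw [show (2 : A) = algebraMap ℂ A 2 from (map_ofNat _ 2).symm, ← map_mul]; norm_num
  calc x = (algebraMap ℂ A (1 / 2)) * (2 * x) := by rw [← mul_assoc, h, one_mul]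
    _ = 0 := by rw [hx, mul_zero]

/-- The usual combination of the four cyclic identities for the four cyclic arrangements of the
arguments gives twice the difference. -/
lemma Rm_pair : G.Rm U V W Z = G.Rm W Z U V := by
  have a := G.Rm_cyc U V W Z
  have b := G.Rm_cyc V W Z U
  have c := G.Rm_cyc W Z U V
  have e := G.Rm_cyc Z U V W
  rw [← sub_eq_zero]
  apply two_cancel
  have s := fun p q r t : Fin 4 → A => G.Rm_anti₃₄ p q r t
  have s' := fun p q r t : Fin 4 → A => G.Rm_anti₁₂ p q r t
  rw [s V W Z U, s W Z V U, s' Z V W U, s V Z W U] at b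
  rw [s' U W Z V, s W U Z V] at c
  rw [s Z U V W, s U V Z W] at e
  linear_combination a + b - c - e

/-- The differential Bianchi identity, contracted with five vector fields. -/
lemma bianchi_second (P Q R V W : Fin 4 → A) :
    (G.Dv P (G.Rm Q R V W) - G.Rm Q R (G.nab P V) W - G.Rm Q R V (G.nab P W)
        + G.Rm P (G.br Q R) V W)
      + (G.Dv Q (G.Rm R P V W) - G.Rm R P (G.nab Q V) W - G.Rm R P V (G.nab Q W)
        + G.Rm Q (G.br R P) V W)
      + (G.Dv R (G.Rm P Q V W) - G.Rm P Q (G.nab R V) W - G.Rm P Q V (G.nab R W)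
        + G.Rm R (G.br P Q) V W) = 0 := by
  have j : G.nab (G.br P (G.br Q R) + G.br Q (G.br R P) + G.br R (G.br P Q)) V = 0 := by
    rw [jacobi, nab_zero_left]
  have v : (G.nab P (G.Riem Q R V) - G.Riem Q R (G.nab P V) + G.Riem P (G.br Q R) V)
      + (G.nab Q (G.Riem R P V) - G.Riem R P (G.nab Q V) + G.Riem Q (G.br R P) V)
      + (G.nab R (G.Riem P Q V) - G.Riem P Q (G.nab R V) + G.Riem R (G.br P Q) V) = 0 := by
    simp only [Riem, nab_sub, nab_add_left] at j ⊢
    rw [← neg_eq_zero] at j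
    rw [← j]; abel
  have := congrArg (fun T => G.gm T W) v
  simp only [gm_add_left, gm_sub_left, gm_zero_left] at this
  simp only [Rm, gm_compat]
  linear_combination this

lemma Rm_same₁₂ : G.Rm V V W Z = 0 := two_cancel (by linear_combination G.Rm_anti₁₂ V V W Z)
lemma Rm_same₃₄ : G.Rm V W Z Z = 0 := two_cancel (by linear_combination G.Rm_anti₃₄ V W Z Z)

variable {V W} in
/-- Differentiating a constant scalar product. -/
lemma gm_nab_swap (h : G.Dv U (G.gm V W) = 0) :
    G.gm (G.nab U W) V = -G.gm (G.nab U V) W := by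
  rw [gm_compat, G.gm_symm V] at h
  linear_combination h

variable {V} in
lemma gm_nab_self (h : G.gm V V = 0) : G.gm (G.nab U V) V = 0 := by
  have := G.gm_nab_swap U (V := V) (W := V) (by rw [h]; simp)
  exact two_cancel (by linear_combination this)

end curvature

/-! ### The curvature in components -/

section coordinates

/-- The components `R^a_{bcd}`. -/
def curv (a b c e : Fin 4) : A :=
  G.d c (G.Γ a e b) - G.d e (G.Γ a c b) + ∑ k, (G.Γ a c k * G.Γ k e b - G.Γ a e k * G.Γ k c b)

lemma Riem_single (a b c e : Fin 4) :
    G.Riem (Pi.single c 1) (Pi.single e 1) (Pi.single b 1) a = G.curv a b c e := by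
  have h0 : ∀ x : A, G.br (Pi.single c 1) (Pi.single e x) = Pi.single e (G.d c x) := by
    intro x; ext k
    have : G.Dv (Pi.single e x) (Pi.single (M := fun _ => A) c 1 k) = 0 := by
      by_cases hk : k = c
      · subst hk; simp
      · simp [hk]
    rw [br_apply, this, sub_zero]
    by_cases hk : k = e
    · subst hk; simp [Dv, Pi.single_apply]
    · simp [hk]
  have h1 : ∀ (c : Fin 4) V, G.nab (Pi.single c 1) V = G.nabc c V := fun c V => by
    ext k; simp [nab, Pi.single_apply]
  have h2 : ∀ c : Fin 4, G.nabc c (Pi.single b 1) = fun k => G.Γ k c b := fun c => by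
    ext k
    have : G.d c (Pi.single (M := fun _ => A) b 1 k) = 0 := by
      by_cases hk : k = b
      · subst hk; simp
      · simp [hk]
    rw [nabc, this]; simp [Pi.single_apply]
  have := h0 1
  simp only [Derivation.map_one_eq_zero, Pi.single_zero] at this
  rw [Riem, this, nab_zero_left, sub_zero, h1, h1, h1, h1, h2, h2]
  simp only [Pi.sub_apply, nabc, curv, Finset.sum_sub_distrib]
  ring

lemma Riem_apply (U V W : Fin 4 → A) (a : Fin 4) :
    G.Riem U V W a = ∑ b, ∑ c, ∑ e, G.curv a b c e * W b * U c * V e := by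
  have s1 : ∀ (F : Fin 4 → Fin 4 → A) (V W : Fin 4 → A),
      G.Riem (∑ c, F c) V W = ∑ c, G.Riem (F c) V W := fun F V W => by
    simp [Fin.sum_univ_four]
  have s2 : ∀ (F : Fin 4 → Fin 4 → A) (V W : Fin 4 → A),
      G.Riem V (∑ c, F c) W = ∑ c, G.Riem V (F c) W := fun F V W => by
    simp [Fin.sum_univ_four]
  have s3 : ∀ (F : Fin 4 → Fin 4 → A) (V W : Fin 4 → A),
      G.Riem V W (∑ c, F c) = ∑ c, G.Riem V W (F c) := fun F V W => by
    simp [Fin.sum_univ_four]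
  have vec_eq_sum : ∀ V : Fin 4 → A, V = ∑ c, V c • Pi.single (M := fun _ => A) c 1 :=
    fun V => by ext a; simp [Pi.single_apply]
  conv_lhs => rw [vec_eq_sum W, s3, vec_eq_sum U, vec_eq_sum V]
  simp only [s1, s2, Riem_smul_left, Riem_smul_mid, Riem_smul_right, Finset.sum_apply,
    Pi.smul_apply, Riem_single, smul_eq_mul]
  exact Finset.sum_congr rfl fun b _ => Finset.sum_congr rfl fun c _ =>
    Finset.sum_congr rfl fun e _ => by ring

end coordinates

/-! ### Invariance of the connection and the curvature under a Killing vector -/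

section killing
variable {G} {X : Fin 4 → A}
  (hX : ∀ V W, G.Dv X (G.gm V W) = G.gm (G.br X V) W + G.gm V (G.br X W))
  (nondeg : ∀ V, (∀ W, G.gm V W = 0) → V = 0)
include hX nondeg

/-- Killing vectors preserve the Levi-Civita connection. -/
lemma killing_nab (U V : Fin 4 → A) :
    G.br X (G.nab U V) = G.nab (G.br X U) V + G.nab U (G.br X V) := by
  -- `T` is the failure of `X` to preserve `∇`. It is symmetric in its two arguments (Jacobi and
  -- vanishing torsion), while `g(T U V, W)` is skew in `V`, `W` (Killing and metric compatibility).
  -- An expression symmetric in one pair of arguments and skew in the other vanishes, by the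
  -- permutation argument that also gives uniqueness of the Levi-Civita connection.
  set T : (Fin 4 → A) → (Fin 4 → A) → (Fin 4 → A) := fun U V =>
    G.br X (G.nab U V) - (G.nab (G.br X U) V + G.nab U (G.br X V)) with hT
  have sym : ∀ U V, T U V = T V U := by
    intro U V
    have j := G.jacobi X U V
    rw [G.br_anti V X, ← G.nab_torsion U V] at j
    have e1 : G.br X (G.nab U V - G.nab V U) = G.br X (G.nab U V) - G.br X (G.nab V U) := by
      rw [sub_eq_add_neg, show -G.nab V U = (-1 : A) • G.nab V U by simp, br_add_right,
        br_smul_right]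
      simp [sub_eq_add_neg]
    have e2 : G.br U (-G.br X V) = -G.br U (G.br X V) := by
      rw [show -G.br X V = (-1 : A) • G.br X V by simp, br_smul_right]; simp
    rw [e1, e2, G.br_anti V (G.br X U), ← G.nab_torsion U (G.br X V),
      ← G.nab_torsion (G.br X U) V] at j
    rw [← sub_eq_zero, ← j]
    simp only [hT]; abel
  have asym : ∀ U V W, G.gm (T U V) W = -G.gm V (T U W) := by
    intro U V W
    have h1 := congrArg (G.Dv X) (G.gm_compat U V W)
    have h2 := congrArg (G.Dv U) (hX V W)
    have h3 := G.gm_compat (G.br X U) V W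
    rw [Dv_br] at h3
    simp only [Dv_add, hX, gm_compat] at h1 h2 h3
    simp only [hT, gm_sub_left, gm_add_left, gm_sub_right, gm_add_right]
    linear_combination h3
  rw [← sub_eq_zero]
  change T U V = 0
  refine nondeg _ fun W => two_cancel ?_
  have s : ∀ U V W, G.gm (T U V) W = -G.gm (T U W) V := fun U V W => by
    rw [asym, G.gm_symm V]
  have a1 := s U V W
  have a2 := s W U V
  have a3 := s V W U
  rw [sym W U] at a2; rw [sym W V] at a2; rw [sym V U] at a3
  linear_combination a1 - a2 + a3

/-- `X` acts as a derivation on brackets by the Jacobi identity and on `∇` by `killing_nab`, hence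
on the curvature operator, and on the metric by assumption. -/
lemma killing_Rm (U V W Z : Fin 4 → A) :
    G.Dv X (G.Rm U V W Z) = G.Rm (G.br X U) V W Z + G.Rm U (G.br X V) W Z
      + G.Rm U V (G.br X W) Z + G.Rm U V W (G.br X Z) := by
  have j := G.jacobi X U V
  have bj : G.br X (G.br U V) = G.br (G.br X U) V + G.br U (G.br X V) := by
    rw [G.br_anti V X, G.br_anti V (G.br X U)] at j
    have e2 : G.br U (-G.br X V) = -G.br U (G.br X V) := by
      rw [show -G.br X V = (-1 : A) • G.br X V by simp, br_smul_right]; simp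
    rw [e2] at j
    rw [← sub_eq_zero, ← j]; abel
  have k := killing_nab hX nondeg
  have sb : ∀ P Q, G.br X (P - Q) = G.br X P - G.br X Q := fun P Q => by
    rw [sub_eq_add_neg, show -Q = (-1 : A) • Q by simp, br_add_right, br_smul_right]
    simp [sub_eq_add_neg]
  have v : G.br X (G.Riem U V W) = G.Riem (G.br X U) V W + G.Riem U (G.br X V) W
      + G.Riem U V (G.br X W) := by
    simp only [Riem, sb, k, bj, nab_add_left, nab_add]
    abel
  rw [Rm, hX, v]
  simp only [Rm, gm_add_left]

end killing
end Geo
end BoostRot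
end

noncomputable section

namespace BoostRot

/-! ### The Newman–Penrose equations -/

/-- A null tetrad `l = ∂_r`, `n = ∂_u + Q ∂_r + C^i ∂_i`, `m = ξ^i ∂_i`, `m̄ = ζ^i ∂_i` of a vacuum
metric, in the gauge `ε = 0`. -/
structure Tetrad {A : Type*} [CommRing A] [Algebra ℂ A] (G : Geo A) where
  Q : A
  C : Fin 2 → A
  ξ : Fin 2 → A
  ζ : Fin 2 → A
  l : Fin 4 → A := ![0, 1, 0, 0]
  n : Fin 4 → A := ![1, Q, C 0, C 1]
  m : Fin 4 → A := ![0, 0, ξ 0, ξ 1]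
  mb : Fin 4 → A := ![0, 0, ζ 0, ζ 1]
  l_eq : l = ![0, 1, 0, 0]
  n_eq : n = ![1, Q, C 0, C 1]
  m_eq : m = ![0, 0, ξ 0, ξ 1]
  mb_eq : mb = ![0, 0, ζ 0, ζ 1]
  ll : G.gm l l = 0
  ln : G.gm l n = 1
  nn : G.gm n n = 0
  lm : G.gm l m = 0
  lmb : G.gm l mb = 0
  nm : G.gm n m = 0
  nmb : G.gm n mb = 0
  mm : G.gm m m = 0
  mbmb : G.gm mb mb = 0
  mmb : G.gm m mb = -1
  eps : G.gm (G.nab l m) mb = 0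
  complete : ∀ V, V = G.gm V n • l + G.gm V l • n - G.gm V mb • m - G.gm V m • mb
  -- This is the vanishing of the Ricci contraction, with the inverse metric written as `l ⊗ n + n ⊗
  -- l - m ⊗ mb - mb ⊗ m`.
  vac : ∀ V W, G.Rm l W V n + G.Rm n W V l - G.Rm m W V mb - G.Rm mb W V m = 0

namespace Tetrad

variable {A : Type*} [CommRing A] [Algebra ℂ A] {G : Geo A} (T : Tetrad G)

lemma mn : G.gm T.m T.n = 0 := by rw [G.gm_symm, T.nm]
lemma mbn : G.gm T.mb T.n = 0 := by rw [G.gm_symm, T.nmb]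
lemma mbm : G.gm T.mb T.m = -1 := by rw [G.gm_symm, T.mmb]

lemma nondeg (T : Tetrad G) (V : Fin 4 → A) (h : ∀ W, G.gm V W = 0) : V = 0 := by
  rw [T.complete V]; simp [h]

/-- Lowering the index of `l` gives `du`, since `n` is the only leg with a `u`-component and that
component is `1`. -/
lemma comp0 (V : Fin 4 → A) : V 0 = G.gm V T.l := by
  conv_lhs => rw [T.complete V]
  simp [T.l_eq, T.n_eq, T.m_eq, T.mb_eq]

lemma comp1 (V : Fin 4 → A) : V 1 = G.gm V T.n + G.gm V T.l * T.Q := by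
  conv_lhs => rw [T.complete V]
  simp [T.l_eq, T.n_eq, T.m_eq, T.mb_eq]

lemma comp2 (V : Fin 4 → A) :
    V 2 = G.gm V T.l * T.C 0 - G.gm V T.mb * T.ξ 0 - G.gm V T.m * T.ζ 0 := by
  conv_lhs => rw [T.complete V]
  simp [T.l_eq, T.n_eq, T.m_eq, T.mb_eq]

lemma comp3 (V : Fin 4 → A) :
    V 3 = G.gm V T.l * T.C 1 - G.gm V T.mb * T.ξ 1 - G.gm V T.m * T.ζ 1 := by
  conv_lhs => rw [T.complete V]
  simp [T.l_eq, T.n_eq, T.m_eq, T.mb_eq]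

lemma Dv_l (f : A) : G.Dv T.l f = G.d 1 f := by
  simp [Geo.Dv, T.l_eq, Fin.sum_univ_four]
lemma Dv_n (f : A) : G.Dv T.n f = G.d 0 f + T.Q * G.d 1 f + T.C 0 * G.d 2 f + T.C 1 * G.d 3 f := by
  simp [Geo.Dv, T.n_eq, Fin.sum_univ_four]
lemma Dv_m (f : A) : G.Dv T.m f = T.ξ 0 * G.d 2 f + T.ξ 1 * G.d 3 f := by
  simp [Geo.Dv, T.m_eq, Fin.sum_univ_four]
lemma Dv_mb (f : A) : G.Dv T.mb f = T.ζ 0 * G.d 2 f + T.ζ 1 * G.d 3 f := by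
  simp [Geo.Dv, T.mb_eq, Fin.sum_univ_four]

/-- `g(∇_V l, W)` is symmetric, because `l` is a gradient. -/
lemma hess_symm (V W : Fin 4 → A) : G.gm (G.nab V T.l) W = G.gm (G.nab W T.l) V := by
  have h1 := G.gm_compat V T.l W
  have h2 := G.gm_compat W T.l V
  have h3 := G.nab_torsion V W
  have h4 := T.comp0 (G.br V W)
  rw [← h3, G.gm_sub_left, h3, G.br_apply, T.comp0 V, T.comp0 W] at h4
  rw [G.gm_symm T.l W] at h1
  rw [G.gm_symm T.l V] at h2
  rw [G.gm_symm (G.nab V W)] at h4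
  rw [G.gm_symm (G.nab W V)] at h4
  linear_combination h2 - h1 + h4

/-! The spin coefficients. -/

def τ : A := G.gm (G.nab T.m T.l) T.n
def τb : A := G.gm (G.nab T.mb T.l) T.n
def ρ : A := G.gm (G.nab T.mb T.l) T.m
def σ : A := G.gm (G.nab T.m T.l) T.m
def σb : A := G.gm (G.nab T.mb T.l) T.mb
def γ : A := G.gm (G.nab T.n T.l) T.n
def lam : A := G.gm (G.nab T.m T.m) T.n
def lamb : A := G.gm (G.nab T.mb T.mb) T.n
def μ : A := G.gm (G.nab T.m T.mb) T.n
def b : A := G.gm (G.nab T.m T.m) T.mb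
def bb : A := G.gm (G.nab T.mb T.mb) T.m
def ν : A := G.gm (G.nab T.n T.m) T.n
def νb : A := G.gm (G.nab T.n T.mb) T.n
def c : A := G.gm (G.nab T.n T.m) T.mb
def Ψ0 : A := G.Rm T.l T.m T.l T.m
def Ψ1 : A := G.Rm T.l T.n T.l T.m
-- Up to sign this is `Ψ₂`.
def P2 : A := G.Rm T.n T.mb T.l T.m

lemma nab_ll : G.nab T.l T.l = 0 := by
  apply T.nondeg
  intro W
  rw [T.hess_symm, G.gm_nab_self W T.ll]

lemma nab_lm : G.nab T.l T.m = T.τ • T.l := by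
  have h0 : G.gm (G.br T.l T.m) T.n = 0 := by
    have h1 := T.comp1 (G.br T.l T.m)
    have h2 := T.comp0 (G.br T.l T.m)
    rw [← h2] at h1
    simp only [G.br_apply, T.l_eq, T.m_eq] at h1 h2 ⊢
    simpa using h1.symm
  rw [← G.nab_torsion] at h0
  simp only [Geo.gm_sub_left] at h0
  rw [T.complete (G.nab T.l T.m), T.eps, G.gm_nab_self T.l T.mm, G.gm_nab_swap T.l (V := T.l) (W := T.m) (by rw [T.lm]; simp),
    T.nab_ll]
  simp only [Geo.gm_zero_left, τ]
  rw [sub_eq_zero.mp h0]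
  simp

lemma nab_lmb : G.nab T.l T.mb = T.τb • T.l := by
  have h0 : G.gm (G.br T.l T.mb) T.n = 0 := by
    have h1 := T.comp1 (G.br T.l T.mb)
    have h2 := T.comp0 (G.br T.l T.mb)
    rw [← h2] at h1
    simp only [G.br_apply, T.l_eq, T.mb_eq] at h1 h2 ⊢
    simpa using h1.symm
  rw [← G.nab_torsion] at h0
  simp only [Geo.gm_sub_left] at h0
  rw [T.complete (G.nab T.l T.mb), G.gm_nab_self T.l T.mbmb, G.gm_nab_swap T.l (V := T.m) (W := T.mb) (by rw [T.mmb]; simp),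
    T.eps, G.gm_nab_swap T.l (V := T.l) (W := T.mb) (by rw [T.lmb]; simp), T.nab_ll]
  simp only [Geo.gm_zero_left, τb]
  rw [sub_eq_zero.mp h0]
  simp

lemma gm_ml_mb : G.gm (G.nab T.m T.l) T.mb = T.ρ := T.hess_symm _ _
lemma gm_nl_m : G.gm (G.nab T.n T.l) T.m = T.τ := T.hess_symm _ _
lemma gm_nl_mb : G.gm (G.nab T.n T.l) T.mb = T.τb := T.hess_symm _ _

lemma nab_ml : G.nab T.m T.l = T.τ • T.l - T.ρ • T.m - T.σ • T.mb := by
  rw [T.complete (G.nab T.m T.l), G.gm_nab_self T.m T.ll, T.gm_ml_mb]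
  simp [τ, σ]

lemma nab_mbl : G.nab T.mb T.l = T.τb • T.l - T.ρ • T.mb - T.σb • T.m := by
  rw [T.complete (G.nab T.mb T.l), G.gm_nab_self T.mb T.ll]
  simp only [τb, ρ, σb]; module

lemma nab_nl : G.nab T.n T.l = T.γ • T.l - T.τb • T.m - T.τ • T.mb := by
  rw [T.complete (G.nab T.n T.l), G.gm_nab_self T.n T.ll, T.gm_nl_m, T.gm_nl_mb]
  simp [γ]

lemma nab_mm : G.nab T.m T.m = T.lam • T.l - T.σ • T.n - T.b • T.m := by
  rw [T.complete (G.nab T.m T.m), G.gm_nab_self T.m T.mm, G.gm_nab_swap T.m (V := T.l) (W := T.m) (by rw [T.lm]; simp)]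
  simp only [lam, σ, b]; module

lemma nab_mbmb : G.nab T.mb T.mb = T.lamb • T.l - T.σb • T.n - T.bb • T.mb := by
  rw [T.complete (G.nab T.mb T.mb), G.gm_nab_self T.mb T.mbmb, G.gm_nab_swap T.mb (V := T.l) (W := T.mb) (by rw [T.lmb]; simp)]
  simp only [lamb, σb, bb]; module

lemma nab_mmb : G.nab T.m T.mb = T.μ • T.l - T.ρ • T.n + T.b • T.mb := by
  rw [T.complete (G.nab T.m T.mb), G.gm_nab_self T.m T.mbmb, G.gm_nab_swap T.m (V := T.l) (W := T.mb) (by rw [T.lmb]; simp),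
    G.gm_nab_swap T.m (V := T.m) (W := T.mb) (by rw [T.mmb]; simp), T.gm_ml_mb]
  simp only [μ, b]; module

/-- The bracket `[m, mb]` is tangent to the surfaces of constant `u` and `r`, so both orders of
differentiation give the same component. -/
lemma gm_mbm_n : G.gm (G.nab T.mb T.m) T.n = T.μ := by
  have h0 : G.gm (G.br T.m T.mb) T.n = 0 := by
    have h1 := T.comp1 (G.br T.m T.mb)
    have h2 := T.comp0 (G.br T.m T.mb)
    rw [← h2] at h1
    simp only [G.br_apply, T.m_eq, T.mb_eq] at h1 h2 ⊢
    simpa using h1.symm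
  rw [← G.nab_torsion] at h0
  simp only [Geo.gm_sub_left] at h0
  rw [μ]; linear_combination -h0

lemma nab_mbm : G.nab T.mb T.m = T.μ • T.l - T.ρ • T.n + T.bb • T.m := by
  rw [T.complete (G.nab T.mb T.m), G.gm_nab_self T.mb T.mm, G.gm_nab_swap T.mb (V := T.l) (W := T.m) (by rw [T.lm]; simp),
    G.gm_nab_swap T.mb (V := T.mb) (W := T.m) (by rw [T.mbm]; simp), T.gm_mbm_n]
  simp only [ρ, bb]; module

lemma nab_nm : G.nab T.n T.m = T.ν • T.l - T.τ • T.n - T.c • T.m := by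
  rw [T.complete (G.nab T.n T.m), G.gm_nab_self T.n T.mm, G.gm_nab_swap T.n (V := T.l) (W := T.m) (by rw [T.lm]; simp), T.gm_nl_m]
  simp only [ν, c]; module

lemma nab_nmb : G.nab T.n T.mb = T.νb • T.l - T.τb • T.n + T.c • T.mb := by
  rw [T.complete (G.nab T.n T.mb), G.gm_nab_self T.n T.mbmb, G.gm_nab_swap T.n (V := T.l) (W := T.mb) (by rw [T.lmb]; simp), T.gm_nl_mb,
    G.gm_nab_swap T.n (V := T.m) (W := T.mb) (by rw [T.mmb]; simp)]
  simp only [νb, c]; module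

lemma nab_mn : G.nab T.m T.n = -(T.τ • T.n) + T.lam • T.mb + T.μ • T.m := by
  rw [T.complete (G.nab T.m T.n), G.gm_nab_self T.m T.nn, G.gm_nab_swap T.m (V := T.l) (W := T.n) (by rw [T.ln]; simp),
    G.gm_nab_swap T.m (V := T.m) (W := T.n) (by rw [T.mn]; simp), G.gm_nab_swap T.m (V := T.mb) (W := T.n) (by rw [T.mbn]; simp)]
  simp only [lam, μ, τ]; module

lemma nab_mbn : G.nab T.mb T.n = -(T.τb • T.n) + T.lamb • T.m + T.μ • T.mb := by
  rw [T.complete (G.nab T.mb T.n), G.gm_nab_self T.mb T.nn, G.gm_nab_swap T.mb (V := T.l) (W := T.n) (by rw [T.ln]; simp),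
    G.gm_nab_swap T.mb (V := T.m) (W := T.n) (by rw [T.mn]; simp), G.gm_nab_swap T.mb (V := T.mb) (W := T.n) (by rw [T.mbn]; simp),
    T.gm_mbm_n]
  simp only [lamb, τb]; module

lemma nab_ln : G.nab T.l T.n = T.τ • T.mb + T.τb • T.m := by
  rw [T.complete (G.nab T.l T.n), G.gm_nab_self T.l T.nn, G.gm_nab_swap T.l (V := T.l) (W := T.n) (by rw [T.ln]; simp),
    G.gm_nab_swap T.l (V := T.m) (W := T.n) (by rw [T.mn]; simp), G.gm_nab_swap T.l (V := T.mb) (W := T.n) (by rw [T.mbn]; simp),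
    T.nab_ll, T.nab_lm, T.nab_lmb]
  simp only [Geo.gm_smul_left, T.ln, Geo.gm_zero_left]; module

lemma br_lm : G.br T.l T.m = T.ρ • T.m + T.σ • T.mb := by
  rw [← G.nab_torsion, T.nab_lm, T.nab_ml]; module
lemma br_lmb : G.br T.l T.mb = T.ρ • T.mb + T.σb • T.m := by
  rw [← G.nab_torsion, T.nab_lmb, T.nab_mbl]; module
lemma br_ln : G.br T.l T.n = -(T.γ • T.l) + (2 * T.τb) • T.m + (2 * T.τ) • T.mb := by
  rw [← G.nab_torsion, T.nab_ln, T.nab_nl]; module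
lemma br_mmb : G.br T.m T.mb = T.b • T.mb - T.bb • T.m := by
  rw [← G.nab_torsion, T.nab_mmb, T.nab_mbm]; module
lemma br_nm : G.br T.n T.m = T.ν • T.l - (T.c + T.μ) • T.m - T.lam • T.mb := by
  rw [← G.nab_torsion, T.nab_nm, T.nab_mn]; module
lemma br_nmb : G.br T.n T.mb = T.νb • T.l - (T.μ - T.c) • T.mb - T.lamb • T.m := by
  rw [← G.nab_torsion, T.nab_nmb, T.nab_mbn]; module

/-! Commutators in components. -/

lemma d_xi (i : Fin 2) : G.d 1 (T.ξ i) = T.ρ * T.ξ i + T.σ * T.ζ i := by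
  have := T.br_lm
  fin_cases i
  · have h := congrFun this 2
    simp only [G.br_apply, T.Dv_l, T.Dv_m] at h
    simpa [T.l_eq, T.m_eq, T.mb_eq] using h
  · have h := congrFun this 3
    simp only [G.br_apply, T.Dv_l, T.Dv_m] at h
    simpa [T.l_eq, T.m_eq, T.mb_eq] using h

lemma d_zeta (i : Fin 2) : G.d 1 (T.ζ i) = T.ρ * T.ζ i + T.σb * T.ξ i := by
  have := T.br_lmb
  fin_cases i
  · have h := congrFun this 2
    simp only [G.br_apply, T.Dv_l, T.Dv_mb] at h
    simpa [T.l_eq, T.m_eq, T.mb_eq] using h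
  · have h := congrFun this 3
    simp only [G.br_apply, T.Dv_l, T.Dv_mb] at h
    simpa [T.l_eq, T.m_eq, T.mb_eq] using h

lemma d_C (i : Fin 2) : G.d 1 (T.C i) = 2 * T.τb * T.ξ i + 2 * T.τ * T.ζ i := by
  have := T.br_ln
  fin_cases i
  · have h := congrFun this 2
    simp only [G.br_apply, T.Dv_l, T.Dv_n] at h
    simpa [T.l_eq, T.m_eq, T.mb_eq, T.n_eq] using h
  · have h := congrFun this 3
    simp only [G.br_apply, T.Dv_l, T.Dv_n] at h
    simpa [T.l_eq, T.m_eq, T.mb_eq, T.n_eq] using h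

lemma d_Q : G.d 1 T.Q = -T.γ := by
  have h := congrFun T.br_ln 1
  simp only [G.br_apply, T.Dv_l, T.Dv_n] at h
  simpa [T.l_eq, T.m_eq, T.mb_eq, T.n_eq] using h

lemma comm_mmb (i : Fin 2) :
    G.Dv T.m (T.ζ i) - G.Dv T.mb (T.ξ i) = T.b * T.ζ i - T.bb * T.ξ i := by
  have := T.br_mmb
  fin_cases i
  · simpa [G.br_apply, T.m_eq, T.mb_eq] using congrFun this 2
  · simpa [G.br_apply, T.m_eq, T.mb_eq] using congrFun this 3

lemma comm_nm (i : Fin 2) :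
    G.Dv T.n (T.ξ i) - G.Dv T.m (T.C i) = -(T.c + T.μ) * T.ξ i - T.lam * T.ζ i := by
  have := T.br_nm
  fin_cases i
  · have := congrFun this 2
    simp only [G.br_apply] at this
    simp [T.l_eq, T.m_eq, T.mb_eq, T.n_eq] at this ⊢
    linear_combination this
  · have := congrFun this 3
    simp only [G.br_apply] at this
    simp [T.l_eq, T.m_eq, T.mb_eq, T.n_eq] at this ⊢
    linear_combination this

lemma comm_nmb (i : Fin 2) :
    G.Dv T.n (T.ζ i) - G.Dv T.mb (T.C i) = -(T.μ - T.c) * T.ζ i - T.lamb * T.ξ i := by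
  have := T.br_nmb
  fin_cases i
  · have := congrFun this 2
    simp only [G.br_apply] at this
    simp [T.l_eq, T.m_eq, T.mb_eq, T.n_eq] at this ⊢
    linear_combination this
  · have := congrFun this 3
    simp only [G.br_apply] at this
    simp [T.l_eq, T.m_eq, T.mb_eq, T.n_eq] at this ⊢
    linear_combination this

/-! The Ricci identities. -/

/-- Sachs' equation: `Ψ₀` is the source of the shear along the generators. -/
lemma d_sigma : G.d 1 T.σ = 2 * T.ρ * T.σ + T.Ψ0 := by
  simp only [Ψ0, Geo.Rm, Geo.Riem]
  rw [T.nab_ll, T.br_lm, T.nab_ml]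
  simp only [Geo.nab_sub, Geo.nab_add, Geo.nab_smul, Geo.nab_zero, Geo.nab_add_left,
    Geo.nab_smul_left, T.nab_ml, T.nab_mbl, T.nab_lm, T.nab_lmb, T.nab_ll, Geo.gm_sub_left,
    Geo.gm_add_left, Geo.gm_smul_left, Geo.gm_zero_left, T.lm, T.mm, T.mbm, T.Dv_l, smul_zero]
  ring

lemma vac_ll : G.Rm T.l T.m T.l T.mb = 0 := by
  have h := T.vac T.l T.l
  have h1 : G.Rm T.l T.l T.l T.n = 0 := Geo.two_cancel (by linear_combination G.Rm_anti₁₂ T.l T.l T.l T.n)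
  have h2 : G.Rm T.n T.l T.l T.l = 0 := Geo.two_cancel (by linear_combination G.Rm_anti₃₄ T.n T.l T.l T.l)
  have h3 := G.Rm_anti₁₂ T.m T.l T.l T.mb
  have h4 := G.Rm_anti₁₂ T.mb T.l T.l T.m
  have h5 := G.Rm_pair T.l T.mb T.l T.m
  apply Geo.two_cancel
  linear_combination h - h1 - h2 + h3 + h4 - h5

/-- Raychaudhuri's equation. The Ricci term is absent by `vac_ll`. -/
lemma d_rho : G.d 1 T.ρ = T.ρ ^ 2 + T.σ * T.σb := by
  have h := T.vac_ll
  simp only [Geo.Rm, Geo.Riem] at h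
  rw [T.nab_ll, T.br_lm, T.nab_ml] at h
  simp only [Geo.nab_sub, Geo.nab_add, Geo.nab_smul, Geo.nab_zero, Geo.nab_add_left,
    Geo.nab_smul_left, T.nab_ml, T.nab_mbl, T.nab_lm, T.nab_lmb, T.nab_ll, Geo.gm_sub_left,
    Geo.gm_add_left, Geo.gm_smul_left, Geo.gm_zero_left, T.lmb, T.mmb, T.mbmb, T.Dv_l,
    smul_zero] at h
  linear_combination h

lemma Psi1_eq : T.Ψ1 = G.d 1 T.τ - 2 * T.τ * T.ρ - 2 * T.τb * T.σ := by
  simp only [Ψ1, Geo.Rm, Geo.Riem]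
  rw [T.nab_ll, T.br_ln, T.nab_nl]
  simp only [Geo.nab_sub, Geo.nab_add, Geo.nab_smul, Geo.nab_zero, Geo.nab_add_left,
    Geo.nab_smul_left, Geo.nab_neg_left, T.nab_ml, T.nab_mbl, T.nab_lm, T.nab_lmb, T.nab_ll,
    Geo.gm_sub_left, Geo.gm_neg_left, 
    Geo.gm_add_left, Geo.gm_smul_left, Geo.gm_zero_left, T.lm, T.mm, T.mbm, T.Dv_l, smul_zero]
  ring

/-- Together with `Psi1_eq`, this expresses curvature through spin coefficients. It supplies the
rough initial decay that the Bianchi identities then improve. -/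
lemma P2_eq : T.P2 = G.Dv T.n T.ρ + T.τ * T.τb - T.γ * T.ρ - G.Dv T.mb T.τ + T.τ * T.bb
    + T.μ * T.ρ + T.lamb * T.σ := by
  simp only [P2, Geo.Rm, Geo.Riem]
  rw [T.br_nmb, T.nab_nl, T.nab_mbl]
  simp only [Geo.nab_sub, Geo.nab_add, Geo.nab_smul, Geo.nab_zero, Geo.nab_sub_left,
    Geo.nab_smul_left, Geo.nab_neg_left, T.nab_ml, T.nab_mbl, T.nab_nm, T.nab_nmb, T.nab_nl,
    T.nab_ll, T.nab_mbm, T.nab_mbmb, T.mbm,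
    Geo.gm_sub_left, Geo.gm_neg_left,
    Geo.gm_add_left, Geo.gm_smul_left, Geo.gm_zero_left, T.lm, T.mm, T.mbm, T.nm, smul_zero]
  ring

/-! The curvature components in terms of `Ψ₀`, `Ψ₁`, `Ψ₂`. -/

lemma Rm_mmb_lm : G.Rm T.m T.mb T.l T.m = -T.Ψ1 := by
  have h := T.vac T.l T.m
  rw [G.Rm_same₃₄, G.Rm_same₁₂] at h
  rw [Ψ1, G.Rm_pair T.l T.n]
  linear_combination h + G.Rm_anti₁₂ T.m T.mb T.l T.m

lemma Rm_lmb_lm : G.Rm T.l T.mb T.l T.m = 0 := by rw [G.Rm_pair, T.vac_ll]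

lemma Rm_lm_ln : G.Rm T.l T.m T.l T.n = T.Ψ1 := G.Rm_pair _ _ _ _

lemma Rm_lm_mbm : G.Rm T.l T.m T.mb T.m = T.Ψ1 := by
  rw [G.Rm_pair, G.Rm_anti₁₂, T.Rm_mmb_lm, neg_neg]

/-- The two terms enter the Bianchi identities below only through this sum. -/
lemma Rm_lmb_sum : G.Rm T.l T.mb T.mb T.m + G.Rm T.l T.mb T.l T.n = 0 := by
  have h := T.vac T.l T.mb
  rw [G.Rm_same₃₄, G.Rm_same₁₂] at h
  linear_combination h + G.Rm_pair T.l T.mb T.mb T.m + G.Rm_anti₁₂ T.mb T.m T.l T.mb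

lemma Rm_nm_lm : G.Rm T.n T.m T.l T.m = 0 := by
  have h := T.vac T.m T.m
  rw [G.Rm_same₃₄, G.Rm_same₁₂] at h
  apply Geo.two_cancel
  linear_combination -h + G.Rm_anti₃₄ T.n T.m T.m T.l + G.Rm_anti₃₄ T.l T.m T.m T.n
    + G.Rm_pair T.n T.m T.l T.m

/-- As with `Rm_lmb_sum`, only this combination enters the Bianchi identities, so the two components
need not be determined separately. -/
lemma Rm_ln_sum : G.Rm T.l T.n T.mb T.m + G.Rm T.l T.n T.l T.n = -2 * T.P2 := by
  have h := T.vac T.l T.n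
  rw [G.Rm_same₃₄] at h
  have h1 := G.Rm_cyc T.l T.n T.mb T.m
  have h2 := G.Rm_pair T.mb T.l T.n T.m
  have h3 := G.Rm_anti₃₄ T.n T.m T.mb T.l
  have h4 := G.Rm_anti₁₂ T.m T.n T.l T.mb
  have h5 := G.Rm_anti₁₂ T.mb T.n T.l T.m
  have h6 := G.Rm_anti₃₄ T.n T.mb T.l T.m
  rw [P2]
  linear_combination h + h1 - h2 - h3 + h4 + h5

/-! The Bianchi identities. -/

/-- A transport equation along the generators with source `Ψ₀`. With `ρ ≈ -1/r`, its homogeneous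
solutions fall off like `r⁻⁴`. -/
lemma bianchi_Psi1 : G.d 1 T.Ψ1 = G.Dv T.mb T.Ψ0 - (T.τb + 2 * T.bb) * T.Ψ0
    + 4 * T.ρ * T.Ψ1 := by
  have h := G.bianchi_second T.l T.m T.mb T.l T.m
  have e1 := G.br_anti T.mb T.l
  rw [T.br_lmb] at e1
  rw [T.br_mmb, e1, T.br_lm, T.nab_ll, T.nab_lm, T.nab_ml, T.nab_mm, T.nab_mbl, T.nab_mbm] at h
  simp only [Geo.Rm_add₁, Geo.Rm_add₂, Geo.Rm_add₃, Geo.Rm_add₄, Geo.Rm_sub₁, Geo.Rm_sub₂,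
    Geo.Rm_sub₃, Geo.Rm_sub₄, Geo.Rm_smul₁, Geo.Rm_smul₂, Geo.Rm_smul₃, Geo.Rm_smul₄,
    Geo.Rm_neg₁, Geo.Rm_neg₂, Geo.Rm_neg₃, Geo.Rm_neg₄, Geo.Rm_zero₃, G.Rm_same₁₂, G.Rm_same₃₄,
    G.Rm_anti₁₂ T.mb T.l, G.Rm_anti₁₂ T.mb T.m, T.Rm_mmb_lm, T.Rm_lmb_lm, T.Rm_lm_ln, T.Rm_lm_mbm,
    T.Dv_l, Geo.Dv_neg, Geo.Dv_zero, map_neg] at h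
  have := T.Rm_lmb_sum
  rw [show G.Rm T.l T.m T.l T.m = T.Ψ0 from rfl] at h
  linear_combination -h - T.σ * this

/-- The one Bianchi identity used here that differentiates across the null hypersurfaces. It
controls `∂_u Ψ₀`. -/
lemma bianchi_Psi0 : G.Dv T.n T.Ψ0 = G.Dv T.m T.Ψ1 + (2 * T.γ - 2 * T.c - T.μ) * T.Ψ0
    + (T.b - 5 * T.τ) * T.Ψ1 - 3 * T.σ * T.P2 := by
  have h := G.bianchi_second T.l T.n T.m T.l T.m
  have e1 := G.br_anti T.m T.l
  rw [T.br_lm] at e1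
  rw [T.br_nm, e1, T.br_ln, T.nab_ll, T.nab_lm, T.nab_nl, T.nab_nm, T.nab_ml, T.nab_mm] at h
  simp only [Geo.Rm_add₁, Geo.Rm_add₂, Geo.Rm_add₃, Geo.Rm_add₄, Geo.Rm_sub₁, Geo.Rm_sub₂,
    Geo.Rm_sub₃, Geo.Rm_sub₄, Geo.Rm_smul₁, Geo.Rm_smul₂, Geo.Rm_smul₃, Geo.Rm_smul₄,
    Geo.Rm_neg₁, Geo.Rm_neg₂, Geo.Rm_neg₃, Geo.Rm_neg₄, Geo.Rm_zero₃, G.Rm_same₁₂, G.Rm_same₃₄,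
    G.Rm_anti₁₂ T.m T.l, T.Rm_mmb_lm, T.Rm_lmb_lm, T.Rm_lm_ln, T.Rm_lm_mbm, T.Rm_nm_lm,
    T.Dv_l, Geo.Dv_neg, Geo.Dv_zero] at h
  rw [show G.Rm T.l T.m T.l T.m = T.Ψ0 from rfl, show G.Rm T.l T.n T.l T.m = T.Ψ1 from rfl,
    show G.Rm T.n T.mb T.l T.m = T.P2 from rfl, map_zero] at h
  linear_combination -h + T.σ * T.Rm_ln_sum

lemma bianchi_P2 : G.d 1 T.P2 = 3 * T.ρ * T.P2 - G.Dv T.mb T.Ψ1 - (T.τb - T.bb) * T.Ψ1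
    + T.lamb * T.Ψ0 := by
  have h := G.bianchi_second T.l T.n T.mb T.l T.m
  have e1 := G.br_anti T.mb T.l
  rw [T.br_lmb] at e1
  rw [T.br_nmb, e1, T.br_ln, T.nab_ll, T.nab_lm, T.nab_nl, T.nab_nm, T.nab_mbl, T.nab_mbm] at h
  simp only [Geo.Rm_add₁, Geo.Rm_add₂, Geo.Rm_add₃, Geo.Rm_add₄, Geo.Rm_sub₁, Geo.Rm_sub₂,
    Geo.Rm_sub₃, Geo.Rm_sub₄, Geo.Rm_smul₁, Geo.Rm_smul₂, Geo.Rm_smul₃, Geo.Rm_smul₄,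
    Geo.Rm_neg₁, Geo.Rm_neg₂, Geo.Rm_neg₃, Geo.Rm_neg₄, Geo.Rm_zero₃, G.Rm_same₁₂, G.Rm_same₃₄,
    G.Rm_anti₁₂ T.mb T.l, G.Rm_anti₁₂ T.mb T.m, T.Rm_mmb_lm, T.Rm_lmb_lm, T.Rm_lm_ln, T.Rm_lm_mbm,
    T.Rm_nm_lm, T.Dv_l, Geo.Dv_neg, Geo.Dv_zero] at h
  rw [show G.Rm T.l T.m T.l T.m = T.Ψ0 from rfl, show G.Rm T.l T.n T.l T.m = T.Ψ1 from rfl,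
    show G.Rm T.n T.mb T.l T.m = T.P2 from rfl] at h
  linear_combination h - T.ρ * T.Rm_ln_sum + T.τ * T.Rm_lmb_sum

/-! Killing vectors. -/

section killing
variable {X : Fin 4 → A}
  (hX : ∀ V W, G.Dv X (G.gm V W) = G.gm (G.br X V) W + G.gm V (G.br X W))
include hX

/-- The imaginary function `g([X, m], m̄)`. -/
def w (X : Fin 4 → A) : A := G.gm (G.br X T.m) T.mb

lemma killing_br_l (a : Fin 4) : G.br X T.l a = -G.d 1 (X a) := by
  rw [G.br_apply, T.Dv_l, T.l_eq]
  fin_cases a <;> simp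

/-- This is the `l l` component of the Killing equation, because `l` is the gradient of `u`. -/
lemma killing_d_X0 (T : Tetrad G) : G.d 1 (X 0) = 0 := by
  have h := hX T.l T.l
  rw [T.ll, Geo.Dv_zero, G.gm_symm T.l, ← T.comp0, T.killing_br_l hX] at h
  exact Geo.two_cancel (by linear_combination h)

lemma killing_br_m_l : G.gm (G.br X T.m) T.l = -G.Dv T.m (X 0) := by
  rw [← T.comp0, G.br_apply, T.m_eq]; simp
lemma killing_br_mb_l : G.gm (G.br X T.mb) T.l = -G.Dv T.mb (X 0) := by
  rw [← T.comp0, G.br_apply, T.mb_eq]; simp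

lemma killing_br_l_m : G.gm (G.br X T.l) T.m = G.Dv T.m (X 0) := by
  have h := hX T.l T.m
  rw [T.lm, Geo.Dv_zero, G.gm_symm T.l, T.killing_br_m_l hX] at h
  linear_combination -h
lemma killing_br_l_mb : G.gm (G.br X T.l) T.mb = G.Dv T.mb (X 0) := by
  have h := hX T.l T.mb
  rw [T.lmb, Geo.Dv_zero, G.gm_symm T.l, T.killing_br_mb_l hX] at h
  linear_combination -h

lemma killing_d_X2 : G.d 1 (X 2) = G.Dv T.mb (X 0) * T.ξ 0 + G.Dv T.m (X 0) * T.ζ 0 := by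
  have h := T.comp2 (G.br X T.l)
  rw [← T.comp0, T.killing_br_l hX, T.killing_br_l hX, T.killing_d_X0 hX, T.killing_br_l_m hX,
    T.killing_br_l_mb hX] at h
  linear_combination -h

lemma killing_d_X3 : G.d 1 (X 3) = G.Dv T.mb (X 0) * T.ξ 1 + G.Dv T.m (X 0) * T.ζ 1 := by
  have h := T.comp3 (G.br X T.l)
  rw [← T.comp0, T.killing_br_l hX, T.killing_br_l hX, T.killing_d_X0 hX, T.killing_br_l_m hX,
    T.killing_br_l_mb hX] at h
  linear_combination -h

lemma killing_br_n_l : G.gm (G.br X T.n) T.l = -G.Dv T.n (X 0) := by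
  rw [← T.comp0, G.br_apply, T.n_eq]; simp

lemma killing_br_l_n : G.gm (G.br X T.l) T.n = G.Dv T.n (X 0) := by
  have h := hX T.l T.n
  rw [T.ln, Geo.Dv_one, G.gm_symm T.l, T.killing_br_n_l hX] at h
  linear_combination -h

lemma killing_d_X1 (T : Tetrad G) : G.d 1 (X 1) = -G.Dv T.n (X 0) := by
  have h := T.comp1 (G.br X T.l)
  rw [← T.comp0, T.killing_br_l hX, T.killing_br_l hX, T.killing_d_X0 hX, T.killing_br_l_n hX] at h
  linear_combination -h

lemma killing_br_m_m : G.gm (G.br X T.m) T.m = 0 := by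
  have h := hX T.m T.m
  rw [T.mm, Geo.Dv_zero, G.gm_symm T.m] at h
  exact Geo.two_cancel (by linear_combination -h)
lemma killing_br_mb_mb : G.gm (G.br X T.mb) T.mb = 0 := by
  have h := hX T.mb T.mb
  rw [T.mbmb, Geo.Dv_zero, G.gm_symm T.mb] at h
  exact Geo.two_cancel (by linear_combination -h)
lemma killing_br_mb_m : G.gm (G.br X T.mb) T.m = -T.w X := by
  have h := hX T.m T.mb
  rw [T.mmb, Geo.Dv_neg, Geo.Dv_one, G.gm_symm T.m] at h
  rw [w]
  linear_combination -h

/-- This and the next three lemmas are the angular components of `[X, m]` and `[X, mb]`. The Killing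
equation fixes these brackets except for the rotation `w` of the pair and the components along `l`,
which have no angular part. -/
lemma killing_xi0 : G.Dv X (T.ξ 0) - G.Dv T.m (X 2) = -G.Dv T.m (X 0) * T.C 0 - T.w X * T.ξ 0 := by
  have h := T.comp2 (G.br X T.m)
  rw [T.killing_br_m_l hX, T.killing_br_m_m hX, G.br_apply] at h
  simp only [w]
  simp only [show T.m 2 = T.ξ 0 by rw [T.m_eq]; rfl] at h
  linear_combination h
lemma killing_xi1 : G.Dv X (T.ξ 1) - G.Dv T.m (X 3) = -G.Dv T.m (X 0) * T.C 1 - T.w X * T.ξ 1 := by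
  have h := T.comp3 (G.br X T.m)
  rw [T.killing_br_m_l hX, T.killing_br_m_m hX, G.br_apply] at h
  simp only [w]
  simp only [show T.m 3 = T.ξ 1 by rw [T.m_eq]; rfl] at h
  linear_combination h
lemma killing_zeta0 :
    G.Dv X (T.ζ 0) - G.Dv T.mb (X 2) = -G.Dv T.mb (X 0) * T.C 0 + T.w X * T.ζ 0 := by
  have h := T.comp2 (G.br X T.mb)
  rw [T.killing_br_mb_l hX, T.killing_br_mb_m hX, T.killing_br_mb_mb hX, G.br_apply] at h
  simp only [show T.mb 2 = T.ζ 0 by rw [T.mb_eq]; rfl] at h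
  linear_combination h
lemma killing_zeta1 :
    G.Dv X (T.ζ 1) - G.Dv T.mb (X 3) = -G.Dv T.mb (X 0) * T.C 1 + T.w X * T.ζ 1 := by
  have h := T.comp3 (G.br X T.mb)
  rw [T.killing_br_mb_l hX, T.killing_br_mb_m hX, T.killing_br_mb_mb hX, G.br_apply] at h
  simp only [show T.mb 3 = T.ζ 1 by rw [T.mb_eq]; rfl] at h
  linear_combination h

lemma killing_br_n_m : G.gm (G.br X T.n) T.m = G.Dv T.m (X 1) - G.Dv T.m (X 0) * T.Q := by
  have h := hX T.n T.m
  have h1 := T.comp1 (G.br X T.m)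
  rw [T.nm, Geo.Dv_zero, G.gm_symm T.n] at h
  rw [T.killing_br_m_l hX, G.br_apply] at h1
  simp only [show T.m 1 = 0 by rw [T.m_eq]; rfl, Geo.Dv_zero] at h1
  linear_combination -h + h1
lemma killing_br_n_mb : G.gm (G.br X T.n) T.mb = G.Dv T.mb (X 1) - G.Dv T.mb (X 0) * T.Q := by
  have h := hX T.n T.mb
  have h1 := T.comp1 (G.br X T.mb)
  rw [T.nmb, Geo.Dv_zero, G.gm_symm T.n] at h
  rw [T.killing_br_mb_l hX, G.br_apply] at h1
  simp only [show T.mb 1 = 0 by rw [T.mb_eq]; rfl, Geo.Dv_zero] at h1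
  linear_combination -h + h1

lemma killing_C0 : G.Dv X (T.C 0) - G.Dv T.n (X 2) = -G.Dv T.n (X 0) * T.C 0
    - (G.Dv T.mb (X 1) - G.Dv T.mb (X 0) * T.Q) * T.ξ 0
    - (G.Dv T.m (X 1) - G.Dv T.m (X 0) * T.Q) * T.ζ 0 := by
  have h := T.comp2 (G.br X T.n)
  rw [T.killing_br_n_l hX, T.killing_br_n_m hX, T.killing_br_n_mb hX, G.br_apply] at h
  simp only [show T.n 2 = T.C 0 by rw [T.n_eq]; rfl] at h
  linear_combination h

/-- Expand the invariance of `Rm l m l m` in the tetrad. Both `l` and `m` occur twice, which gives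
the factor `2`. The `Ψ₁` terms come from the `m`- and `mb`-parts of `[X, l]` and the `n`-part of
`[X, m]`, the remaining components being killed by the vacuum equations. -/
lemma killing_Psi0 : G.Dv X T.Ψ0 =
    -2 * (G.d 1 (X 1) + T.w X) * T.Ψ0 - 4 * G.Dv T.m (X 0) * T.Ψ1 := by
  have h := Geo.killing_Rm hX T.nondeg T.l T.m T.l T.m
  have e1 : G.br X T.l = -(G.d 1 (X 1)) • T.l - G.Dv T.mb (X 0) • T.m - G.Dv T.m (X 0) • T.mb := by
    rw [T.complete (G.br X T.l), T.killing_br_l_n hX, ← T.comp0, T.killing_br_l hX,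
      T.killing_d_X0 hX, T.killing_br_l_m hX, T.killing_br_l_mb hX, T.killing_d_X1 hX]
    module
  have e2 : G.br X T.m = G.gm (G.br X T.m) T.n • T.l - G.Dv T.m (X 0) • T.n - T.w X • T.m := by
    conv_lhs => rw [T.complete (G.br X T.m), T.killing_br_m_l hX, T.killing_br_m_m hX]
    rw [w]; module
  rw [G.Rm_pair T.l T.m (G.br X T.l), G.Rm_pair T.l T.m T.l (G.br X T.m), e1, e2] at h
  simp only [Geo.Rm_add₁, Geo.Rm_add₂, Geo.Rm_sub₁, Geo.Rm_sub₂, Geo.Rm_smul₁, Geo.Rm_smul₂,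
    Geo.Rm_neg₁, Geo.Rm_neg₂, G.Rm_same₁₂, G.Rm_anti₁₂ T.mb T.m, T.Rm_mmb_lm,
    show G.Rm T.l T.m T.l T.m = T.Ψ0 from rfl, show G.Rm T.l T.n T.l T.m = T.Ψ1 from rfl] at h
  linear_combination h

end killing
end Tetrad
end BoostRot
end

noncomputable section

namespace BoostRot

/-! ### The ring of smooth functions near a piece of null infinity -/

/-- The point of null infinity on the same generator. -/
def base (x : Pt) : Scri := ![x 0, x 2, x 3]

/-- A neighbourhood `dom` of a piece `scri` of null infinity, on which `r > 1`. -/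
structure Nbhd where
  scri : Set Scri
  dom : Set Pt
  scri_open : IsOpen scri
  dom_open : IsOpen dom
  r_gt : ∀ x ∈ dom, 1 < x 1
  base_mem : ∀ x ∈ dom, base x ∈ scri
  rays : ∀ K : Set Scri, K ⊆ scri → IsCompact K →
    ∃ R : ℝ, ∀ p ∈ K, ∀ r, R < r → pt p r ∈ dom

variable {D : Nbhd}

open Classical in
/-- Extension by zero. -/
def extend (D : Nbhd) (f : D.dom → ℂ) : Pt → ℂ := fun x => if h : x ∈ D.dom then f ⟨x, h⟩ else 0

lemma extend_apply (f : D.dom → ℂ) {x : Pt} (h : x ∈ D.dom) : extend D f x = f ⟨x, h⟩ := by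
  simp [extend, h]

lemma contDiffOn_extend {f : D.dom → ℂ} {F : Pt → ℂ} (h : ContDiffOn ℝ ∞ F D.dom)
    (e : ∀ x (hx : x ∈ D.dom), f ⟨x, hx⟩ = F x) : ContDiffOn ℝ ∞ (extend D f) D.dom :=
  h.congr fun x hx => by rw [extend_apply f hx, e]

def smoothFn (D : Nbhd) : Subalgebra ℂ (D.dom → ℂ) where
  carrier := {f | ContDiffOn ℝ ∞ (extend D f) D.dom}
  mul_mem' {f h} hf hh := contDiffOn_extend (ContDiffOn.mul hf hh) fun x hx => by
    simp [extend_apply _ hx]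
  add_mem' {f h} hf hh := contDiffOn_extend (ContDiffOn.add hf hh) fun x hx => by
    simp [extend_apply _ hx]
  algebraMap_mem' c := contDiffOn_extend (contDiffOn_const (c := c)) fun x hx => rfl

/-- Smooth complex functions on a neighbourhood of null infinity. -/
def Fn (D : Nbhd) : Type := smoothFn D

instance : CommRing (Fn D) := inferInstanceAs (CommRing (smoothFn D))
instance : Algebra ℂ (Fn D) := inferInstanceAs (Algebra ℂ (smoothFn D))

namespace Fn

/-- Extension by zero allows evaluation and differentiation in all of `Pt`. Only the behaviour on
the open set `D.dom` carries information. -/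
def ev (f : Fn D) : Pt → ℂ := extend D f.1

def mk (F : Pt → ℂ) (h : ContDiffOn ℝ ∞ F D.dom) : Fn D :=
  ⟨fun x => F x.1, contDiffOn_extend h fun _ _ => rfl⟩

lemma ev_mk {F : Pt → ℂ} (h : ContDiffOn ℝ ∞ F D.dom) {x : Pt} (hx : x ∈ D.dom) :
    (mk F h).ev x = F x := extend_apply _ hx

lemma smooth (f : Fn D) : ContDiffOn ℝ ∞ f.ev D.dom := f.2

lemma ext_ev {f h : Fn D} (e : ∀ x ∈ D.dom, f.ev x = h.ev x) : f = h :=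
  Subtype.ext <| funext fun x => by
    have := e x.1 x.2
    rwa [ev, ev, extend_apply _ x.2, extend_apply _ x.2] at this

variable {x : Pt} (f h : Fn D)

lemma ev_add (hx : x ∈ D.dom) : (f + h).ev x = f.ev x + h.ev x := by
  simp only [ev, extend_apply _ hx]; rfl
lemma ev_sub (hx : x ∈ D.dom) : (f - h).ev x = f.ev x - h.ev x := by
  simp only [ev, extend_apply _ hx]; rfl
lemma ev_neg (hx : x ∈ D.dom) : (-f).ev x = -f.ev x := by
  simp only [ev, extend_apply _ hx]; rfl
lemma ev_mul (hx : x ∈ D.dom) : (f * h).ev x = f.ev x * h.ev x := by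
  simp only [ev, extend_apply _ hx]; rfl
lemma ev_zero : (0 : Fn D).ev x = 0 := by
  by_cases hx : x ∈ D.dom
  · simp only [ev, extend_apply _ hx]; rfl
  · simp [ev, extend, hx]
lemma ev_one (hx : x ∈ D.dom) : (1 : Fn D).ev x = 1 := by
  simp only [ev, extend_apply _ hx]; rfl
lemma ev_smul (c : ℂ) (hx : x ∈ D.dom) : (c • f).ev x = c * f.ev x := by
  simp only [ev, extend_apply _ hx]; rfl
lemma ev_algebraMap (c : ℂ) (hx : x ∈ D.dom) : (algebraMap ℂ (Fn D) c).ev x = c := by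
  simp only [ev, extend_apply _ hx]; rfl
lemma ev_sum {ι : Type*} (s : Finset ι) (F : ι → Fn D) (hx : x ∈ D.dom) :
    (∑ i ∈ s, F i).ev x = ∑ i ∈ s, (F i).ev x := by
  classical
  induction s using Finset.induction_on with
  | empty => simp [ev_zero]
  | insert a s ha ih => rw [Finset.sum_insert ha, Finset.sum_insert ha, ev_add _ _ hx, ih]
lemma ev_pow (n : ℕ) (hx : x ∈ D.dom) : (f ^ n).ev x = f.ev x ^ n := by
  induction n with
  | zero => simp [ev_one hx]
  | succ n ih => rw [pow_succ, pow_succ, ev_mul _ _ hx, ih]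

lemma contDiffAt (hx : x ∈ D.dom) : ContDiffAt ℝ ∞ f.ev x :=
  f.smooth.contDiffAt (D.dom_open.mem_nhds hx)

lemma diffAt (hx : x ∈ D.dom) : DifferentiableAt ℝ f.ev x :=
  (f.contDiffAt hx).differentiableAt (by simp)

end Fn

lemma pd_contDiffOn {E : Type*} [NormedAddCommGroup E] [NormedSpace ℝ E] {F : Pt → E} {s : Set Pt}
    (hs : IsOpen s) (h : ContDiffOn ℝ ∞ F s) (a : Fin 4) : ContDiffOn ℝ ∞ (pd a F) s :=
  (h.fderiv_of_isOpen hs (by simp)).clm_apply contDiffOn_const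

lemma pd_congr {E : Type*} [NormedAddCommGroup E] [NormedSpace ℝ E] {F H : Pt → E} {s : Set Pt}
    (hs : IsOpen s) (e : ∀ x ∈ s, F x = H x) (a : Fin 4) {x : Pt} (hx : x ∈ s) :
    pd a F x = pd a H x := by
  have : F =ᶠ[𝓝 x] H := Filter.eventually_of_mem (hs.mem_nhds hx) e
  rw [pd, pd, this.fderiv_eq]

namespace Fn

def dFun (a : Fin 4) (f : Fn D) : Fn D := mk (pd a f.ev) (pd_contDiffOn D.dom_open f.smooth a)

lemma ev_dFun (a : Fin 4) (f : Fn D) {x : Pt} (hx : x ∈ D.dom) :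
    (dFun a f).ev x = pd a f.ev x := ev_mk _ hx

lemma ev_dFun_of_eq (a : Fin 4) (f : Fn D) {F : Pt → ℂ} (e : ∀ y ∈ D.dom, f.ev y = F y)
    {x : Pt} (hx : x ∈ D.dom) : (dFun a f).ev x = pd a F x := by
  rw [ev_dFun a f hx, pd_congr D.dom_open e a hx]

/-- The coordinate derivations. -/
def d (a : Fin 4) : Derivation ℂ (Fn D) (Fn D) :=
  Derivation.mk'
    { toFun := dFun a
      map_add' := fun f h => ext_ev fun x hx => by
        rw [ev_dFun_of_eq a (f + h) (F := f.ev + h.ev) (fun y hy => ev_add f h hy) hx,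
          ev_add _ _ hx, ev_dFun _ _ hx, ev_dFun _ _ hx, pd,
          fderiv_add (f.diffAt hx) (h.diffAt hx)]
        rfl
      map_smul' := fun c f => ext_ev fun x hx => by
        rw [ev_dFun_of_eq a (c • f) (F := c • f.ev) (fun y hy => ev_smul f c hy) hx,
          RingHom.id_apply, ev_smul _ _ hx, ev_dFun _ _ hx, pd, fderiv_const_smul (f.diffAt hx)]
        rfl }
    (fun f h => ext_ev fun x hx => by
      change (dFun a (f * h)).ev x = (f * dFun a h + h * dFun a f).ev x
      rw [ev_dFun_of_eq a (f * h) (F := f.ev * h.ev) (fun y hy => ev_mul f h hy) hx,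
        ev_add _ _ hx, ev_mul _ _ hx, ev_mul _ _ hx, ev_dFun _ _ hx, ev_dFun _ _ hx, pd,
        fderiv_mul (f.diffAt hx) (h.diffAt hx)]
      simp [pd])

lemma ev_d (a : Fin 4) (f : Fn D) {x : Pt} (hx : x ∈ D.dom) : (d a f).ev x = pd a f.ev x :=
  ev_dFun a f hx

lemma ev_d_of_eq (a : Fin 4) (f : Fn D) {F : Pt → ℂ} (e : ∀ y ∈ D.dom, f.ev y = F y)
    {x : Pt} (hx : x ∈ D.dom) : (d a f).ev x = pd a F x := ev_dFun_of_eq a f e hx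

lemma d_comm (a b : Fin 4) (f : Fn D) : d a (d b f) = d b (d a f) := by
  have key : ∀ a b : Fin 4, ∀ x ∈ D.dom, (d a (d b f)).ev x =
      fderiv ℝ (fderiv ℝ f.ev) x (Pi.single a 1) (Pi.single b 1) := by
    intro a b x hx
    rw [ev_d_of_eq a _ (fun y hy => ev_d b f hy) hx]
    have hd : DifferentiableAt ℝ (fderiv ℝ f.ev) x :=
      ((f.contDiffAt hx).fderiv_right (m := ∞) (by simp)).differentiableAt (by simp)
    simp only [pd]
    change fderiv ℝ (fun y => fderiv ℝ f.ev y (Pi.single b 1)) x _ = _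
    rw [fderiv_clm_apply hd (by fun_prop)]
    simp
  refine ext_ev fun x hx => ?_
  rw [key a b x hx, key b a x hx]
  exact (((f.contDiffAt hx).isSymmSndFDerivAt
    (by simpa using WithTop.coe_le_coe.2 (le_top : (2 : ℕ∞) ≤ ⊤))) _ _)

lemma contDiffOn_conj (f : Fn D) : ContDiffOn ℝ ∞ (fun x => starRingEnd ℂ (f.ev x)) D.dom :=
  Complex.conjCLE.contDiff.comp_contDiffOn f.smooth

/-- Complex conjugation. -/
def cj : Fn D →+* Fn D where
  toFun f := mk (fun x => starRingEnd ℂ (f.ev x)) f.contDiffOn_conj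
  map_one' := ext_ev fun x hx => by rw [ev_mk _ hx, ev_one hx]; simp
  map_mul' f h := ext_ev fun x hx => by
    rw [ev_mk _ hx, ev_mul _ _ hx, ev_mul _ _ hx, ev_mk _ hx, ev_mk _ hx]; simp
  map_zero' := ext_ev fun x hx => by rw [ev_mk _ hx, ev_zero]; simp
  map_add' f h := ext_ev fun x hx => by
    rw [ev_mk _ hx, ev_add _ _ hx, ev_add _ _ hx, ev_mk _ hx, ev_mk _ hx]; simp

lemma ev_cj (f : Fn D) {x : Pt} (hx : x ∈ D.dom) : (cj f).ev x = starRingEnd ℂ (f.ev x) :=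
  ev_mk _ hx

lemma d_cj (a : Fin 4) (f : Fn D) : d a (cj f) = cj (d a f) := by
  refine ext_ev fun x hx => ?_
  rw [ev_d_of_eq a _ (fun y hy => ev_cj f hy) hx, ev_cj _ hx, ev_d a f hx]
  simp only [pd]
  have := (Complex.conjCLE.toContinuousLinearMap.hasFDerivAt.comp x (f.diffAt hx).hasFDerivAt).fderiv
  have e : (fun x => starRingEnd ℂ (f.ev x)) = ⇑Complex.conjCLE.toContinuousLinearMap ∘ f.ev := rfl
  rw [e, this]; rfl

lemma cj_cj (f : Fn D) : cj (cj f) = f := ext_ev fun x hx => by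
  rw [ev_cj _ hx, ev_cj _ hx]; simp

lemma cj_algebraMap (c : ℂ) : cj (algebraMap ℂ (Fn D) c) = algebraMap ℂ _ (starRingEnd ℂ c) :=
  ext_ev fun x hx => by rw [ev_cj _ hx, ev_algebraMap _ hx, ev_algebraMap _ hx]

end Fn
end BoostRot
end

noncomputable section

namespace BoostRot

/-! ### The filtration by the order of decay -/

open Filter Asymptotics

/-- Local uniformity over a compact set of generators is encoded in the filter `𝓟 K ×ˢ atTop`, so
the calculus of `IsBigO` applies unchanged. -/
lemma eventually_end {K : Set Scri} {P : Scri × ℝ → Prop} :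
    (∀ᶠ q in 𝓟 K ×ˢ atTop, P q) ↔ ∃ R : ℝ, ∀ p ∈ K, ∀ r, R < r → P (p, r) := by
  rw [Filter.eventually_prod_iff]
  constructor
  · rintro ⟨pa, ha, pb, hb, h⟩
    obtain ⟨R, hR⟩ := eventually_atTop.1 hb
    exact ⟨R, fun p hp r hr => h (mem_principal.1 ha hp) (hR r hr.le)⟩
  · rintro ⟨R, hR⟩
    exact ⟨fun p => p ∈ K, mem_principal_self K, fun r => R < r, eventually_gt_atTop R,
      fun {_} hp {_} hr => hR _ hp _ hr⟩

variable {D : Nbhd}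

lemma Nbhd.eventually_dom (D : Nbhd) {K : Set Scri} (hK : K ⊆ D.scri) (hc : IsCompact K) :
    ∀ᶠ q : Scri × ℝ in 𝓟 K ×ˢ atTop, pt q.1 q.2 ∈ D.dom ∧ 1 < q.2 := by
  rw [eventually_end]
  obtain ⟨R, hR⟩ := D.rays K hK hc
  exact ⟨max R 1, fun p hp r hr => ⟨hR p hp r ((le_max_left _ _).trans_lt hr),
    (le_max_right _ _).trans_lt hr⟩⟩

namespace Fn

/-- `f = O(r^{-k+δ})` for all `δ > 0`, locally uniformly. -/
def Bnd (k : ℤ) (f : Fn D) : Prop :=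
  ∀ K : Set Scri, K ⊆ D.scri → IsCompact K → ∀ a : ℝ, a < k →
    (fun q : Scri × ℝ => f.ev (pt q.1 q.2)) =O[𝓟 K ×ˢ atTop] fun q => q.2 ^ (-a)

/-- The bounds for derivatives up to order `n`. -/
def Bn : ℕ → ℤ → Fn D → Prop
  | 0, k, f => Bnd k f
  | n + 1, k, f => Bnd k f ∧ ∀ c, Bn n (k + if c = 1 then 1 else 0) (d c f)

lemma Bnd.mono {k l : ℤ} {f : Fn D} (h : Bnd k f) (hl : l ≤ k) : Bnd l f :=
  fun K hK hc a ha => h K hK hc a (ha.trans_le (by exact_mod_cast hl))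

lemma Bnd.add {k : ℤ} {f h : Fn D} (hf : Bnd k f) (hh : Bnd k h) : Bnd k (f + h) := by
  intro K hK hc a ha
  refine ((hf K hK hc a ha).add (hh K hK hc a ha)).congr' ?_ EventuallyEq.rfl
  filter_upwards [D.eventually_dom hK hc] with q hq
  rw [ev_add _ _ hq.1]

lemma Bnd.smul {k : ℤ} {f : Fn D} (c : ℂ) (hf : Bnd k f) : Bnd k (c • f) := by
  intro K hK hc a ha
  refine ((hf K hK hc a ha).const_mul_left c).congr' ?_ EventuallyEq.rfl
  filter_upwards [D.eventually_dom hK hc] with q hq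
  rw [ev_smul _ _ hq.1]

lemma Bnd.mul {k l : ℤ} {f h : Fn D} (hf : Bnd k f) (hh : Bnd l h) : Bnd (k + l) (f * h) := by
  intro K hK hc a ha
  push_cast at ha
  -- The available margin `k + l - a` is shared equally between the two factors.
  have h1 := hf K hK hc (k - (k + l - a) / 2) (by linarith)
  have h2 := hh K hK hc (l - (k + l - a) / 2) (by linarith)
  refine (h1.mul h2).congr' ?_ ?_
  · filter_upwards [D.eventually_dom hK hc] with q hq
    rw [ev_mul _ _ hq.1]
  · filter_upwards [D.eventually_dom hK hc] with q hq
    rw [← Real.rpow_add (by linarith [hq.2])]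
    congr 1; ring

lemma Bnd.zero (k : ℤ) : Bnd k (0 : Fn D) := by
  intro K hK hc a ha
  simp only [ev_zero]
  exact isBigO_zero _ _

lemma Bnd.cj {k : ℤ} {f : Fn D} (hf : Bnd k f) : Bnd k (cj f) := by
  intro K hK hc a ha
  refine IsBigO.of_norm_left ?_
  refine (hf K hK hc a ha).norm_left.congr' ?_ EventuallyEq.rfl
  filter_upwards [D.eventually_dom hK hc] with q hq
  rw [ev_cj _ hq.1]; simp

lemma Bn.mono {n : ℕ} {k l : ℤ} {f : Fn D} (h : Bn n k f) (hl : l ≤ k) : Bn n l f := by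
  induction n generalizing k l f with
  | zero => exact Bnd.mono h hl
  | succ n ih => exact ⟨h.1.mono hl, fun c => ih (h.2 c) (by omega)⟩

lemma Bn.pred {n : ℕ} {k : ℤ} {f : Fn D} (h : Bn (n + 1) k f) : Bn n k f := by
  induction n generalizing k f with
  | zero => exact h.1
  | succ n ih => exact ⟨h.1, fun c => ih (h.2 c)⟩

lemma Bn.add {n : ℕ} {k : ℤ} {f h : Fn D} (hf : Bn n k f) (hh : Bn n k h) : Bn n k (f + h) := by
  induction n generalizing k f h with
  | zero => exact Bnd.add hf hh
  | succ n ih => exact ⟨hf.1.add hh.1, fun c => by rw [map_add]; exact ih (hf.2 c) (hh.2 c)⟩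

lemma Bn.smul {n : ℕ} {k : ℤ} {f : Fn D} (c : ℂ) (hf : Bn n k f) : Bn n k (c • f) := by
  induction n generalizing k f with
  | zero => exact Bnd.smul c hf
  | succ n ih => exact ⟨hf.1.smul c, fun a => by rw [Derivation.map_smul]; exact ih (hf.2 a)⟩

lemma Bn.zero (n : ℕ) (k : ℤ) : Bn n k (0 : Fn D) := by
  induction n generalizing k with
  | zero => exact Bnd.zero k
  | succ n ih => exact ⟨Bnd.zero k, fun c => by rw [map_zero]; exact ih _⟩

lemma Bn.mul {n : ℕ} {k l : ℤ} {f h : Fn D} (hf : Bn n k f) (hh : Bn n l h) :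
    Bn n (k + l) (f * h) := by
  induction n generalizing k l f h with
  | zero => exact Bnd.mul hf hh
  | succ n ih =>
    refine ⟨hf.1.mul hh.1, fun c => ?_⟩
    rw [Derivation.leibniz, smul_eq_mul, smul_eq_mul, mul_comm h]
    exact ((ih hf.pred (hh.2 c)).mono (by omega)).add ((ih (hf.2 c) hh.pred).mono (by omega))

lemma Bn.cj {n : ℕ} {k : ℤ} {f : Fn D} (hf : Bn n k f) : Bn n k (cj f) := by
  induction n generalizing k f with
  | zero => exact Bnd.cj hf
  | succ n ih => exact ⟨hf.1.cj, fun c => by rw [d_cj]; exact ih (hf.2 c)⟩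

/-- The functions of order `r^{-k}` (up to arbitrarily small powers of `r`), together with their
derivatives; each `r`-derivative improves the order by one. -/
def B (D : Nbhd) (k : ℤ) : Submodule ℂ (Fn D) where
  carrier := {f | ∀ n, Bn n k f}
  add_mem' hf hh n := (hf n).add (hh n)
  zero_mem' n := Bn.zero n k
  smul_mem' c _ hf n := (hf n).smul c

lemma B_mono {k l : ℤ} {f : Fn D} (h : f ∈ B D k) (hl : l ≤ k) : f ∈ B D l := fun n => (h n).mono hl
lemma B_mul {k l m : ℤ} {f h : Fn D} (hf : f ∈ B D k) (hh : h ∈ B D l) (hm : m ≤ k + l) :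
    f * h ∈ B D m := fun n => ((hf n).mul (hh n)).mono hm
lemma B_cj {k : ℤ} {f : Fn D} (h : f ∈ B D k) : cj f ∈ B D k := fun n => (h n).cj
lemma B_d {k : ℤ} {f : Fn D} (h : f ∈ B D k) (c : Fin 4) : d c f ∈ B D k := fun n =>
  ((h (n + 1)).2 c).mono (by split_ifs <;> omega)
lemma B_d1 {k l : ℤ} {f : Fn D} (h : f ∈ B D k) (hl : l ≤ k + 1) : d 1 f ∈ B D l := fun n =>
  ((h (n + 1)).2 1).mono (by simpa using hl)

/-! ### Integration along the generators -/

lemma hasDerivAt_pt (p : Scri) (r : ℝ) : HasDerivAt (pt p) (Pi.single 1 1) r := by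
  rw [hasDerivAt_pi]
  intro i
  fin_cases i
  · simpa [pt] using hasDerivAt_const r (p 0)
  · simpa [pt] using hasDerivAt_id' r
  · simpa [pt] using hasDerivAt_const r (p 1)
  · simpa [pt] using hasDerivAt_const r (p 2)

lemma hasDerivAt_ray (f : Fn D) {p : Scri} {r : ℝ} (h : pt p r ∈ D.dom) :
    HasDerivAt (fun s => f.ev (pt p s)) ((d 1 f).ev (pt p r)) r := by
  rw [ev_d _ _ h]
  exact (f.diffAt h).hasFDerivAt.comp_hasDerivAt r (hasDerivAt_pt p r)

/-- Integration of a bound on the derivative by a power. -/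
lemma norm_sub_le_rpow {F F' : ℝ → ℂ} {R C a r r' : ℝ} (hR : 0 < R) (ha : a ≠ 0)
    (hF : ∀ s, R ≤ s → HasDerivAt F (F' s) s) (hb : ∀ s, R ≤ s → ‖F' s‖ ≤ C * s ^ (-a - 1))
    (hr : R ≤ r) (hr' : r ≤ r') : ‖F r' - F r‖ ≤ C / a * (r ^ (-a) - r' ^ (-a)) := by
  have hd : ∀ s, R ≤ s → HasDerivAt (fun x : ℝ => C / a * (r ^ (-a) - x ^ (-a)))
      (C * s ^ (-a - 1)) s := by
    intro s hs
    have h1 := ((Real.hasDerivAt_rpow_const (x := s) (p := -a)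
      (Or.inl (by linarith))).const_sub (r ^ (-a))).const_mul (C / a)
    refine h1.congr_deriv ?_
    field_simp
  have := image_norm_le_of_norm_deriv_right_le_deriv_boundary' (a := r) (b := r')
    (f := fun x => F x - F r) (f' := F') (B := fun x : ℝ => C / a * (r ^ (-a) - x ^ (-a)))
    (B' := fun s => C * s ^ (-a - 1))
    (fun x hx => ((hF x (hr.trans hx.1)).continuousAt.sub continuousAt_const).continuousWithinAt)
    (fun x hx => ((hF x (hr.trans hx.1)).sub_const (F r)).hasDerivWithinAt)
    (by simp) (fun x hx => hd x (hr.trans hx.1) |>.continuousAt.continuousWithinAt)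
    (fun x hx => (hd x (hr.trans hx.1)).hasDerivWithinAt)
    (fun x hx => hb x (hr.trans hx.1))
  exact this ⟨hr', le_rfl⟩

lemma ray_bound {f : Fn D} {k : ℤ} (h : Bnd (k + 1) (d 1 f)) {K : Set Scri} (hK : K ⊆ D.scri)
    (hc : IsCompact K) {a : ℝ} (ha : a < k) : ∃ R C : ℝ, 1 < R ∧ 0 ≤ C ∧
      (∀ p ∈ K, ∀ r, R ≤ r → pt p r ∈ D.dom) ∧
      ∀ p ∈ K, ∀ r, R ≤ r → ‖(d 1 f).ev (pt p r)‖ ≤ C * r ^ (-a - 1) := by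
  obtain ⟨C, hC0, hC⟩ := (h K hK hc (a + 1) (by push_cast; linarith)).exists_nonneg
  obtain ⟨R, hR⟩ := eventually_end.1 (hC.bound.and (D.eventually_dom hK hc))
  refine ⟨max R 1 + 1, C, by linarith [le_max_right R 1], hC0, fun p hp r hr => ?_,
    fun p hp r hr => ?_⟩
  · exact (hR p hp r (by linarith [le_max_left R 1])).2.1
  · have h1 := (hR p hp r (by linarith [le_max_left R 1])).1
    have h2 : (0 : ℝ) < r := by linarith [le_max_right R 1]
    simp only [Real.norm_of_nonneg (Real.rpow_nonneg h2.le _)] at h1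
    convert h1 using 3
    ring

lemma continuous_pt (r : ℝ) : Continuous fun p : Scri => pt p r := by
  refine continuous_pi fun i => ?_
  fin_cases i <;> simp [pt] <;> fun_prop

/-- Integration outward from `r = R`. For `k ≤ 0` the initial values, bounded on `K`, are themselves
within the claimed order. -/
lemma Bnd_of_d1 {f : Fn D} {k : ℤ} (hk : k ≤ 0) (h : Bnd (k + 1) (d 1 f)) : Bnd k f := by
  intro K hK hc a ha
  have ha0 : a < 0 := ha.trans_le (by exact_mod_cast hk)
  obtain ⟨R, C, hR, hC, hd, hb⟩ := ray_bound h hK hc ha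
  have hcont : ContinuousOn (fun p => f.ev (pt p R)) K :=
    f.smooth.continuousOn.comp (continuous_pt R).continuousOn fun p hp => hd p hp R le_rfl
  obtain ⟨M, hM⟩ := hc.exists_bound_of_continuousOn hcont
  refine IsBigO.of_bound (|M| + C / (-a)) ?_
  rw [eventually_end]
  refine ⟨R, fun p hp r hr => ?_⟩
  have h1 := norm_sub_le_rpow (by linarith) ha0.ne (fun s hs => f.hasDerivAt_ray (hd p hp s hs))
    (hb p hp) le_rfl hr.le
  have hr0 : 0 < r := by linarith
  have h2 : (1 : ℝ) ≤ r ^ (-a) := Real.one_le_rpow (by linarith) (by linarith)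
  have h3 : 0 ≤ R ^ (-a) := Real.rpow_nonneg (by linarith) _
  rw [Real.norm_of_nonneg (by linarith)]
  have h4 : C / a * (R ^ (-a) - r ^ (-a)) ≤ C / (-a) * r ^ (-a) := by
    have : 0 ≤ C / (-a) := div_nonneg hC (by linarith)
    rw [show C / a = -(C / (-a)) by rw [div_neg, neg_neg]]
    nlinarith
  calc ‖f.ev (pt p r)‖ = ‖f.ev (pt p R) + (f.ev (pt p r) - f.ev (pt p R))‖ := by
        congr 1; ring
    _ ≤ ‖f.ev (pt p R)‖ + ‖f.ev (pt p r) - f.ev (pt p R)‖ := norm_add_le _ _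
    _ ≤ |M| + C / (-a) * r ^ (-a) :=
        add_le_add ((hM p hp).trans (le_abs_self M)) (h1.trans h4)
    _ ≤ (|M| + C / (-a)) * r ^ (-a) := by
        nlinarith [abs_nonneg M]

/-- Since `f` tends to zero, it is minus the integral of its derivative over the tail, and the tail
integral of a power decays at the expected rate. -/
lemma Bnd_of_d1' {f : Fn D} {k : ℤ} (h0 : Bnd 1 f) (h : Bnd (k + 1) (d 1 f)) : Bnd k f := by
  intro K hK hc a ha
  by_cases ha1 : a < 1
  · exact h0 K hK hc a (by exact_mod_cast ha1)
  push Not at ha1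
  obtain ⟨R, C, hR, hC, hd, hb⟩ := ray_bound h hK hc ha
  refine IsBigO.of_bound (C / a) ?_
  rw [eventually_end]
  refine ⟨R, fun p hp r hr => ?_⟩
  have hr0 : 0 < r := by linarith
  rw [Real.norm_of_nonneg (Real.rpow_nonneg hr0.le _)]
  have hlim : Tendsto (fun s => f.ev (pt p s)) atTop (𝓝 0) := by
    have h1 := h0 {p} (by simpa using hK hp) isCompact_singleton (1 / 2) (by norm_num)
    have h2 := h1.comp_tendsto (k := fun s => (p, s)) (l' := atTop)
      (by exact (tendsto_const_pure.mono_right (by simp)).prodMk tendsto_id)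
    refine h2.trans_tendsto ?_
    exact tendsto_rpow_neg_atTop (by norm_num)
  have hlim' : Tendsto (fun s => ‖f.ev (pt p s) - f.ev (pt p r)‖) atTop (𝓝 ‖0 - f.ev (pt p r)‖) :=
    (hlim.sub_const _).norm
  rw [zero_sub, norm_neg] at hlim'
  refine le_of_tendsto hlim' ?_
  filter_upwards [eventually_ge_atTop r] with s hs
  have h1 := norm_sub_le_rpow (by linarith) (by linarith)
    (fun s hs => f.hasDerivAt_ray (hd p hp s hs)) (hb p hp) hr.le hs
  refine h1.trans ?_
  have : 0 ≤ s ^ (-a) := Real.rpow_nonneg (by linarith) _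
  exact mul_le_mul_of_nonneg_left (by linarith) (div_nonneg hC (by linarith))

/-- Integration from a fixed sphere. -/
lemma B_of_d1 {f : Fn D} {k : ℤ} (hk : k ≤ 0) (h : d 1 f ∈ B D (k + 1)) : f ∈ B D k := by
  intro n
  induction n generalizing f with
  | zero => exact Bnd_of_d1 hk (h 0)
  | succ n ih =>
    refine ⟨Bnd_of_d1 hk (h 0), fun c => ?_⟩
    by_cases hc : c = 1
    · subst hc; simpa using h n
    · simp only [hc, if_false, add_zero]
      -- Derivatives transverse to the generators commute with `∂_r`, so they satisfy the same
      -- hypothesis and the induction closes.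
      exact ih (by rw [d_comm]; exact B_d h c)

/-- Integration from infinity. -/
lemma B_of_d1' {f : Fn D} {k : ℤ} (h0 : f ∈ B D 1) (h : d 1 f ∈ B D (k + 1)) : f ∈ B D k := by
  intro n
  induction n generalizing f with
  | zero => exact Bnd_of_d1' (h0 0) (h 0)
  | succ n ih =>
    refine ⟨Bnd_of_d1' (h0 0) (h 0), fun c => ?_⟩
    by_cases hc : c = 1
    · subst hc; simpa using h n
    · simp only [hc, if_false, add_zero]
      exact ih (B_d h0 c) (by rw [d_comm]; exact B_d h c)

/-! ### Powers of `r`, the logarithm, and functions on null infinity -/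

lemma r_pos {x : Pt} (hx : x ∈ D.dom) : 0 < x 1 := by linarith [D.r_gt x hx]

lemma pd_r {x : Pt} {φ : ℝ → ℂ} {φ' : ℂ} (h : HasDerivAt φ φ' (x 1)) (a : Fin 4) :
    pd a (fun y => φ (y 1)) x = if a = 1 then φ' else 0 := by
  have h1 : HasFDerivAt (fun y : Pt => y 1) (ContinuousLinearMap.proj 1 : Pt →L[ℝ] ℝ) x :=
    (ContinuousLinearMap.proj (R := ℝ) (φ := fun _ : Fin 4 => ℝ) 1).hasFDerivAt
  have h2 := h.hasFDerivAt.comp x h1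
  rw [pd, show (fun y : Pt => φ (y 1)) = φ ∘ fun y : Pt => y 1 from rfl, h2.fderiv]
  by_cases ha : a = 1
  · subst ha; simp
  · have : (Pi.single (M := fun _ : Fin 4 => ℝ) a 1) 1 = 0 := by
      simp [Pi.single_apply, Ne.symm ha]
    simp [ha, this]

/-- The power `r^{-k}`. -/
def rz (D : Nbhd) (k : ℤ) : Fn D := mk (fun x => ((x 1 ^ (-k) : ℝ) : ℂ)) (by
  refine Complex.ofRealCLM.contDiff.comp_contDiffOn ?_
  intro x hx
  exact (((ContinuousLinearMap.proj (R := ℝ) (φ := fun _ : Fin 4 => ℝ) 1).analyticAt x).zpow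
    (r_pos hx).ne').contDiffAt.contDiffWithinAt)

lemma ev_rz (k : ℤ) {x : Pt} (hx : x ∈ D.dom) : (rz D k).ev x = ((x 1 ^ (-k) : ℝ) : ℂ) := ev_mk _ hx

lemma rz_mul (k l : ℤ) : rz D k * rz D l = rz D (k + l) := ext_ev fun x hx => by
  rw [ev_mul _ _ hx, ev_rz _ hx, ev_rz _ hx, ev_rz _ hx, ← Complex.ofReal_mul,
    ← zpow_add₀ (r_pos hx).ne', neg_add]

lemma rz_zero : rz D 0 = 1 := ext_ev fun x hx => by
  rw [ev_rz _ hx, ev_one hx]; simp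

lemma d_rz (k : ℤ) (a : Fin 4) :
    d a (rz D k) = if a = 1 then (-k : ℂ) • rz D (k + 1) else 0 := ext_ev fun x hx => by
  rw [ev_d_of_eq a _ (fun y hy => ev_rz k hy) hx,
    pd_r (φ := fun r => ((r ^ (-k) : ℝ) : ℂ)) (hasDerivAt_zpow (-k) (x 1)
      (Or.inl (r_pos hx).ne')).ofReal_comp]
  split_ifs
  · rw [ev_smul _ _ hx, ev_rz _ hx]
    push_cast
    rw [show -(k + 1) = -k - 1 by ring]
  · rw [ev_zero]

lemma d1_rz (k : ℤ) : d 1 (rz D k) = (-k : ℂ) • rz D (k + 1) := by rw [d_rz, if_pos rfl]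

lemma rz_mem (k : ℤ) : rz D k ∈ B D k := by
  intro n
  have h0 : ∀ k, Bnd k (rz D k) := by
    intro k K hK hc a ha
    refine IsBigO.of_bound 1 ?_
    filter_upwards [D.eventually_dom hK hc] with q hq
    have hr : 0 < q.2 := by linarith [hq.2]
    rw [ev_rz _ hq.1, Complex.norm_real, Real.norm_of_nonneg (by simpa [pt] using zpow_nonneg hr.le _),
      Real.norm_of_nonneg (Real.rpow_nonneg hr.le _), one_mul]
    simp only [pt, Matrix.cons_val_one, Matrix.cons_val_zero]
    rw [← Real.rpow_intCast]
    exact Real.rpow_le_rpow_of_exponent_le hq.2.le (by push_cast; linarith)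
  induction n generalizing k with
  | zero => exact h0 k
  | succ n ih =>
    refine ⟨h0 k, fun c => ?_⟩
    rw [d_rz]
    split_ifs
    · exact (ih _).smul _
    · exact Bn.zero _ _

/-- `ln r`. -/
def lnr (D : Nbhd) : Fn D := mk (fun x => ((Real.log (x 1) : ℝ) : ℂ)) (by
  refine Complex.ofRealCLM.contDiff.comp_contDiffOn ?_
  intro x hx
  exact ((contDiff_apply ℝ ℝ (1 : Fin 4)).contDiffAt.log (r_pos hx).ne').contDiffWithinAt)

lemma ev_lnr {x : Pt} (hx : x ∈ D.dom) : (lnr D).ev x = ((Real.log (x 1) : ℝ) : ℂ) := ev_mk _ hx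

lemma d_lnr (a : Fin 4) : d a (lnr D) = if a = 1 then rz D 1 else 0 := ext_ev fun x hx => by
  rw [ev_d_of_eq a _ (fun y hy => ev_lnr hy) hx,
    pd_r (φ := fun r => ((Real.log r : ℝ) : ℂ)) (Real.hasDerivAt_log (r_pos hx).ne').ofReal_comp]
  split_ifs
  · rw [ev_rz _ hx]; simp
  · rw [ev_zero]

lemma lnr_mem : lnr D ∈ B D 0 :=
  B_of_d1 le_rfl (by rw [d_lnr, if_pos rfl]; simpa using rz_mem 1)

lemma contDiff_base : ContDiff ℝ ∞ base := by
  rw [contDiff_pi]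
  intro i
  fin_cases i <;> simp only [base] <;> simp <;> exact contDiff_apply ℝ ℝ _

/-- A function on null infinity, as a function in spacetime. -/
def pf (c : Scri → ℂ) (hc : ContDiffOn ℝ ∞ c D.scri) : Fn D :=
  mk (fun x => c (base x)) (hc.comp contDiff_base.contDiffOn D.base_mem)

/-- The functions that come from null infinity. -/
def IsPf (f : Fn D) : Prop := ∃ c : Scri → ℂ, ContDiffOn ℝ ∞ c D.scri ∧ ∀ x ∈ D.dom, f.ev x = c (base x)

lemma base_pt (p : Scri) (r : ℝ) : base (pt p r) = p := by
  ext i; fin_cases i <;> simp [base, pt]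

lemma pt_base (x : Pt) : pt (base x) (x 1) = x := by
  ext i; fin_cases i <;> simp [base, pt]

lemma ev_pf {c : Scri → ℂ} (hc : ContDiffOn ℝ ∞ c D.scri) {x : Pt} (hx : x ∈ D.dom) :
    (pf c hc).ev x = c (base x) := ev_mk _ hx

lemma isPf_pf (c : Scri → ℂ) (hc : ContDiffOn ℝ ∞ c D.scri) : IsPf (pf c hc) :=
  ⟨c, hc, fun _ hx => ev_pf hc hx⟩

/-- The direction in null infinity. -/
def baseDir (a : Fin 4) : Scri := base (Pi.single a 1)

lemma pd_base {c : Scri → ℂ} (hc : ContDiffOn ℝ ∞ c D.scri) (a : Fin 4) {x : Pt} (hx : x ∈ D.dom) :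
    pd a (fun y => c (base y)) x = fderiv ℝ c (base x) (baseDir a) := by
  let L : Pt →L[ℝ] Scri := LinearMap.toContinuousLinearMap
    { toFun := base
      map_add' := fun x y => by ext i; fin_cases i <;> rfl
      map_smul' := fun x y => by ext i; fin_cases i <;> rfl }
  have h1 : HasFDerivAt base L x := L.hasFDerivAt
  have h2 : DifferentiableAt ℝ c (base x) :=
    (hc.contDiffAt (D.scri_open.mem_nhds (D.base_mem x hx))).differentiableAt (by simp)
  rw [pd, show (fun y => c (base y)) = c ∘ base from rfl, (h2.hasFDerivAt.comp x h1).fderiv]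
  rfl

lemma IsPf.d {f : Fn D} (h : IsPf f) (a : Fin 4) : IsPf (d a f) := by
  obtain ⟨c, hc, e⟩ := h
  refine ⟨fun p => fderiv ℝ c p (baseDir a),
    (hc.fderiv_of_isOpen D.scri_open (by simp)).clm_apply contDiffOn_const, fun x hx => ?_⟩
  rw [ev_d_of_eq a f e hx, pd_base hc a hx]

lemma IsPf.d1 {f : Fn D} (h : IsPf f) : Fn.d 1 f = 0 := by
  obtain ⟨c, hc, e⟩ := h
  refine ext_ev fun x hx => ?_
  rw [ev_d_of_eq 1 f e hx, pd_base hc 1 hx, ev_zero]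
  have : baseDir 1 = 0 := by
    ext i; fin_cases i <;> simp [baseDir, base]
  rw [this, map_zero]

lemma IsPf.mem {f : Fn D} (h : IsPf f) : f ∈ B D 0 :=
  B_of_d1 le_rfl (by rw [h.d1]; exact zero_mem _)

lemma IsPf.add {f h : Fn D} (hf : IsPf f) (hh : IsPf h) : IsPf (f + h) := by
  obtain ⟨c, hc, e⟩ := hf
  obtain ⟨c', hc', e'⟩ := hh
  exact ⟨fun p => c p + c' p, hc.add hc', fun x hx => by rw [ev_add _ _ hx, e x hx, e' x hx]⟩

lemma IsPf.mul {f h : Fn D} (hf : IsPf f) (hh : IsPf h) : IsPf (f * h) := by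
  obtain ⟨c, hc, e⟩ := hf
  obtain ⟨c', hc', e'⟩ := hh
  exact ⟨fun p => c p * c' p, hc.mul hc', fun x hx => by rw [ev_mul _ _ hx, e x hx, e' x hx]⟩

lemma isPf_algebraMap (c : ℂ) : IsPf (algebraMap ℂ (Fn D) c) :=
  ⟨fun _ => c, contDiffOn_const, fun _ hx => ev_algebraMap c hx⟩

lemma IsPf.smul {f : Fn D} (c : ℂ) (hf : IsPf f) : IsPf (c • f) := by
  rw [Algebra.smul_def]; exact (isPf_algebraMap c).mul hf

lemma tendsto_ray {f : Fn D} (h : f ∈ B D 1) {p : Scri} (hp : p ∈ D.scri) :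
    Tendsto (fun s => f.ev (pt p s)) atTop (𝓝 0) := by
  have h1 := h 0 {p} (by simpa using hp) isCompact_singleton (1 / 2) (by norm_num)
  have h2 := h1.comp_tendsto (k := fun s => (p, s)) (l' := atTop)
    (by exact (tendsto_const_pure.mono_right (by simp)).prodMk tendsto_id)
  exact h2.trans_tendsto (tendsto_rpow_neg_atTop (by norm_num))

lemma eventually_ray (D : Nbhd) {p : Scri} (hp : p ∈ D.scri) :
    ∀ᶠ r in atTop, pt p r ∈ D.dom := by
  obtain ⟨R, hR⟩ := D.rays {p} (by simpa using hp) isCompact_singleton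
  filter_upwards [eventually_gt_atTop R] with r hr using hR p rfl r hr

/-- A function constant along the generators equals its own limit. Coefficients of expansions are
compared through this lemma. -/
lemma IsPf.eq_zero {f : Fn D} (h : IsPf f) (hB : f ∈ B D 1) : f = 0 := by
  obtain ⟨c, hc, e⟩ := h
  refine ext_ev fun x hx => ?_
  have hp := D.base_mem x hx
  have h1 := tendsto_ray hB hp
  have h2 : Tendsto (fun s => f.ev (pt (base x) s)) atTop (𝓝 (c (base x))) := by
    refine tendsto_const_nhds.congr' ?_
    filter_upwards [eventually_ray D hp] with r hr
    rw [e _ hr, base_pt]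
  rw [e x hx, tendsto_nhds_unique h2 h1, ev_zero]

/-! ### Inverses -/

/-- Here `f` tends to `1` uniformly on compact sets of generators, so `|f| ≥ 1/2` far out and the
inverse is bounded. -/
lemma Bnd_inv {f k : Fn D} (hfk : f * k = 1) (hf : f - 1 ∈ B D 1) : Bnd 0 k := by
  intro K hK hc a ha
  have h1 := hf 0 K hK hc (1 / 2) (by norm_num)
  have h2 : Tendsto (fun q : Scri × ℝ => q.2 ^ (-(1 / 2) : ℝ)) (𝓟 K ×ˢ atTop) (𝓝 0) :=
    (tendsto_rpow_neg_atTop (by norm_num)).comp tendsto_snd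
  have h3 := h1.trans_tendsto h2
  refine IsBigO.of_bound 2 ?_
  filter_upwards [D.eventually_dom hK hc, h3.norm.eventually
    (gt_mem_nhds (show ‖(0 : ℂ)‖ < 1 / 2 by simp))]
    with q hq h4
  rw [ev_sub _ _ hq.1, ev_one hq.1] at h4
  have h5 : f.ev (pt q.1 q.2) * k.ev (pt q.1 q.2) = 1 := by
    rw [← ev_mul _ _ hq.1, hfk, ev_one hq.1]
  have h6 : (1 : ℝ) / 2 ≤ ‖f.ev (pt q.1 q.2)‖ := by
    have := norm_sub_norm_le (1 : ℂ) (1 - f.ev (pt q.1 q.2))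
    rw [norm_sub_rev 1, norm_one, sub_sub_cancel] at this
    linarith
  have h7 : ‖f.ev (pt q.1 q.2)‖ * ‖k.ev (pt q.1 q.2)‖ = 1 := by
    rw [← norm_mul, h5, norm_one]
  have h8 : (1 : ℝ) ≤ q.2 ^ (-a) := Real.one_le_rpow hq.2.le (by
    have : a < 0 := by simpa using ha
    linarith)
  rw [Real.norm_of_nonneg (by linarith)]
  nlinarith [norm_nonneg (k.ev (pt q.1 q.2))]

lemma one_mem : (1 : Fn D) ∈ B D 0 := by
  rw [← rz_zero]; exact rz_mem 0

/-- The derivatives of the inverse are `-k² ∂f`, so each further derivative is controlled by the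
bounds already obtained for `k`. -/
lemma B_inv {f k : Fn D} (hfk : f * k = 1) (hf : f - 1 ∈ B D 1) : k ∈ B D 0 := by
  have hf0 : f ∈ B D 0 := by
    have := add_mem (B_mono hf zero_le_one) one_mem
    simpa using this
  have hd : ∀ c, d c k = -(k * k) * d c f := by
    intro c
    have h := congrArg (d c) hfk
    rw [Derivation.leibniz, Derivation.map_one_eq_zero, smul_eq_mul, smul_eq_mul] at h
    linear_combination k * h - d c k * hfk
  intro n
  induction n with
  | zero => exact Bnd_inv hfk hf
  | succ n ih =>
    refine ⟨Bnd_inv hfk hf, fun c => ?_⟩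
    rw [hd, show -(k * k) * d c f = (-1 : ℂ) • ((k * k) * d c f) by simp]
    have h1 := ((ih.mul ih).mul ((hf0 (n + 1)).2 c)).smul (-1)
    simpa using h1

lemma B_inv_sub {f k : Fn D} (hfk : f * k = 1) (hf : f - 1 ∈ B D 1) : k - 1 ∈ B D 1 := by
  have : k - 1 = -(k * (f - 1)) := by linear_combination hfk
  rw [this]
  exact neg_mem (B_mul (B_inv hfk hf) hf (by norm_num))

end Fn
end BoostRot
end

/-! ### Calculus of orders, and asymptotically flat tetrads -/

noncomputable section

namespace BoostRot

open Filter Asymptotics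

namespace Fn

variable {D : Nbhd}

def r (D : Nbhd) : Fn D := rz D (-1)
def s (D : Nbhd) : Fn D := rz D 1

lemma r_mem : r D ∈ B D (-1) := rz_mem _
lemma s_mem : s D ∈ B D 1 := rz_mem _
lemma rs : r D * s D = 1 := by rw [r, s, rz_mul, ← rz_zero]; norm_num
lemma d1_r : d 1 (r D) = 1 := by
  rw [r, d1_rz]; simp [rz_zero]
lemma d1_s : d 1 (s D) = -(s D * s D) := by
  rw [s, d1_rz, rz_mul]; norm_num
lemma d_s {c : Fin 4} (hc : c ≠ 1) : d c (s D) = 0 := by rw [s, d_rz, if_neg hc]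
lemma d1_lnr : d 1 (lnr D) = s D := by rw [d_lnr, if_pos rfl, s]
lemma d_lnr' {c : Fin 4} (hc : c ≠ 1) : d c (lnr D) = 0 := by rw [d_lnr, if_neg hc]
lemma cj_r : cj (r D) = r D := ext_ev fun y hy => by
  rw [ev_cj _ hy, r, ev_rz _ hy, Complex.conj_ofReal]
lemma cj_s : cj (s D) = s D := ext_ev fun y hy => by
  rw [ev_cj _ hy, s, ev_rz _ hy, Complex.conj_ofReal]

/-! Membership rules with automatic arithmetic of the orders. -/

lemma Bw {k l : ℤ} {f : Fn D} (h : f ∈ B D k) (hl : l ≤ k := by norm_num) : f ∈ B D l := B_mono h hl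
lemma Bm {k l m : ℤ} {f h : Fn D} (hf : f ∈ B D k) (hh : h ∈ B D l)
    (hm : m ≤ k + l := by norm_num) : f * h ∈ B D m := B_mul hf hh hm
lemma Bd {k l : ℤ} {f : Fn D} (h : f ∈ B D k) (c : Fin 4) (hl : l ≤ k := by norm_num) :
    d c f ∈ B D l := B_mono (B_d h c) hl
lemma Bd1 {k l : ℤ} {f : Fn D} (h : f ∈ B D k) (hl : l ≤ k + 1 := by norm_num) :
    d 1 f ∈ B D l := B_d1 h hl
lemma Bnat {k : ℤ} {f : Fn D} (n : ℕ) [n.AtLeastTwo] (h : f ∈ B D k) :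
    (OfNat.ofNat n : Fn D) * f ∈ B D k := by
  have : (OfNat.ofNat n : Fn D) * f = n • f := by rw [nsmul_eq_mul]; rfl
  rw [this]; exact nsmul_mem h n
lemma Bz {k : ℤ} {f : Fn D} (n : ℤ) (h : f ∈ B D k) : (n : Fn D) * f ∈ B D k := by
  rw [← zsmul_eq_mul]; exact zsmul_mem h n
lemma B_two {k : ℤ} {f : Fn D} (h : 2 * f ∈ B D k) : f ∈ B D k := by
  have : f = (1 / 2 : ℂ) • (2 * f) := by
    rw [two_mul, ← two_smul ℂ f, smul_smul]; norm_num
  rw [this]; exact Submodule.smul_mem _ _ h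

lemma r_mul_mem {k l : ℤ} {f : Fn D} (h : f ∈ B D k) (hl : l ≤ k - 1 := by norm_num) :
    r D * f ∈ B D l := B_mul r_mem h (by omega)
lemma s_mul_mem {k l : ℤ} {f : Fn D} (h : f ∈ B D k) (hl : l ≤ k + 1 := by norm_num) :
    s D * f ∈ B D l := B_mul s_mem h (by omega)
lemma mem_of_r {k l : ℤ} {f : Fn D} (h : r D * f ∈ B D k) (hl : l ≤ k + 1 := by norm_num) :
    f ∈ B D l := by
  have : f = s D * (r D * f) := by linear_combination -f * rs
  rw [this]; exact s_mul_mem h hl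
lemma mem_of_s {k l : ℤ} {f : Fn D} (h : s D * f ∈ B D k) (hl : l ≤ k - 1 := by norm_num) :
    f ∈ B D l := by
  have : f = r D * (s D * f) := by linear_combination -f * rs
  rw [this]; exact r_mul_mem h hl

/-- A first order linear equation along the generators. -/
lemma B_of_d1s {f : Fn D} (k : ℤ) {l : ℤ} (hl : l ≤ k)
    (h : d 1 f + (k : Fn D) * (s D * f) ∈ B D (l + 1)) : f ∈ B D l := by
  have e1 : rz D k * rz D (-k) = 1 := by rw [rz_mul, add_neg_cancel, rz_zero]
  have e2 : rz D (-k + 1) = rz D (-k) * s D := by rw [s, rz_mul]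
  have e : d 1 (rz D (-k) * f) = rz D (-k) * (d 1 f + (k : Fn D) * (s D * f)) := by
    rw [Derivation.leibniz, d1_rz, e2, smul_eq_mul, smul_eq_mul, Algebra.smul_def]
    rw [Int.cast_neg, neg_neg, map_intCast]; ring
  -- The integrating factor is `r^k`. The condition `l ≤ k` makes `l - k ≤ 0`, so integration from a
  -- finite sphere suffices and no decay of `f` has to be known beforehand.
  have h1 : rz D (-k) * f ∈ B D (l - k) := by
    refine B_of_d1 (by omega) ?_
    rw [e]
    exact B_mul (rz_mem _) h (by omega)
  have : f = rz D k * (rz D (-k) * f) := by linear_combination -f * e1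
  rw [this]
  exact B_mul (rz_mem _) h1 (by omega)

/-! ### Functions without logarithms at leading order -/

/-- The functions `f = f₀ r^{-k} + O(r^{-k-1+δ})`: there is no logarithm at the order `r^{-k}`. -/
def L (D : Nbhd) (k : ℤ) : Submodule ℂ (Fn D) where
  carrier := {f | f ∈ B D k ∧ d 1 f + (k : Fn D) * (s D * f) ∈ B D (k + 2)}
  add_mem' {f h} hf hh := ⟨add_mem hf.1 hh.1, by
    have := add_mem hf.2 hh.2
    rw [map_add]
    convert this using 1; ring⟩
  zero_mem' := ⟨zero_mem _, by simp⟩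
  smul_mem' c f hf := ⟨Submodule.smul_mem _ c hf.1, by
    have := Submodule.smul_mem _ c hf.2
    rw [Derivation.map_smul, mul_smul_comm, mul_smul_comm, ← smul_add]
    exact this⟩

variable {f h : Fn D} {k l m : ℤ}

lemma LB (hf : f ∈ L D k) (hl : l ≤ k := by norm_num) : f ∈ B D l := Bw hf.1 hl
-- A function of strictly faster decay has zero coefficient at `r^{-l}`, and in particular no
-- logarithm there.
lemma BL (hf : f ∈ B D k) (hl : l < k := by norm_num) : f ∈ L D l :=
  ⟨Bw hf (by omega), add_mem (Bd1 hf (by omega)) (Bz _ (s_mul_mem hf (by omega)))⟩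
lemma L_of_d1 (hf : d 1 f + (k : Fn D) * (s D * f) ∈ B D (k + 2)) : f ∈ L D k :=
  ⟨B_of_d1s k le_rfl (Bw hf (by omega)), hf⟩
lemma Lm (hf : f ∈ L D k) (hh : h ∈ L D l) (hm : m = k + l := by norm_num) : f * h ∈ L D m := by
  subst hm
  refine ⟨Bm hf.1 hh.1 le_rfl, ?_⟩
  have h1 := add_mem (Bm (m := k + l + 2) hf.1 hh.2 (by omega)) (Bm hh.1 hf.2 (by omega))
  rw [Derivation.leibniz, smul_eq_mul, smul_eq_mul]
  convert h1 using 1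
  push_cast; ring
-- Derivatives transverse to `∂_r` commute with the operator `∂_r + k/r`.
lemma Ld (hf : f ∈ L D k) {c : Fin 4} (hc : c ≠ 1) : d c f ∈ L D k := by
  refine ⟨Bd hf.1 c le_rfl, ?_⟩
  have := Bd hf.2 c le_rfl
  simp only [map_add, Derivation.leibniz, Derivation.map_intCast, d_s hc, smul_eq_mul, mul_zero,
    add_zero] at this
  rwa [d_comm 1 c]
lemma s_L : s D ∈ L D 1 := ⟨s_mem, by rw [d1_s]; simp⟩
lemma r_L : r D ∈ L D (-1) := ⟨r_mem, by
  rw [d1_r]; push_cast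
  rw [show (1 : Fn D) + -1 * (s D * r D) = 0 by linear_combination -rs]; exact zero_mem _⟩
lemma Lz (n : ℤ) (hf : f ∈ L D k) : (n : Fn D) * f ∈ L D k := by
  rw [← zsmul_eq_mul]; exact zsmul_mem hf n
lemma Ln (n : ℕ) [n.AtLeastTwo] (h : f ∈ L D k) : (OfNat.ofNat n : Fn D) * f ∈ L D k := by
  have : (OfNat.ofNat n : Fn D) * f = n • f := by rw [nsmul_eq_mul]; rfl
  rw [this]; exact nsmul_mem h n
lemma Ld1 (hf : f ∈ L D k) (hl : l = k + 1 := by norm_num) : d 1 f ∈ L D l := by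
  have : d 1 f = (d 1 f + (k : Fn D) * (s D * f)) - (k : Fn D) * (s D * f) := by ring
  rw [this]
  exact sub_mem (BL hf.2 (by omega)) (Lz _ (Lm s_L hf (by omega)))
lemma L_cj (hf : f ∈ L D k) : cj f ∈ L D k := by
  refine ⟨B_cj hf.1, ?_⟩
  have := B_cj hf.2
  rwa [map_add, map_mul, map_mul, map_intCast, cj_s, ← d_cj] at this
lemma L_two (h : 2 * f ∈ L D k) : f ∈ L D k := by
  have : f = (1 / 2 : ℂ) • (2 * f) := by
    rw [two_mul, ← two_smul ℂ f, smul_smul]; norm_num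
  rw [this]; exact Submodule.smul_mem _ _ h
lemma IsPf.mem_L (hf : IsPf f) : f ∈ L D 0 := ⟨hf.mem, by rw [hf.d1]; simp⟩
lemma Ls (hf : f ∈ L D k) (hl : l = k + 1 := by norm_num) : s D * f ∈ L D l :=
  Lm s_L hf (by omega)
lemma Lr (hf : f ∈ L D k) (hl : l = k - 1 := by norm_num) : r D * f ∈ L D l :=
  Lm r_L hf (by omega)
lemma L_of_s (hf : s D * f ∈ L D k) (hl : l = k - 1 := by norm_num) : f ∈ L D l := by
  have : f = r D * (s D * f) := by linear_combination -f * rs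
  rw [this]; exact Lr hf hl

/-- If `f` vanishes at infinity and `∂_r f` has no logarithm at the order `r^{-2}`, then `f` has no
logarithm at the order `r^{-1}`. -/
lemma L_one_of_d1 (h1 : f ∈ B D 1) (h2 : d 1 f ∈ L D 2) : f ∈ L D 1 := by
  -- The identity `∂_r (r f' + f) = r (f'' + (2/r) f')` turns the condition on `f'` at order `r⁻²`
  -- into one on `f` at order `r⁻¹`. The integration is from infinity.
  have e : d 1 (r D * (d 1 f + s D * f)) = r D * (d 1 (d 1 f) + (2 : ℤ) * (s D * d 1 f)) := by
    simp only [map_add, Derivation.leibniz, d1_r, d1_s, smul_eq_mul]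
    push_cast
    linear_combination (-s D * f - d 1 f) * rs
  have h3 : r D * (d 1 f + s D * f) ∈ B D 2 := by
    refine B_of_d1' (r_mul_mem (k := 2) (add_mem (Bd1 h1) (s_mul_mem h1))) ?_
    rw [e]
    exact r_mul_mem h2.2
  exact ⟨h1, by simpa using mem_of_r (l := 3) h3⟩

/-- Membership in `L D 0` forces `∂_r (f ln r) = f / r` to be of order `r⁻²`. This reads off
coefficients of logarithms. -/
lemma IsPf.eq_zero_of_log (h : IsPf f) (hL : f * lnr D ∈ L D 0) : f = 0 := by
  refine h.eq_zero (mem_of_s (k := 2) ?_)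
  have := hL.2
  rw [Derivation.leibniz, h.d1, d1_lnr, smul_eq_mul, smul_zero, add_zero] at this
  rw [mul_comm]; simpa using this

lemma d_const (a : Fin 4) (c : ℂ) : d a (algebraMap ℂ (Fn D) c) = 0 := Derivation.map_algebraMap _ c

/-- The constant `1/√2`. -/
def ca (D : Nbhd) : Fn D := algebraMap ℂ _ ((1 / Real.sqrt 2 : ℝ) : ℂ)
def cI (D : Nbhd) : Fn D := algebraMap ℂ _ Complex.I

lemma ca_sq : 2 * (ca D * ca D) = 1 := by
  have h : (2 : ℂ) * (((1 / Real.sqrt 2 : ℝ) : ℂ) * ((1 / Real.sqrt 2 : ℝ) : ℂ)) = 1 := by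
    rw [← Complex.ofReal_mul, div_mul_div_comm, Real.mul_self_sqrt (by norm_num)]; norm_num
  have := congrArg (algebraMap ℂ (Fn D)) h
  rwa [map_mul, map_mul, map_one, map_ofNat] at this
lemma cI_sq : cI D * cI D = -1 := by
  rw [cI, ← map_mul, Complex.I_mul_I, map_neg, map_one]
lemma ca_pf : IsPf (ca D) := isPf_algebraMap _
lemma cI_pf : IsPf (cI D) := isPf_algebraMap _
lemma ca_mem : ca D ∈ B D 0 := ca_pf.mem
lemma cI_mem : cI D ∈ B D 0 := cI_pf.mem
lemma d_ca (a : Fin 4) : d a (ca D) = 0 := d_const a _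
lemma d_cI (a : Fin 4) : d a (cI D) = 0 := d_const a _
lemma cj_ca : cj (ca D) = ca D := by rw [ca, cj_algebraMap, Complex.conj_ofReal]
lemma cj_cI : cj (cI D) = -cI D := by rw [cI, cj_algebraMap, Complex.conj_I, map_neg]

end Fn

open Fn

variable {D : Nbhd} {G : Geo (Fn D)}

/-- The asymptotic behaviour of the tetrad.  `sn`, `cs`, `csc` stand for `sin θ`, `cos θ`,
`1 / sin θ`. -/
structure Tetrad.Flat (T : Tetrad G) (sn cs csc : Fn D) (x : Fin 2 → Fn D) : Prop where
  hd : G.d = Fn.d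
  sn_pf : IsPf sn
  cs_pf : IsPf cs
  csc_pf : IsPf csc
  sn_csc : sn * csc = 1
  csc_real : cj csc = csc
  d2_sn : d 2 sn = cs
  d0_sn : d 0 sn = 0
  d3_sn : d 3 sn = 0
  Q_mem : T.Q + algebraMap ℂ _ (1 / 2) ∈ B D 1
  C_mem : ∀ i, T.C i ∈ B D 1
  C_real : ∀ i, cj (T.C i) = T.C i
  zeta_eq : ∀ i, T.ζ i = cj (T.ξ i)
  xi0 : T.ξ 0 = s D * (ca D + x 0)
  xi1 : T.ξ 1 = s D * (-(cI D * ca D * csc) + x 1)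
  x_mem : ∀ i, x i ∈ B D 1
  d3_xi : ∀ i, d 3 (T.ξ i) = 0
  Psi0_mem : T.Ψ0 ∈ B D 4

namespace Tetrad.Flat

variable {T : Tetrad G} {sn cs csc : Fn D} {x : Fin 2 → Fn D} (F : T.Flat sn cs csc x)
include F

lemma zeta0 : T.ζ 0 = s D * (ca D + cj (x 0)) := by
  rw [F.zeta_eq, F.xi0, map_mul, map_add, cj_s, cj_ca]
lemma zeta1 : T.ζ 1 = s D * (cI D * ca D * csc + cj (x 1)) := by
  rw [F.zeta_eq, F.xi1, map_mul, map_add, map_neg, map_mul, map_mul, cj_s, cj_ca, cj_cI, F.csc_real]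
  ring

lemma d_csc (c : Fin 4) : d c csc = -(csc * csc * d c sn) := by
  have h := congrArg (d c) F.sn_csc
  rw [Derivation.leibniz, Derivation.map_one_eq_zero, smul_eq_mul, smul_eq_mul] at h
  linear_combination csc * h - d c csc * F.sn_csc

lemma xi_L (i : Fin 2) : T.ξ i ∈ L D 1 := by
  fin_cases i
  · change T.ξ 0 ∈ _
    rw [F.xi0]
    exact Ls (k := 0) (add_mem ca_pf.mem_L (BL (F.x_mem 0)))
  · change T.ξ 1 ∈ _
    rw [F.xi1]
    exact Ls (k := 0) (add_mem (neg_mem (Lm (Lm cI_pf.mem_L ca_pf.mem_L rfl) F.csc_pf.mem_L))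
      (BL (F.x_mem 1)))
lemma zeta_L (i : Fin 2) : T.ζ i ∈ L D 1 := by rw [F.zeta_eq]; exact L_cj (F.xi_L i)
lemma xi_mem (i : Fin 2) : T.ξ i ∈ B D 1 := LB (F.xi_L i)
lemma zeta_mem (i : Fin 2) : T.ζ i ∈ B D 1 := LB (F.zeta_L i)

/-- The determinant of `m`, `m̄` is invertible, of order `r^{-2}`. -/
lemma det_inv : ∃ k : Fn D, (T.ξ 0 * T.ζ 1 - T.ξ 1 * T.ζ 0) * k = 1 ∧ k ∈ L D (-2) := by
  obtain ⟨W, hW⟩ : ∃ W, W = T.ξ 0 * T.ζ 1 - T.ξ 1 * T.ζ 0 := ⟨_, rfl⟩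
  obtain ⟨k, hk⟩ : ∃ k, W * k = 1 := by
    -- The Gram determinant of `m`, `mb` is `-1` and equals `W²` times the determinant of the
    -- angular part of the metric, which exhibits the inverse of `W`.
    refine ⟨-(W * (G.g 2 2 * G.g 3 3 - G.g 2 3 * G.g 2 3)), ?_⟩
    have h1 := T.mm
    have h2 := T.mbmb
    have h3 := T.mmb
    simp only [Geo.gm, T.m_eq, T.mb_eq, Fin.sum_univ_four] at h1 h2 h3
    simp [G.g_symm 3 2] at h1 h2 h3
    rw [hW]
    linear_combination (-T.ζ 0 ^ 2 * G.g 2 2 - 2 * T.ζ 0 * T.ζ 1 * G.g 2 3 - T.ζ 1 ^ 2 * G.g 3 3) * h1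
      + (T.ξ 0 * T.ζ 0 * G.g 2 2 + T.ξ 0 * T.ζ 1 * G.g 2 3 + T.ξ 1 * T.ζ 0 * G.g 2 3
        + T.ξ 1 * T.ζ 1 * G.g 3 3 - 1) * h3
  refine ⟨k, hW ▸ hk, ?_⟩
  -- At leading order `W` is `i / (r² sin θ)`, so this normalization tends to `1` and the lemmas on
  -- inverses apply.
  have e1 : -(cI D * sn) * (r D * r D * W) - 1 = -(cI D * sn) *
      (ca D * cj (x 1) + x 0 * (cI D * ca D * csc + cj (x 1)) + cI D * ca D * csc * cj (x 0)
        - x 1 * (ca D + cj (x 0))) := by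
    rw [hW, F.xi0, F.xi1, F.zeta0, F.zeta1]
    linear_combination (-(cI D * sn) * ((ca D + x 0) * (cI D * ca D * csc + cj (x 1))
      - (-(cI D * ca D * csc) + x 1) * (ca D + cj (x 0))) * (r D * s D + 1)) * rs
      - cI D ^ 2 * (sn * csc) * ca_sq - cI D ^ 2 * F.sn_csc - cI_sq
  have h2 : -(cI D * sn) * (r D * r D * W) - 1 ∈ B D 1 := by
    rw [e1]
    have hx := F.x_mem
    have hxc := fun i => B_cj (F.x_mem i)
    have hI : cI D * ca D * csc ∈ B D 0 := Bm (Bm cI_mem ca_mem le_rfl) F.csc_pf.mem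
    have h3 := Bm (m := 1) ca_mem (hxc 1)
    have h4 := Bm (m := 1) (hx 0) (add_mem hI (Bw (hxc 1)))
    have h5 := Bm (m := 1) hI (hxc 0)
    have h6 := Bm (m := 1) (hx 1) (add_mem ca_mem (Bw (hxc 0)))
    exact Bm (neg_mem (Bm cI_mem F.sn_pf.mem le_rfl)) (sub_mem (add_mem (add_mem h3 h4) h5) h6)
  have hk0 : -(cI D * sn) * (r D * r D * W) * (cI D * csc * (s D * s D * k)) = 1 := by
    linear_combination (-cI D * cI D * (sn * csc) * (r D * s D) ^ 2) * hk
      - (sn * csc) * (r D * s D) ^ 2 * cI_sq + (r D * s D) ^ 2 * F.sn_csc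
      + (1 + r D * s D) * rs
  have hk1 := B_inv_sub hk0 h2
  have hk2 : cI D * csc * (s D * s D * k) ∈ L D 0 := by
    have := add_mem (BL hk1 (l := 0)) (isPf_algebraMap 1).mem_L
    rwa [map_one, sub_add_cancel] at this
  have e3 : k = -(cI D * sn) * (r D * r D * (cI D * csc * (s D * s D * k))) := by
    linear_combination k * ((sn * csc) * (r D * s D) ^ 2 * cI_sq - (r D * s D) ^ 2 * F.sn_csc
      - (1 + r D * s D) * rs)
  rw [e3]
  exact Lm (k := 0) (l := -2) (neg_mem (Lm cI_pf.mem_L F.sn_pf.mem_L))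
    (Lm (k := -2) (Lm r_L r_L) hk2)

/-- Solving for the components in the basis `m`, `m̄`. -/
lemma solve {X Y : Fn D} {v : Fin 2 → Fn D} (h : ∀ i, X * T.ξ i + Y * T.ζ i = v i) :
    ∃ k ∈ L D (-2), X = (v 0 * T.ζ 1 - v 1 * T.ζ 0) * k ∧ Y = (T.ξ 0 * v 1 - T.ξ 1 * v 0) * k := by
  obtain ⟨k, hk, hkL⟩ := F.det_inv
  refine ⟨k, hkL, ?_, ?_⟩
  · rw [← h 0, ← h 1]; linear_combination -X * hk
  · rw [← h 0, ← h 1]; linear_combination -Y * hk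

/-- By Cramer's rule: the inverse determinant costs `r²` and the other leg contributes `r⁻¹`, so one
order is lost. -/
lemma solve_B {X Y : Fn D} {v : Fin 2 → Fn D} {j l : ℤ} (h : ∀ i, X * T.ξ i + Y * T.ζ i = v i)
    (hv : ∀ i, v i ∈ B D l) (hj : j ≤ l - 1 := by norm_num) : X ∈ B D j ∧ Y ∈ B D j := by
  obtain ⟨k, hk, rfl, rfl⟩ := F.solve h
  have hz := F.zeta_mem
  have hx := F.xi_mem
  constructor <;> refine Bm (k := l + 1) (sub_mem ?_ ?_) hk.1 (by omega) <;>
    first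
    | exact Bm (hv _) (hz _)
    | exact Bm (hx _) (hv _) (by omega)

lemma solve_L {X Y : Fn D} {v : Fin 2 → Fn D} {j l : ℤ} (h : ∀ i, X * T.ξ i + Y * T.ζ i = v i)
    (hv : ∀ i, v i ∈ L D l) (hj : j = l - 1 := by norm_num) : X ∈ L D j ∧ Y ∈ L D j := by
  obtain ⟨k, hk, rfl, rfl⟩ := F.solve h
  have hz := F.zeta_L
  have hx := F.xi_L
  constructor <;> refine Lm (k := l + 1) (sub_mem ?_ ?_) hk (by omega) <;>
    first
    | exact Lm (hv _) (hz _)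
    | exact Lm (hx _) (hv _) (by omega)

lemma solve_unique {X Y X' Y' : Fn D} (h : ∀ i, X * T.ξ i + Y * T.ζ i = X' * T.ξ i + Y' * T.ζ i) :
    X = X' ∧ Y = Y' := by
  obtain ⟨k, hk, -⟩ := F.det_inv
  constructor
  · linear_combination (T.ζ 1 * h 0 - T.ζ 0 * h 1) * k - (X - X') * hk
  · linear_combination (T.ξ 0 * h 1 - T.ξ 1 * h 0) * k - (Y - Y') * hk

end Tetrad.Flat
end BoostRot
end

/-! ### Decay of the spin coefficients and the Weyl scalars -/

noncomputable section

namespace BoostRot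

open Fn

namespace Tetrad.Flat

variable {D : Nbhd} {G : Geo (Fn D)} {T : Tetrad G} {sn cs csc : Fn D} {x : Fin 2 → Fn D}
  (F : T.Flat sn cs csc x)
include F

lemma Dm (f : Fn D) : G.Dv T.m f = T.ξ 0 * d 2 f + T.ξ 1 * d 3 f := by rw [T.Dv_m, F.hd]
lemma Dmb (f : Fn D) : G.Dv T.mb f = T.ζ 0 * d 2 f + T.ζ 1 * d 3 f := by rw [T.Dv_mb, F.hd]
lemma Dn (f : Fn D) : G.Dv T.n f = d 0 f + T.Q * d 1 f + T.C 0 * d 2 f + T.C 1 * d 3 f := by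
  rw [T.Dv_n, F.hd]

lemma Q_L : T.Q ∈ L D 0 := by
  have := sub_mem (BL F.Q_mem (l := 0)) (isPf_algebraMap (1 / 2)).mem_L
  rwa [add_sub_cancel_right] at this

lemma Dm_B {f : Fn D} {k l : ℤ} (h : f ∈ B D k) (hl : l ≤ k + 1 := by norm_num) :
    G.Dv T.m f ∈ B D l := by
  rw [F.Dm]
  exact add_mem (Bm (F.xi_mem 0) (B_d h 2) (by omega)) (Bm (F.xi_mem 1) (B_d h 3) (by omega))
lemma Dmb_B {f : Fn D} {k l : ℤ} (h : f ∈ B D k) (hl : l ≤ k + 1 := by norm_num) :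
    G.Dv T.mb f ∈ B D l := by
  rw [F.Dmb]
  exact add_mem (Bm (F.zeta_mem 0) (B_d h 2) (by omega)) (Bm (F.zeta_mem 1) (B_d h 3) (by omega))
lemma Dm_L {f : Fn D} {k l : ℤ} (h : f ∈ L D k) (hl : l = k + 1 := by norm_num) :
    G.Dv T.m f ∈ L D l := by
  rw [F.Dm]
  exact add_mem (Lm (F.xi_L 0) (Ld h (by decide)) (by omega))
    (Lm (F.xi_L 1) (Ld h (by decide)) (by omega))
lemma Dmb_L {f : Fn D} {k l : ℤ} (h : f ∈ L D k) (hl : l = k + 1 := by norm_num) :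
    G.Dv T.mb f ∈ L D l := by
  rw [F.Dmb]
  exact add_mem (Lm (F.zeta_L 0) (Ld h (by decide)) (by omega))
    (Lm (F.zeta_L 1) (Ld h (by decide)) (by omega))

/-! ### The shear and the expansion -/

/-- The leading part `1/r` of the legs satisfies the equation with `ρ = -1/r`, `σ = 0`, so only the
remainders `x` act as a source. -/
lemma d_xi' (i : Fin 2) : (T.ρ + s D) * T.ξ i + T.σ * T.ζ i = s D * d 1 (x i) := by
  have h := T.d_xi i
  rw [F.hd] at h
  have e : d 1 (T.ξ i) = s D * d 1 (x i) - s D * T.ξ i := by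
    fin_cases i
    · change d 1 (T.ξ 0) = s D * d 1 (x 0) - s D * T.ξ 0
      rw [F.xi0]
      simp only [Derivation.leibniz, map_add, d_ca, d1_s, smul_eq_mul]; ring
    · change d 1 (T.ξ 1) = s D * d 1 (x 1) - s D * T.ξ 1
      rw [F.xi1]
      simp only [Derivation.leibniz, map_add, map_neg, d_ca, d_cI, F.csc_pf.d1, d1_s, smul_eq_mul]
      ring
  linear_combination -h + e

/-- The equations for `ξ` and its conjugate determine both pairs of coefficients uniquely. -/
lemma sigb_rho : T.σb = cj T.σ ∧ T.ρ = cj T.ρ := by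
  refine F.solve_unique fun i => ?_
  have h := T.d_xi i
  have h' := T.d_zeta i
  rw [F.hd] at h h'
  have := congrArg cj h
  rw [← d_cj, map_add, map_mul, map_mul, ← F.zeta_eq, h', F.zeta_eq, cj_cj] at this
  rw [F.zeta_eq]
  linear_combination this

lemma rho_sigma_B : T.ρ + s D ∈ B D 2 ∧ T.σ ∈ B D 2 :=
  F.solve_B (l := 3) F.d_xi' fun i => s_mul_mem (k := 2) (Bd1 (F.x_mem i))
lemma sigmab_B : T.σb ∈ B D 2 := by rw [F.sigb_rho.1]; exact B_cj F.rho_sigma_B.2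

/-- The quadratic terms in Sachs' equation, after removal of `-1/r` from `ρ`, are of order `r⁻⁴`, as
is `Ψ₀`. So no logarithm can arise at order `r⁻²`. -/
lemma sigma_L : T.σ ∈ L D 2 := by
  refine L_of_d1 ?_
  have h := T.d_sigma
  rw [F.hd] at h
  have e : d 1 T.σ + ((2 : ℤ) : Fn D) * (s D * T.σ) = 2 * ((T.ρ + s D) * T.σ) + T.Ψ0 := by
    rw [h]; push_cast; ring
  rw [e]
  exact add_mem (Bnat 2 (Bm F.rho_sigma_B.1 F.rho_sigma_B.2)) F.Psi0_mem

lemma rho_L : T.ρ + s D ∈ L D 2 := by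
  refine L_of_d1 ?_
  have h := T.d_rho
  rw [F.hd] at h
  have e : d 1 (T.ρ + s D) + ((2 : ℤ) : Fn D) * (s D * (T.ρ + s D))
      = (T.ρ + s D) * (T.ρ + s D) + T.σ * T.σb := by
    rw [map_add, h, d1_s]; push_cast; ring
  rw [e]
  exact add_mem (Bm F.rho_sigma_B.1 F.rho_sigma_B.1) (Bm F.rho_sigma_B.2 F.sigmab_B)

/-- The assumptions allow logarithms in the first correction to the legs. They are excluded here
because `ρ + 1/r` and `σ` have none at leading order. -/
lemma x_L (i : Fin 2) : x i ∈ L D 1 := by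
  refine L_one_of_d1 (F.x_mem i) (L_of_s (k := 3) ?_)
  rw [← F.d_xi']
  exact add_mem (Lm F.rho_L (F.xi_L i)) (Lm F.sigma_L (F.zeta_L i))

/-! ### Axial symmetry -/

lemma d3_zeta (i : Fin 2) : d 3 (T.ζ i) = 0 := by rw [F.zeta_eq, d_cj, F.d3_xi, map_zero]

/-- Invariance of `ξ` under `∂_φ` passes to `ρ` and `σ` by unique solvability, and then to `Ψ₀` by
Sachs' equation. -/
lemma d3_Psi0 : d 3 T.Ψ0 = 0 := by
  have h : d 3 T.ρ = 0 ∧ d 3 T.σ = 0 := F.solve_unique fun i => by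
    have h := congrArg (d 3) (T.d_xi i)
    rw [F.hd, d_comm, F.d3_xi] at h
    simp only [map_zero, map_add, Derivation.leibniz, F.d3_xi, F.d3_zeta, smul_eq_mul] at h
    linear_combination -h
  have h1 := congrArg (d 3) T.d_sigma
  rw [F.hd, d_comm, h.2, show 2 * T.ρ * T.σ = T.ρ * T.σ + T.ρ * T.σ by ring] at h1
  simp only [map_zero, map_add, Derivation.leibniz, h.1, h.2, smul_eq_mul, mul_zero, add_zero,
    zero_add] at h1
  exact h1.symm

/-! ### The remaining spin coefficients -/

lemma comm_mmb' (i : Fin 2) : -T.bb * T.ξ i + T.b * T.ζ i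
    = T.ξ 0 * d 2 (T.ζ i) - T.ζ 0 * d 2 (T.ξ i) := by
  have h := T.comm_mmb i
  rw [F.Dm, F.Dmb, F.d3_xi, F.d3_zeta] at h
  linear_combination -h

lemma bb_b_L : -T.bb ∈ L D 1 ∧ T.b ∈ L D 1 :=
  F.solve_L (l := 2) F.comm_mmb' fun i =>
    sub_mem (Lm (F.xi_L 0) (Ld (F.zeta_L i) (by decide)))
      (Lm (F.zeta_L 0) (Ld (F.xi_L i) (by decide)))

/-- The leading term is the connection of the round sphere, `cot θ / √2`, coming from the
`θ`-derivative of `1 / sin θ` in the legs. -/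
lemma bb_B : T.bb + s D * (ca D * (cs * csc)) ∈ B D 2 := by
  have hx := F.x_mem
  have hc := F.csc_pf.mem
  have hxc := fun i => B_cj (F.x_mem i)
  have hd := fun i => B_d (F.x_mem i) 2
  have hdc := fun i => B_d (hxc i) 2
  have hcot : ca D * (cs * csc) ∈ B D 0 := Bm ca_mem (Bm F.cs_pf.mem hc le_rfl)
  obtain ⟨v, hv⟩ : ∃ v : Fin 2 → Fn D, v = ![
    s D * (s D * ((ca D + x 0) * d 2 (cj (x 0)) - (ca D + cj (x 0)) * d 2 (x 0)
      + ca D * (cs * csc) * (cj (x 0) - x 0))),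
    s D * (s D * (ca D * d 2 (cj (x 1)) + x 0 * (cI D * ca D * d 2 csc + d 2 (cj (x 1)))
      - ca D * d 2 (x 1) - cj (x 0) * (-(cI D * ca D * d 2 csc) + d 2 (x 1))
      + ca D * (cs * csc) * (cj (x 1) - x 1)))] := ⟨_, rfl⟩
  have h : ∀ i, -(T.bb + s D * (ca D * (cs * csc))) * T.ξ i
      + (T.b + s D * (ca D * (cs * csc))) * T.ζ i = v i := by
    intro i
    have h := F.comm_mmb' i
    have e2 := F.d_csc 2
    rw [F.d2_sn] at e2
    subst hv
    fin_cases i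
    · change -T.bb * T.ξ 0 + T.b * T.ζ 0 = T.ξ 0 * d 2 (T.ζ 0) - T.ζ 0 * d 2 (T.ξ 0) at h
      simp only [F.xi0, F.zeta0, Derivation.leibniz, map_add, d_ca, d_s (show (2 : Fin 4) ≠ 1 by decide),
        smul_eq_mul] at h
      simp only [Fin.zero_eta, F.xi0, F.zeta0, Matrix.cons_val_zero]
      linear_combination h
    · change -T.bb * T.ξ 1 + T.b * T.ζ 1 = T.ξ 0 * d 2 (T.ζ 1) - T.ζ 0 * d 2 (T.ξ 1) at h
      simp only [F.xi0, F.xi1, F.zeta1, F.zeta0, Derivation.leibniz, map_add, map_neg, d_ca, d_cI,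
        d_s (show (2 : Fin 4) ≠ 1 by decide), smul_eq_mul] at h
      simp only [Fin.mk_one, F.xi1, F.zeta1, Matrix.cons_val_one, Matrix.cons_val_fin_one]
      linear_combination h + 2 * s D ^ 2 * ca D ^ 2 * cI D * e2
  have hv : ∀ i, v i ∈ B D 3 := by
    intro i
    subst hv
    have hca := Bw (l := 0) (ca_mem (D := D))
    have hq : cI D * ca D * d 2 csc ∈ B D 0 := Bm (Bm cI_mem ca_mem le_rfl) (B_d hc 2)
    fin_cases i
    · refine s_mul_mem (k := 2) (s_mul_mem (k := 1) (add_mem (sub_mem ?_ ?_) ?_))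
      · exact Bm (add_mem hca (Bw (hx 0))) (hdc 0)
      · exact Bm (add_mem hca (Bw (hxc 0))) (hd 0)
      · exact Bm hcot (sub_mem (hxc 0) (hx 0))
    · refine s_mul_mem (k := 2) (s_mul_mem (k := 1)
        (add_mem (sub_mem (sub_mem (add_mem ?_ ?_) ?_) ?_) ?_))
      · exact Bm hca (hdc 1)
      · exact Bm (hx 0) (add_mem hq (Bw (hdc 1)))
      · exact Bm hca (hd 1)
      · exact Bm (hxc 0) (add_mem (neg_mem hq) (Bw (hd 1)))
      · exact Bm hcot (sub_mem (hxc 1) (hx 1))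
  simpa using neg_mem (F.solve_B (l := 3) h hv (j := 2)).1

lemma tau_conj : T.τb = cj T.τ := by
  have h : 2 * T.τb = 2 * cj T.τ ∧ 2 * T.τ = 2 * cj T.τb := F.solve_unique fun i => by
    have h := T.d_C i
    rw [F.hd] at h
    have h' := congrArg cj h
    simp only [← d_cj, F.C_real, map_add, map_mul, ← F.zeta_eq, map_ofNat] at h'
    rw [h, F.zeta_eq, cj_cj] at h'
    rw [F.zeta_eq]
    linear_combination h'
  exact sub_eq_zero.1 (Geo.two_cancel (by linear_combination h.1))

/-- First step of a bootstrap: the decay of `C` bounds `τ`, this bounds `Ψ₁`, the Ricci identity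
improves `τ`, and the Bianchi identity then improves `Ψ₁` again up to order `r⁻⁴`. -/
lemma tau_B1 : T.τ ∈ B D 1 :=
  B_two (F.solve_B (X := 2 * T.τb) (l := 2) (v := fun i => d 1 (T.C i))
    (fun i => by rw [← F.hd]; exact (T.d_C i).symm) (fun i => Bd1 (F.C_mem i))).2

lemma rho_B : T.ρ ∈ B D 1 := by
  have := sub_mem (Bw F.rho_sigma_B.1 (l := 1)) s_mem
  rwa [add_sub_cancel_right] at this

lemma Psi1_B : T.Ψ1 ∈ B D 3 := by
  have hs := F.rho_sigma_B.2
  have ht := F.tau_B1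
  have htb : T.τb ∈ B D 1 := by rw [F.tau_conj]; exact B_cj ht
  have h2 : T.Ψ1 ∈ B D 2 := by
    rw [T.Psi1_eq, F.hd, mul_assoc, mul_assoc]
    exact sub_mem (sub_mem (Bd1 ht) (Bnat 2 (Bm ht F.rho_B))) (Bnat 2 (Bm htb hs))
  have h := T.bianchi_Psi1
  rw [F.hd] at h
  have e : d 1 T.Ψ1 + ((4 : ℤ) : Fn D) * (s D * T.Ψ1)
      = G.Dv T.mb T.Ψ0 - (T.τb + 2 * T.bb) * T.Ψ0 + 4 * ((T.ρ + s D) * T.Ψ1) := by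
    rw [h]; push_cast; ring
  refine B_of_d1s 4 (by norm_num) ?_
  rw [e]
  have hbb : T.bb ∈ B D 1 := by simpa using neg_mem (LB F.bb_b_L.1 (l := 1))
  exact add_mem (sub_mem (F.Dmb_B F.Psi0_mem)
    (Bm (k := 1) (add_mem htb (Bnat 2 hbb)) F.Psi0_mem)) (Bnat 4 (Bm F.rho_sigma_B.1 h2))

lemma tau_B : T.τ ∈ B D 2 := by
  have h := T.Psi1_eq
  rw [F.hd] at h
  have e : d 1 T.τ + ((2 : ℤ) : Fn D) * (s D * T.τ)
      = 2 * ((T.ρ + s D) * T.τ) + 2 * (T.τb * T.σ) + T.Ψ1 := by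
    rw [h]; push_cast; ring
  have htb : T.τb ∈ B D 1 := by rw [F.tau_conj]; exact B_cj F.tau_B1
  refine B_of_d1s 2 le_rfl ?_
  rw [e]
  exact add_mem (add_mem (Bnat 2 (Bm F.rho_sigma_B.1 F.tau_B1))
    (Bnat 2 (Bm htb F.rho_sigma_B.2))) F.Psi1_B

lemma taub_B : T.τb ∈ B D 2 := by rw [F.tau_conj]; exact B_cj F.tau_B

lemma Psi1_B4 : T.Ψ1 ∈ B D 4 := by
  have h := T.bianchi_Psi1
  rw [F.hd] at h
  have e : d 1 T.Ψ1 + ((4 : ℤ) : Fn D) * (s D * T.Ψ1)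
      = G.Dv T.mb T.Ψ0 - (T.τb + 2 * T.bb) * T.Ψ0 + 4 * ((T.ρ + s D) * T.Ψ1) := by
    rw [h]; push_cast; ring
  refine B_of_d1s 4 le_rfl ?_
  rw [e]
  have hbb : T.bb ∈ B D 1 := by simpa using neg_mem (LB F.bb_b_L.1 (l := 1))
  exact add_mem (sub_mem (F.Dmb_B F.Psi0_mem)
    (Bm (k := 1) (add_mem (Bw F.taub_B) (Bnat 2 hbb)) F.Psi0_mem))
    (Bnat 4 (Bm F.rho_sigma_B.1 F.Psi1_B))

/-- The derivative of `C` is of order `r⁻³` by the improved decay of `τ`, and `C` vanishes at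
infinity. -/
lemma C_B (i : Fin 2) : T.C i ∈ B D 2 := by
  refine B_of_d1' (F.C_mem i) ?_
  rw [← F.hd, T.d_C, mul_assoc, mul_assoc]
  exact add_mem (Bnat 2 (Bm F.taub_B (F.xi_mem i))) (Bnat 2 (Bm F.tau_B (F.zeta_mem i)))

lemma gamma_B : T.γ ∈ B D 2 := by
  have h := T.d_Q
  rw [F.hd] at h
  have h1 := Bd1 F.Q_mem (l := 2)
  rw [map_add, d_const, add_zero, h] at h1
  simpa using neg_mem h1

lemma Dn_L {f : Fn D} {k : ℤ} (h : f ∈ L D k) : G.Dv T.n f - d 0 f ∈ L D (k + 1) := by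
  have e : G.Dv T.n f - d 0 f = T.Q * d 1 f + T.C 0 * d 2 f + T.C 1 * d 3 f := by rw [F.Dn]; ring
  rw [e]
  exact add_mem (add_mem (Lm F.Q_L (Ld1 h rfl) (by omega))
    (Lm (BL (l := 1) (F.C_B 0)) (Ld h (by decide)) (by omega)))
    (Lm (BL (l := 1) (F.C_B 1)) (Ld h (by decide)) (by omega))

lemma d0_xi_L (i : Fin 2) : d 0 (T.ξ i) ∈ L D 2 := by
  have h0 : (0 : Fin 4) ≠ 1 := by decide
  have e : d 0 (T.ξ i) = s D * d 0 (x i) := by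
    have e0 := F.d_csc 0
    rw [F.d0_sn, mul_zero, neg_zero] at e0
    fin_cases i
    · change d 0 (T.ξ 0) = s D * d 0 (x 0)
      rw [F.xi0]; simp only [Derivation.leibniz, map_add, d_ca, d_s h0, smul_eq_mul]; ring
    · change d 0 (T.ξ 1) = s D * d 0 (x 1)
      rw [F.xi1]
      simp only [Derivation.leibniz, map_add, map_neg, d_ca, d_cI, e0, d_s h0, smul_eq_mul]; ring
  rw [e]
  exact Ls (k := 1) (Ld (F.x_L i) h0)

/-- The commutators `[n, m]` and `[n, mb]` are solved for the combinations `c + μ` and `μ - c`. The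
`u`-derivative of the legs starts at `r⁻²` since their leading terms do not depend on `u`. -/
lemma mu_c_lam_L : T.μ ∈ L D 1 ∧ T.c ∈ L D 1 ∧ T.lamb ∈ L D 1 := by
  have h1 : T.c + T.μ ∈ L D 1 := by
    have h := fun i => T.comm_nm i
    have := F.solve_L (X := -(T.c + T.μ)) (Y := -T.lam) (l := 2) (j := 1)
      (v := fun i => d 0 (T.ξ i) + (G.Dv T.n (T.ξ i) - d 0 (T.ξ i)) - G.Dv T.m (T.C i))
      (fun i => by linear_combination -(h i))
      (fun i => sub_mem (add_mem (F.d0_xi_L i) (F.Dn_L (F.xi_L i)))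
        (F.Dm_L (BL (l := 1) (F.C_B i))))
    simpa only [neg_neg] using neg_mem this.1
  have h2 : T.lamb ∈ L D 1 ∧ T.μ - T.c ∈ L D 1 := by
    have h := fun i => T.comm_nmb i
    have := F.solve_L (X := -T.lamb) (Y := -(T.μ - T.c)) (l := 2) (j := 1)
      (v := fun i => d 0 (T.ζ i) + (G.Dv T.n (T.ζ i) - d 0 (T.ζ i)) - G.Dv T.mb (T.C i))
      (fun i => by linear_combination -(h i))
      (fun i => sub_mem (add_mem (by rw [F.zeta_eq, d_cj]; exact L_cj (F.d0_xi_L i))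
        (F.Dn_L (F.zeta_L i))) (F.Dmb_L (BL (l := 1) (F.C_B i))))
    exact ⟨by simpa only [neg_neg] using neg_mem this.1,
      by simpa only [neg_neg] using neg_mem this.2⟩
  refine ⟨L_two ?_, L_two ?_, h2.1⟩
  · have := add_mem h1 h2.2
    convert this using 1; ring
  · have := sub_mem h1 h2.2
    convert this using 1; ring

lemma P2_L : T.P2 ∈ L D 3 := by
  have he := F.rho_sigma_B.1
  have hmu := LB F.mu_c_lam_L.1 (l := 1)
  have hlb := LB F.mu_c_lam_L.2.2 (l := 1)
  have hbb : T.bb ∈ B D 1 := by simpa using neg_mem (LB F.bb_b_L.1 (l := 1))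
  have h2 : T.P2 ∈ B D 2 := by
    have h0 : (0 : Fin 4) ≠ 1 := by decide
    have hn : G.Dv T.n T.ρ ∈ B D 2 := by
      have h1 : T.ρ ∈ L D 1 := by
        have := sub_mem (BL he (l := 1)) s_L
        rwa [add_sub_cancel_right] at this
      have h3 : d 0 T.ρ ∈ B D 2 := by
        have := Bd he 0 (l := 2)
        rwa [map_add, d_s h0, add_zero] at this
      have := add_mem h3 (LB (F.Dn_L h1) (l := 2))
      rwa [add_sub_cancel] at this
    rw [T.P2_eq]
    exact add_mem (add_mem (add_mem (sub_mem (sub_mem (add_mem hn (Bm F.tau_B F.taub_B))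
      (Bm F.gamma_B F.rho_B)) (F.Dmb_B F.tau_B)) (Bm F.tau_B hbb)) (Bm hmu F.rho_B))
      (Bm hlb F.rho_sigma_B.2)
  have h := T.bianchi_P2
  rw [F.hd] at h
  have e : d 1 T.P2 + ((3 : ℤ) : Fn D) * (s D * T.P2)
      = 3 * ((T.ρ + s D) * T.P2) - G.Dv T.mb T.Ψ1 - (T.τb - T.bb) * T.Ψ1 + T.lamb * T.Ψ0 := by
    rw [h]; push_cast; ring
  -- Used twice: with the rough order `2` it yields order `3`, and with order `3` it yields the
  -- absence of a logarithm.
  have hrest : ∀ {k : ℤ}, T.P2 ∈ B D k → k ≤ 3 →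
      d 1 T.P2 + ((3 : ℤ) : Fn D) * (s D * T.P2) ∈ B D (k + 2) := by
    intro k hk hk3
    rw [e]
    refine add_mem (sub_mem (sub_mem ?_ (F.Dmb_B F.Psi1_B4 (by omega))) ?_) ?_
    · exact Bnat 3 (Bm he hk (by omega))
    · exact Bm (k := 1) (sub_mem (Bw F.taub_B) hbb) F.Psi1_B4 (by omega)
    · exact Bm hlb F.Psi0_mem (by omega)
  have h3 : T.P2 ∈ B D 3 := B_of_d1s 3 le_rfl (Bw (hrest h2 (by norm_num)))
  exact L_of_d1 (hrest h3 le_rfl)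

end Tetrad.Flat
end BoostRot
end

/-! ### The boost-rotation vector at null infinity and its action on `Ψ₀` -/

noncomputable section

namespace BoostRot

open Fn

variable {D : Nbhd} {G : Geo (Fn D)}

/-- A Killing vector `X` that is invariant under rotations, with `X^θ → χ`. -/
structure Geo.Boost (G : Geo (Fn D)) (X : Fin 4 → Fn D) (χ : Fn D) : Prop where
  killing : ∀ V W, G.Dv X (G.gm V W) = G.gm (G.br X V) W + G.gm V (G.br X W)
  X1_mem : X 1 ∈ B D (-1)
  X2_mem : X 2 - χ ∈ B D 1
  d3_X : ∀ i, Fn.d 3 (X i) = 0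
  chi_pf : IsPf χ

/-- The expansion of a minimal `Ψ₀`. -/
structure Tetrad.Minimal (T : Tetrad G) (ψ4 ψ5 : Fn D) : Prop where
  pf4 : IsPf ψ4
  pf5 : IsPf ψ5
  mem : T.Ψ0 - s D ^ 4 * ψ4 - s D ^ 5 * (ψ5 * lnr D) ∈ L D 5

namespace Tetrad.Flat

variable {T : Tetrad G} {sn cs csc : Fn D} {x : Fin 2 → Fn D}
  (F : T.Flat sn cs csc x) {X : Fin 4 → Fn D} {χ : Fn D} (K : G.Boost X χ)
include F K

lemma Dv_X (f : Fn D) : G.Dv X f = X 0 * d 0 f + X 1 * d 1 f + X 2 * d 2 f + X 3 * d 3 f := by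
  rw [Geo.Dv, F.hd, Fin.sum_univ_four]

lemma d1_X0 : d 1 (X 0) = 0 := by rw [← F.hd]; exact T.killing_d_X0 K.killing

lemma X0_L : X 0 ∈ L D 0 := L_of_d1 (by rw [F.d1_X0 K]; simp)

/-- The rate `∂_r X^θ` is given by angular derivatives of `X^u`, which is constant along the
generators. It therefore has order `r⁻²` without a logarithm. -/
lemma X2_L : d 1 (X 2) ∈ L D 2 ∧ X 2 - χ ∈ L D 1 ∧ X 2 ∈ L D 0 := by
  have h : d 1 (X 2) ∈ L D 2 := by
    rw [← F.hd, T.killing_d_X2 K.killing]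
    exact add_mem (Lm (F.Dmb_L (F.X0_L K) (l := 1)) (F.xi_L 0))
      (Lm (F.Dm_L (F.X0_L K) (l := 1)) (F.zeta_L 0))
  refine ⟨h, L_one_of_d1 K.X2_mem (by rwa [map_sub, K.chi_pf.d1, sub_zero]), L_of_d1 ?_⟩
  simpa using LB h

lemma X3_L : X 3 ∈ L D 0 := by
  have h : d 1 (X 3) ∈ L D 2 := by
    rw [← F.hd, T.killing_d_X3 K.killing]
    exact add_mem (Lm (F.Dmb_L (F.X0_L K) (l := 1)) (F.xi_L 1))
      (Lm (F.Dm_L (F.X0_L K) (l := 1)) (F.zeta_L 1))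
  refine L_of_d1 ?_
  simpa using LB h

/-- Integrating `∂_r X^r = -n(X^u)`: the part `∂_u X^u` is constant along the generators and
integrates to a multiple of `r`, and the rest is of order `r⁻²`. -/
lemma X1_aux : X 1 + r D * d 0 (X 0) ∈ L D 0 := by
  have h0 : (0 : Fin 4) ≠ 1 := by decide
  refine L_of_d1 ?_
  have h := T.killing_d_X1 K.killing
  rw [F.hd, F.Dn, F.d1_X0 K, K.d3_X] at h
  have e : d 1 (X 1 + r D * d 0 (X 0)) = -(T.C 0 * d 2 (X 0)) := by
    rw [map_add, h, Derivation.leibniz, d1_r, d_comm, F.d1_X0 K, map_zero]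
    simp only [smul_eq_mul]; ring
  rw [e]
  simpa using neg_mem (Bm (m := 2) (F.C_B 0) (Bd (LB (F.X0_L K) (l := 0)) 2 (l := 0)))

lemma X1_L : X 1 ∈ L D (-1) := by
  have := sub_mem (BL (LB (F.X1_aux K) (l := 0)) (l := -1))
    (Lr (l := -1) (Ld (F.X0_L K) (c := 0) (by decide)))
  rwa [add_sub_cancel_right] at this

/-- `∂_r X^r = X^r / r` up to lower order terms. -/
lemma d1_X1_sub : d 1 (X 1) - s D * X 1 ∈ L D 1 := by
  have h := T.killing_d_X1 K.killing
  rw [F.hd] at h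
  have e : d 1 (X 1) - s D * X 1
      = -(G.Dv T.n (X 0) - d 0 (X 0)) - s D * (X 1 + r D * d 0 (X 0)) := by
    rw [h]; linear_combination d 0 (X 0) * rs
  rw [e]
  exact sub_mem (neg_mem (F.Dn_L (F.X0_L K))) (Ls (F.X1_aux K))

/-- Division by a function tending to `1/√2`, done in two passes: the first gives `v = O(r⁻¹)` up to
logarithms, after which `y v` is of order `r⁻²` and cannot affect the leading term. -/
lemma cancel_unit {y v : Fn D} (hy : y ∈ B D 1) (hv : v ∈ B D 0) (h : (ca D + y) * v ∈ L D 1) :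
    v ∈ L D 1 := by
  have e : v = 2 * (ca D * ((ca D + y) * v)) - 2 * (ca D * (y * v)) := by
    linear_combination -v * ca_sq
  have h1 : 2 * (ca D * ((ca D + y) * v)) ∈ L D 1 := Ln 2 (Lm ca_pf.mem_L h)
  have h2 : v ∈ B D 1 := by
    rw [e]
    exact sub_mem (LB h1) (Bnat 2 (Bm ca_mem (Bm hy hv le_rfl)))
  rw [e]
  exact sub_mem h1 (BL (k := 2) (Bnat 2 (Bm ca_mem (Bm hy h2 le_rfl))))

lemma w_B : T.w X ∈ B D 0 := by
  have hX0 := LB (F.X0_L K) (l := 0)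
  have hX2 := LB (F.X2_L K).2.2 (l := 0)
  have hX3 := LB (F.X3_L K) (l := 0)
  have hD : ∀ i, G.Dv X (T.ξ i) ∈ B D 1 := fun i => by
    rw [F.Dv_X K]
    have := F.xi_mem i
    exact add_mem (add_mem (add_mem (Bm hX0 (B_d this 0)) (Bm K.X1_mem (Bd1 this (l := 2))))
      (Bm hX2 (B_d this 2))) (Bm hX3 (B_d this 3))
  refine (F.solve_B (X := T.w X) (Y := 0) (l := 1)
    (v := ![-G.Dv T.m (X 0) * T.C 0 - G.Dv X (T.ξ 0) + G.Dv T.m (X 2),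
      -G.Dv T.m (X 0) * T.C 1 - G.Dv X (T.ξ 1) + G.Dv T.m (X 3)]) ?_ ?_).1
  · intro i
    fin_cases i
    · simp only [Fin.zero_eta, Matrix.cons_val_zero]
      linear_combination T.killing_xi0 K.killing
    · simp only [Fin.mk_one, Matrix.cons_val_one, Matrix.cons_val_fin_one]
      linear_combination T.killing_xi1 K.killing
  · intro i
    fin_cases i
    · exact add_mem (sub_mem (Bm (neg_mem (F.Dm_B hX0 (l := 1))) (F.C_B 0)) (hD 0)) (F.Dm_B hX2)
    · exact add_mem (sub_mem (Bm (neg_mem (F.Dm_B hX0 (l := 1))) (F.C_B 1)) (hD 1)) (F.Dm_B hX3)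

lemma DX_L (y : Fn D) (hy : y ∈ L D 1) :
    X 0 * d 0 y + X 1 * d 1 y + X 2 * d 2 y ∈ L D 1 :=
  add_mem (add_mem (Lm (F.X0_L K) (Ld hy (by decide))) (Lm (F.X1_L K) (Ld1 hy (l := 2))))
    (Lm (F.X2_L K).2.2 (Ld hy (by decide)))

/-- The equations for `ξ^θ` and its conjugate differ in the sign of `w`. Their difference controls
`w`; their sum is one half of the conformal Killing equation on the sphere, `∂_θ X^θ = -X^r / r` at
leading order. -/
lemma w_H_L : T.w X ∈ L D 1 ∧ s D * X 1 + d 2 (X 2) ∈ L D 1 := by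
  have h0 : (0 : Fin 4) ≠ 1 := by decide
  have h2 : (2 : Fin 4) ≠ 1 := by decide
  have hs : s D * X 1 ∈ B D 0 := s_mul_mem K.X1_mem
  have hw := F.w_B K
  have hd := Bd (LB (F.X2_L K).2.2 (l := 0)) 2 (l := 0)
  have hC := BL (F.C_B 0) (l := 1)
  have hv : T.w X - s D * X 1 - d 2 (X 2) ∈ L D 1 := by
    refine F.cancel_unit K (F.x_mem 0) (sub_mem (sub_mem hw hs) hd) ?_
    have h := T.killing_xi0 K.killing
    rw [F.Dv_X K, F.d3_xi, F.Dm, F.Dm, K.d3_X, K.d3_X, F.xi0] at h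
    simp only [Derivation.leibniz, map_add, d_ca, d1_s, d_s h0, d_s h2, smul_eq_mul] at h
    have e : (ca D + x 0) * (T.w X - s D * X 1 - d 2 (X 2))
        = -(X 0 * d 0 (x 0) + X 1 * d 1 (x 0) + X 2 * d 2 (x 0))
          - r D * (T.ξ 0 * d 2 (X 0) * T.C 0) := by
      rw [F.xi0]
      linear_combination r D * h - ((ca D + x 0) * (T.w X - s D * X 1 - d 2 (X 2))
        + (X 0 * d 0 (x 0) + X 1 * d 1 (x 0) + X 2 * d 2 (x 0))) * rs
    rw [e]
    refine sub_mem (neg_mem (F.DX_L K _ (F.x_L 0))) (Lr (k := 2) ?_)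
    exact Lm (Lm (F.xi_L 0) (Ld (F.X0_L K) h2) (m := 1)) hC
  have hv' : -T.w X - s D * X 1 - d 2 (X 2) ∈ L D 1 := by
    refine F.cancel_unit K (B_cj (F.x_mem 0)) (sub_mem (sub_mem (neg_mem hw) hs) hd) ?_
    have h := T.killing_zeta0 K.killing
    rw [F.Dv_X K, F.d3_zeta, F.Dmb, F.Dmb, K.d3_X, K.d3_X, F.zeta0] at h
    simp only [Derivation.leibniz, map_add, d_ca, d1_s, d_s h0, d_s h2, smul_eq_mul] at h
    have e : (ca D + cj (x 0)) * (-T.w X - s D * X 1 - d 2 (X 2))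
        = -(X 0 * d 0 (cj (x 0)) + X 1 * d 1 (cj (x 0)) + X 2 * d 2 (cj (x 0)))
          - r D * (T.ζ 0 * d 2 (X 0) * T.C 0) := by
      rw [F.zeta0]
      linear_combination r D * h - ((ca D + cj (x 0)) * (-T.w X - s D * X 1 - d 2 (X 2))
        + (X 0 * d 0 (cj (x 0)) + X 1 * d 1 (cj (x 0)) + X 2 * d 2 (cj (x 0)))) * rs
    rw [e]
    refine sub_mem (neg_mem (F.DX_L K _ (L_cj (F.x_L 0)))) (Lr (k := 2) ?_)
    exact Lm (Lm (F.zeta_L 0) (Ld (F.X0_L K) h2) (m := 1)) hC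
  constructor <;> refine L_two ?_
  · have := sub_mem hv hv'
    convert this using 1; ring
  · have := neg_mem (add_mem hv hv')
    convert this using 1; ring

/-- The other half of the conformal Killing equation: differentiating the factor `1 / sin θ` in
`ξ^φ` along `X` produces `cot θ X^θ`. Subtracting the conjugate equation removes the leading
contribution of `∂_θ X^φ`. -/
lemma J_L : s D * X 1 + cs * csc * X 2 ∈ L D 1 := by
  have h0 : (0 : Fin 4) ≠ 1 := by decide
  have h2 : (2 : Fin 4) ≠ 1 := by decide
  have hC := BL (F.C_B 1) (l := 1)
  have e2 := F.d_csc 2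
  rw [F.d2_sn] at e2
  have e0 := F.d_csc 0
  rw [F.d0_sn, mul_zero, neg_zero] at e0
  have h := T.killing_xi1 K.killing
  rw [F.Dv_X K, F.d3_xi, F.Dm, F.Dm, K.d3_X, K.d3_X, F.xi1] at h
  simp only [Derivation.leibniz, map_add, map_neg, d_ca, d_cI, e0, e2, F.csc_pf.d1, d1_s, d_s h0,
    d_s h2, smul_eq_mul] at h
  have h' := T.killing_zeta1 K.killing
  rw [F.Dv_X K, F.d3_zeta, F.Dmb, F.Dmb, K.d3_X, K.d3_X, F.zeta1] at h'
  simp only [Derivation.leibniz, map_add, map_neg, d_ca, d_cI, e0, e2, F.csc_pf.d1, d1_s, d_s h0,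
    d_s h2, smul_eq_mul] at h'
  obtain ⟨E, hE⟩ : ∃ E, E = -(X 0 * d 0 (x 1) + X 1 * d 1 (x 1) + X 2 * d 2 (x 1))
      + (X 0 * d 0 (cj (x 1)) + X 1 * d 1 (cj (x 1)) + X 2 * d 2 (cj (x 1)))
      + s D * X 1 * (x 1 - cj (x 1)) + (x 0 - cj (x 0)) * d 2 (X 3) - T.w X * (x 1 + cj (x 1))
      - r D * (T.ξ 0 * d 2 (X 0) * T.C 1) + r D * (T.ζ 0 * d 2 (X 0) * T.C 1) := ⟨_, rfl⟩
  have e : 2 * (cI D * ca D * csc) * (s D * X 1 + cs * csc * X 2) = E := by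
    rw [hE]
    have h1 : s D * (2 * (cI D * ca D * csc) * (s D * X 1 + cs * csc * X 2))
        = s D * (-(X 0 * d 0 (x 1) + X 1 * d 1 (x 1) + X 2 * d 2 (x 1))
      + (X 0 * d 0 (cj (x 1)) + X 1 * d 1 (cj (x 1)) + X 2 * d 2 (cj (x 1)))
      + s D * X 1 * (x 1 - cj (x 1)) + (x 0 - cj (x 0)) * d 2 (X 3) - T.w X * (x 1 + cj (x 1)))
      - T.ξ 0 * d 2 (X 0) * T.C 1 + T.ζ 0 * d 2 (X 0) * T.C 1 := by
      rw [F.xi0] at h ⊢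
      rw [F.zeta0] at h' ⊢
      linear_combination h - h'
    linear_combination r D * h1 - (2 * (cI D * ca D * csc) * (s D * X 1 + cs * csc * X 2)
      + (X 0 * d 0 (x 1) + X 1 * d 1 (x 1) + X 2 * d 2 (x 1))
      - (X 0 * d 0 (cj (x 1)) + X 1 * d 1 (cj (x 1)) + X 2 * d 2 (cj (x 1)))
      - s D * X 1 * (x 1 - cj (x 1)) - (x 0 - cj (x 0)) * d 2 (X 3)
      + T.w X * (x 1 + cj (x 1))) * rs
  have hE1 : E ∈ L D 1 := by
    have hx := F.x_L
    have hxc := fun i => L_cj (F.x_L i)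
    have hf : ∀ {y : Fn D}, y ∈ L D 1 → r D * (y * d 2 (X 0) * T.C 1) ∈ L D 1 := fun hy =>
      Lr (k := 2) (Lm (Lm hy (Ld (F.X0_L K) h2) (m := 1)) hC)
    have hs : s D * X 1 ∈ L D 0 := Ls (F.X1_L K)
    have h4 : T.w X * (x 1 + cj (x 1)) ∈ L D 1 := BL (k := 2)
      (Bm (LB (F.w_H_L K).1 (l := 1)) (LB (add_mem (hx 1) (hxc 1)) (l := 1)))
    rw [hE]
    exact add_mem (sub_mem (sub_mem (add_mem (add_mem (add_mem (neg_mem (F.DX_L K _ (hx 1)))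
      (F.DX_L K _ (hxc 1))) (Lm hs (sub_mem (hx 1) (hxc 1))))
      (Lm (sub_mem (hx 0) (hxc 0)) (Ld (F.X3_L K) h2))) h4) (hf (F.xi_L 0))) (hf (F.zeta_L 0))
  have e3 : s D * X 1 + cs * csc * X 2 = -(cI D * ca D * sn) * E := by
    rw [← e]
    linear_combination (s D * X 1 + cs * csc * X 2) * (cI_sq
      + cI D ^ 2 * ca_sq + cI D ^ 2 * 2 * ca D ^ 2 * F.sn_csc)
  rw [e3]
  exact Lm (k := 0) (neg_mem (Lm (Lm cI_pf.mem_L ca_pf.mem_L rfl) F.sn_pf.mem_L)) hE1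

/-- In the Killing equation for `C^θ` every term other than `∂_u X^θ` decays at least like `r⁻¹`, up
to logarithms. -/
lemma d0_X2_B : d 0 (X 2) ∈ B D 1 := by
  have h := T.killing_C0 K.killing
  have e : d 0 (X 2) = G.Dv X (T.C 0) - (G.Dv T.n (X 2) - d 0 (X 2)) + G.Dv T.n (X 0) * T.C 0
      + (G.Dv T.mb (X 1) - G.Dv T.mb (X 0) * T.Q) * T.ξ 0
      + (G.Dv T.m (X 1) - G.Dv T.m (X 0) * T.Q) * T.ζ 0 := by linear_combination -h
  have hX0 := LB (F.X0_L K) (l := 0)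
  have hX2 := LB (F.X2_L K).2.2 (l := 0)
  have hX3 := LB (F.X3_L K) (l := 0)
  have hC := F.C_B 0
  have hQ := LB F.Q_L (l := 0)
  rw [e]
  refine add_mem (add_mem (add_mem (sub_mem ?_ (LB (F.Dn_L (F.X2_L K).2.2))) ?_) ?_) ?_
  · rw [F.Dv_X K]
    exact add_mem (add_mem (add_mem (Bm hX0 (B_d hC 0)) (Bm K.X1_mem (Bd1 hC (l := 3))))
      (Bm hX2 (B_d hC 2))) (Bm hX3 (B_d hC 3))
  · have : G.Dv T.n (X 0) ∈ B D 0 := by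
      have := add_mem (Bd hX0 0 (l := 0)) (LB (F.Dn_L (F.X0_L K)) (l := 0))
      rwa [add_sub_cancel] at this
    exact Bm this hC
  · exact Bm (k := 0) (sub_mem (F.Dmb_B K.X1_mem) (Bm (F.Dmb_B hX0 (l := 1)) hQ)) (F.xi_mem 0)
  · exact Bm (k := 0) (sub_mem (F.Dm_B K.X1_mem) (Bm (F.Dm_B hX0 (l := 1)) hQ)) (F.zeta_mem 0)

/-- The limit of `X^θ` is a multiple of `sin θ`. -/
lemma d_chi : d 0 χ = 0 ∧ d 3 χ = 0 ∧ d 2 χ = cs * csc * χ := by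
  have hc : IsPf (cs * csc) := F.cs_pf.mul F.csc_pf
  refine ⟨(K.chi_pf.d 0).eq_zero ?_, (K.chi_pf.d 3).eq_zero ?_, ?_⟩
  · have := sub_mem (F.d0_X2_B K) (B_d K.X2_mem 0)
    rwa [map_sub, sub_sub_cancel] at this
  · have := neg_mem (B_d K.X2_mem 3)
    rwa [map_sub, K.d3_X, zero_sub, neg_neg] at this
  · have h : IsPf (d 2 χ + (-1 : ℂ) • (cs * csc * χ)) :=
      (K.chi_pf.d 2).add ((hc.mul K.chi_pf).smul _)
    have h1 := h.eq_zero ?_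
    · rw [neg_one_smul] at h1
      linear_combination h1
    -- The difference of `w_H_L` and `J_L` eliminates `X^r`, and replacing `X^θ` by its limit costs
    -- only order `r⁻¹`.
    have h2 := sub_mem (sub_mem (LB (F.w_H_L K).2 (l := 1)) (LB (F.J_L K) (l := 1)))
      (sub_mem (B_d K.X2_mem 2) (Bm (m := 1) hc.mem K.X2_mem))
    rw [neg_one_smul]
    convert h2 using 1
    rw [map_sub]; ring

omit K in
-- In the Bianchi identity along `n` every term but `∂_u Ψ₀` carries an additional factor of order
-- `r⁻¹`.
lemma d0_Psi0_B : d 0 T.Ψ0 ∈ B D 5 := by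
  have h := T.bianchi_Psi0
  have e : d 0 T.Ψ0 = -(T.Q * d 1 T.Ψ0 + T.C 0 * d 2 T.Ψ0 + T.C 1 * d 3 T.Ψ0) + G.Dv T.m T.Ψ1
    + (2 * T.γ - 2 * T.c - T.μ) * T.Ψ0 + (T.b - 5 * T.τ) * T.Ψ1 - 3 * (T.σ * T.P2) := by
    rw [F.Dn] at h; linear_combination h
  have hP := F.Psi0_mem
  rw [e]
  refine sub_mem (add_mem (add_mem (add_mem (neg_mem (add_mem (add_mem ?_ ?_) ?_)) ?_) ?_) ?_) ?_
  · exact Bm (LB F.Q_L (l := 0)) (Bd1 hP (l := 5))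
  · exact Bm (F.C_B 0) (B_d hP 2)
  · exact Bm (F.C_B 1) (B_d hP 3)
  · exact F.Dm_B F.Psi1_B4
  · exact Bm (k := 1) (sub_mem (sub_mem (Bnat 2 (Bw F.gamma_B)) (Bnat 2 (LB F.mu_c_lam_L.2.1)))
      (LB F.mu_c_lam_L.1)) hP
  · exact Bm (k := 1) (sub_mem (LB F.bb_b_L.2) (Bnat 5 (Bw F.tau_B))) F.Psi1_B4
  · exact Bnat 3 (Bm F.rho_sigma_B.2 (LB F.P2_L (l := 3)))

omit K in
-- This tracks logarithms in the identity used for `d0_Psi0_B`. The input needed is that neither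
-- `Ψ₀` nor `Ψ₁` has a logarithm at order `r⁻⁴`.
lemma d0_Psi0_L (hP : T.Ψ0 ∈ L D 4) (h1 : T.Ψ1 ∈ L D 4) : d 0 T.Ψ0 ∈ L D 5 := by
  have h := T.bianchi_Psi0
  have e : d 0 T.Ψ0 = -(T.Q * d 1 T.Ψ0 + T.C 0 * d 2 T.Ψ0 + T.C 1 * d 3 T.Ψ0) + G.Dv T.m T.Ψ1
    + (2 * T.γ - 2 * T.c - T.μ) * T.Ψ0 + (T.b - 5 * T.τ) * T.Ψ1 - 3 * (T.σ * T.P2) := by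
    rw [F.Dn] at h; linear_combination h
  rw [e]
  refine sub_mem (add_mem (add_mem (add_mem (neg_mem (add_mem (add_mem ?_ ?_) ?_)) ?_) ?_) ?_) ?_
  · exact Lm F.Q_L (Ld1 hP (l := 5))
  · exact Lm (BL (F.C_B 0) (l := 1)) (Ld hP (by decide))
  · exact Lm (BL (F.C_B 1) (l := 1)) (Ld hP (by decide))
  · exact F.Dm_L h1
  · exact Lm (k := 1) (sub_mem (sub_mem (Ln 2 (BL F.gamma_B)) (Ln 2 F.mu_c_lam_L.2.1))
      F.mu_c_lam_L.1) hP
  · exact Lm (k := 1) (sub_mem F.bb_b_L.2 (Ln 5 (BL F.tau_B))) h1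
  · exact Ln 3 (Lm F.sigma_L F.P2_L)

/-- The Killing equation for `Ψ₀` at leading order. -/
lemma killing_Psi0_aux (hP : T.Ψ0 ∈ L D 4) :
    X 0 * d 0 T.Ψ0 + χ * (d 2 T.Ψ0 - cs * csc * (r D * d 1 T.Ψ0 + 2 * T.Ψ0))
      + 4 * (G.Dv T.m (X 0) * T.Ψ1) ∈ L D 5 := by
  have h := T.killing_Psi0 K.killing
  rw [F.Dv_X K, F.d3_Psi0, F.hd] at h
  have hc : cs * csc ∈ L D 0 := (F.cs_pf.mul F.csc_pf).mem_L
  have hP' : r D * d 1 T.Ψ0 + 2 * T.Ψ0 ∈ L D 4 := add_mem (Lr (Ld1 hP (l := 5))) (Ln 2 hP)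
  have e : X 0 * d 0 T.Ψ0 + χ * (d 2 T.Ψ0 - cs * csc * (r D * d 1 T.Ψ0 + 2 * T.Ψ0))
      + 4 * (G.Dv T.m (X 0) * T.Ψ1)
      = -(2 * ((d 1 (X 1) - s D * X 1 + T.w X) * T.Ψ0))
        - (s D * X 1 + cs * csc * X 2) * (r D * d 1 T.Ψ0 + 2 * T.Ψ0)
        - (X 2 - χ) * (d 2 T.Ψ0 - cs * csc * (r D * d 1 T.Ψ0 + 2 * T.Ψ0)) := by
    linear_combination h + X 1 * d 1 T.Ψ0 * rs
  rw [e]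
  refine sub_mem (sub_mem (neg_mem (Ln 2 ?_)) ?_) ?_
  · exact Lm (add_mem (F.d1_X1_sub K) (F.w_H_L K).1) hP
  · exact Lm (F.J_L K) hP'
  · exact Lm (F.X2_L K).2.1 (sub_mem (Ld hP (by decide)) (Lm (m := 4) hc hP'))

omit K in
-- The term `r⁻⁵ ln r` is negligible at this accuracy, so only the leading coefficient of `Ψ₀`
-- remains.
lemma Psi0_L {ψ4 ψ5 : Fn D} (M : T.Minimal ψ4 ψ5) : T.Ψ0 - s D ^ 4 * ψ4 ∈ B D 5 ∧ T.Ψ0 ∈ L D 4 := by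
  have h4 : s D ^ 4 ∈ L D 4 := by
    have : s D * (s D * (s D * s D)) ∈ L D 4 := Ls (k := 3) (Ls (k := 2) (Ls s_L))
    convert this using 1; ring
  have h5 : s D ^ 5 ∈ B D 5 := by
    have := LB (Ls h4 (l := 5)) (l := 5)
    convert this using 1; ring
  have h : T.Ψ0 - s D ^ 4 * ψ4 ∈ B D 5 := by
    have := add_mem (LB M.mem (l := 5)) (Bm (m := 5) h5 (Bm (m := 0) M.pf5.mem lnr_mem))
    rwa [sub_add_cancel] at this
  refine ⟨h, ?_⟩
  have := add_mem (BL h (l := 4)) (Lm h4 M.pf4.mem_L)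
  rwa [sub_add_cancel] at this

omit F K in
lemma eq_zero_of_s4 {f : Fn D} (hf : IsPf f) (h : s D ^ 4 * f ∈ B D 5) : f = 0 := by
  refine hf.eq_zero (mem_of_s (k := 2) (mem_of_s (k := 3) (mem_of_s (k := 4) (mem_of_s (k := 5) ?_))))
  convert h using 1; ring

omit F K in
lemma eq_zero_of_s5 {f : Fn D} (hf : IsPf f) (h : s D ^ 5 * (f * lnr D) ∈ L D 5) : f = 0 := by
  refine hf.eq_zero_of_log (L_of_s (k := 1) (L_of_s (k := 2) (L_of_s (k := 3) (L_of_s (k := 4)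
    (L_of_s (k := 5) ?_)))))
  convert h using 1; ring

omit F K in
lemma d_spow {c : Fin 4} (hc : c ≠ 1) (n : ℕ) : d c (s D ^ n) = 0 := by
  rw [Derivation.leibniz_pow, d_s hc]; simp

/-- The coefficients `Ψ₀^{4,0}` and `Ψ₀^{5,1}` are constant multiples of powers of `1 / sin θ`. -/
theorem coefficients {ψ4 ψ5 : Fn D} (M : T.Minimal ψ4 ψ5) {k : Fn D} (hk : χ * k = 1) :
    (d 0 ψ4 = 0 ∧ d 3 ψ4 = 0 ∧ d 2 ψ4 + 2 * (cs * csc * ψ4) = 0) ∧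
    (d 0 ψ5 = 0 ∧ d 3 ψ5 = 0 ∧ d 2 ψ5 + 3 * (cs * csc * ψ5) = 0) := by
  have h0 : (0 : Fin 4) ≠ 1 := by decide
  have h2 : (2 : Fin 4) ≠ 1 := by decide
  have h3 : (3 : Fin 4) ≠ 1 := by decide
  obtain ⟨hB, hP⟩ := F.Psi0_L M
  have hc : IsPf (cs * csc) := F.cs_pf.mul F.csc_pf
  have hn2 : ∀ {f : Fn D}, IsPf f → IsPf (2 * f) := fun {f} hf => by
    have : 2 * f = f + f := by ring
    rw [this]; exact hf.add hf
  have hn3 : ∀ {f : Fn D}, IsPf f → IsPf (3 * f) := fun {f} hf => by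
    have : 3 * f = 2 * f + f := by ring
    rw [this]; exact (hn2 hf).add hf
  have d4 : ∀ {c : Fin 4}, c ≠ 1 → d c (T.Ψ0 - s D ^ 4 * ψ4) = d c T.Ψ0 - s D ^ 4 * d c ψ4 := by
    intro c hc
    rw [map_sub, Derivation.leibniz, d_spow hc, smul_eq_mul, smul_zero, add_zero]
  have d5 : ∀ {c : Fin 4}, c ≠ 1 → d c (T.Ψ0 - s D ^ 4 * ψ4 - s D ^ 5 * (ψ5 * lnr D))
      = d c T.Ψ0 - s D ^ 4 * d c ψ4 - s D ^ 5 * (d c ψ5 * lnr D) := by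
    intro c hc
    rw [map_sub, d4 hc, Derivation.leibniz, Derivation.leibniz, d_spow hc, d_lnr' hc]
    simp only [smul_eq_mul, smul_zero, mul_zero, add_zero, zero_add]; ring
  -- The `u`-derivative of `Ψ₀` is of order `r⁻⁵`, so its leading coefficient vanishes.
  have a0 : d 0 ψ4 = 0 := eq_zero_of_s4 (M.pf4.d 0) <| by
    have := sub_mem F.d0_Psi0_B (B_d hB 0)
    rwa [d4 h0, sub_sub_cancel] at this
  have a3 : d 3 ψ4 = 0 := eq_zero_of_s4 (M.pf4.d 3) <| by
    have := neg_mem (B_d hB 3)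
    rwa [d4 h3, F.d3_Psi0, zero_sub, neg_neg] at this
  have hK := F.killing_Psi0_aux K hP
  -- On `r⁻⁴ ψ4` the operator `r ∂_r + 2` acts as `-2`, which produces the sign and the factor of
  -- the cotangent term. The terms with `∂_u Ψ₀` and `Ψ₁` are of order `r⁻⁵`.
  have a2 : d 2 ψ4 + 2 * (cs * csc * ψ4) = 0 := by
    have hf := (M.pf4.d 2).add (hn2 (hc.mul M.pf4))
    have h := eq_zero_of_s4 (K.chi_pf.mul hf) ?_
    · linear_combination k * h - (d 2 ψ4 + 2 * (cs * csc * ψ4)) * hk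
    have h5 : X 0 * d 0 T.Ψ0 + 4 * (G.Dv T.m (X 0) * T.Ψ1) ∈ B D 5 :=
      add_mem (Bm (LB (F.X0_L K) (l := 0)) F.d0_Psi0_B)
        (Bnat 4 (Bm (F.Dm_B (LB (F.X0_L K) (l := 0)) (l := 1)) F.Psi1_B4))
    have h6 : χ * (d 2 (T.Ψ0 - s D ^ 4 * ψ4) - cs * csc * (r D * d 1 (T.Ψ0 - s D ^ 4 * ψ4)
        + 2 * (T.Ψ0 - s D ^ 4 * ψ4))) ∈ B D 5 :=
      Bm K.chi_pf.mem (sub_mem (Bd hB 2 (l := 5)) (Bm hc.mem (add_mem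
        (r_mul_mem (Bd1 hB (l := 6)) (l := 5)) (Bnat 2 hB))))
    have h7 := sub_mem (sub_mem (LB hK (l := 5)) h5) h6
    convert h7 using 1
    have e1 : d 1 (s D ^ 4 * ψ4) = -4 * s D ^ 5 * ψ4 := by
      rw [Derivation.leibniz, M.pf4.d1, Derivation.leibniz_pow, d1_s]
      simp only [smul_eq_mul, nsmul_eq_mul, mul_zero, zero_add]; push_cast; ring
    rw [d4 h2, map_sub, e1]
    linear_combination χ * (cs * csc) * (-4) * s D ^ 4 * ψ4 * rs
  -- The source of a term `r⁻⁴ ln r` in `Ψ₁` is `∂_θ ψ4 + 2 cot θ ψ4`, which has just been shown to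
  -- vanish.
  have hmb : T.Ψ1 ∈ L D 4 := by
    have h := T.bianchi_Psi1
    rw [F.hd, F.Dmb, F.d3_Psi0, F.zeta0] at h
    have e : d 1 T.Ψ1 + ((4 : ℤ) : Fn D) * (s D * T.Ψ1)
        = s D * (ca D * (d 2 (T.Ψ0 - s D ^ 4 * ψ4) + 2 * (cs * csc * (T.Ψ0 - s D ^ 4 * ψ4))))
        + s D * (cj (x 0) * d 2 T.Ψ0) - T.τb * T.Ψ0
        - 2 * ((T.bb + s D * (ca D * (cs * csc))) * T.Ψ0) + 4 * ((T.ρ + s D) * T.Ψ1) := by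
      rw [h, d4 h2]; push_cast
      linear_combination s D ^ 5 * ca D * a2
    refine L_of_d1 ?_
    rw [e]
    refine add_mem (sub_mem (sub_mem (add_mem (s_mul_mem (k := 5) ?_) (s_mul_mem (k := 5) ?_)) ?_)
      (Bnat 2 ?_)) (Bnat 4 ?_)
    · exact Bm ca_mem (add_mem (Bd hB 2 (l := 5)) (Bnat 2 (Bm hc.mem hB)))
    · exact Bm (B_cj (F.x_mem 0)) (B_d F.Psi0_mem 2)
    · exact Bm F.taub_B F.Psi0_mem
    · exact Bm F.bb_B F.Psi0_mem
    · exact Bm F.rho_sigma_B.1 F.Psi1_B4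
  have hd0 := F.d0_Psi0_L hP hmb
  have b0 : d 0 ψ5 = 0 := eq_zero_of_s5 (M.pf5.d 0) <| by
    have := sub_mem hd0 (Ld M.mem h0)
    rw [d5 h0, a0] at this
    convert this using 1; ring
  have b3 : d 3 ψ5 = 0 := eq_zero_of_s5 (M.pf5.d 3) <| by
    have := neg_mem (Ld M.mem h3)
    rw [d5 h3, a3, F.d3_Psi0] at this
    convert this using 1; ring
  -- It remains to compare the coefficients of `r⁻⁵ ln r` in the Killing equation, where `r ∂_r + 2`
  -- acts as `-3`.
  refine ⟨⟨a0, a3, a2⟩, b0, b3, ?_⟩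
  have hf := (M.pf5.d 2).add (hn3 (hc.mul M.pf5))
  have h := eq_zero_of_s5 (K.chi_pf.mul hf) ?_
  · linear_combination k * h - (d 2 ψ5 + 3 * (cs * csc * ψ5)) * hk
  -- This logarithm-free term arises when `∂_r` falls on `ln r`. It does not affect the logarithmic
  -- coefficient.
  have hs5 : s D ^ 5 * (χ * (cs * csc) * ψ5) ∈ L D 5 := by
    have : s D * (s D * (s D * (s D * (s D * (χ * (cs * csc) * ψ5))))) ∈ L D 5 :=
      Ls (k := 4) (Ls (k := 3) (Ls (k := 2) (Ls (k := 1) (Ls (k := 0)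
        ((K.chi_pf.mul hc).mul M.pf5).mem_L))))
    convert this using 1; ring
  have h5 : X 0 * d 0 T.Ψ0 + 4 * (G.Dv T.m (X 0) * T.Ψ1) ∈ L D 5 :=
    add_mem (Lm (F.X0_L K) hd0) (Ln 4 (Lm (F.Dm_L (F.X0_L K) (l := 1)) hmb))
  obtain ⟨Z, hZ⟩ : ∃ Z, Z = T.Ψ0 - s D ^ 4 * ψ4 - s D ^ 5 * (ψ5 * lnr D) := ⟨_, rfl⟩
  have hZL : Z ∈ L D 5 := hZ ▸ M.mem
  have h6 : χ * (d 2 Z - cs * csc * (r D * d 1 Z + 2 * Z)) ∈ L D 5 :=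
    Lm K.chi_pf.mem_L (sub_mem (Ld hZL h2) (Lm (l := 5) hc.mem_L (add_mem
      (Lr (Ld1 hZL (l := 6))) (Ln 2 hZL))))
  have h7 := add_mem (sub_mem (sub_mem hK h5) h6) hs5
  convert h7 using 1
  have e1 : d 1 (s D ^ 4 * ψ4) = -4 * s D ^ 5 * ψ4 := by
    rw [Derivation.leibniz, M.pf4.d1, Derivation.leibniz_pow, d1_s]
    simp only [smul_eq_mul, nsmul_eq_mul, mul_zero, zero_add]; push_cast; ring
  have e2 : d 1 (s D ^ 5 * (ψ5 * lnr D)) = -5 * s D ^ 6 * (ψ5 * lnr D) + s D ^ 6 * ψ5 := by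
    rw [Derivation.leibniz, Derivation.leibniz, M.pf5.d1, Derivation.leibniz_pow, d1_s, d1_lnr]
    simp only [smul_eq_mul, nsmul_eq_mul, mul_zero, zero_add, add_zero]; push_cast; ring
  rw [hZ, d5 h2, map_sub, map_sub, e1, e2]
  linear_combination (-s D ^ 4 * χ) * a2 + (χ * (cs * csc) * (-4 * s D ^ 4 * ψ4
    - 5 * s D ^ 5 * (ψ5 * lnr D) + s D ^ 5 * ψ5)) * rs

end Tetrad.Flat
end BoostRot
end

noncomputable section

namespace BoostRot

/-! ### Null tetrads and the inverse metric -/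

/-- A null tetrad gives the inverse metric. -/
lemma tetrad_inverse {A : Type*} [CommRing A] (g : Fin 4 → Fin 4 → A) (l n m mb : Fin 4 → A)
    (hg : ∀ a b, g a b = g b a)
    {p : (Fin 4 → A) → (Fin 4 → A) → A} (hp : ∀ V W, p V W = ∑ a, ∑ b, g a b * V a * W b)
    (ll : p l l = 0) (ln : p l n = 1) (nn : p n n = 0) (lm : p l m = 0) (lmb : p l mb = 0)
    (nm : p n m = 0) (nmb : p n mb = 0) (mm : p m m = 0) (mbmb : p mb mb = 0) (mmb : p m mb = -1)
    (a c : Fin 4) :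
    ∑ b, (l a * n b + n a * l b - m a * mb b - mb a * m b) * g b c = if a = c then 1 else 0 := by
  have sw : ∀ V W, p V W = p W V := fun V W => by
    rw [hp, hp, Finset.sum_comm]
    exact Finset.sum_congr rfl fun a _ => Finset.sum_congr rfl fun b _ => by rw [hg]; ring
  let E : Matrix (Fin 4) (Fin 4) A := Matrix.of ![l, n, m, mb]
  let g' : Matrix (Fin 4) (Fin 4) A := Matrix.of g
  let η : Matrix (Fin 4) (Fin 4) A := !![0, 1, 0, 0; 1, 0, 0, 0; 0, 0, 0, -1; 0, 0, -1, 0]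
  have h1 : ∀ i j, (E * g' * E.transpose) i j = p (E i) (E j) := fun i j => by
    rw [hp, Matrix.mul_apply, Finset.sum_comm]
    refine Finset.sum_congr rfl fun b _ => ?_
    rw [Matrix.mul_apply, Finset.sum_mul]
    exact Finset.sum_congr rfl fun a _ => by
      simp only [Matrix.transpose_apply, g', Matrix.of_apply]; ring
  have h2 : E * g' * E.transpose = η := by
    ext i j
    rw [h1]
    have e0 : E 0 = l := rfl
    have e1 : E 1 = n := rfl
    have e2 : E 2 = m := rfl
    have e3 : E 3 = mb := rfl
    fin_cases i <;> fin_cases j <;> simp [e0, e1, e2, e3, η, ll, ln, nn, lm, lmb, nm, nmb, mm, mbmb,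
      mmb, sw n l, sw m l, sw mb l, sw m n, sw mb n, sw mb m]
  have h3 : η * η = 1 := by
    ext i j
    fin_cases i <;> fin_cases j <;> simp [η, Matrix.mul_apply, Fin.sum_univ_four]
  have h4 : (η * E * g') * E.transpose = 1 := by
    rw [Matrix.mul_assoc, Matrix.mul_assoc, ← Matrix.mul_assoc E, h2, h3]
  -- For square matrices a left inverse is a right inverse: `η E g` inverts the transpose of `E`, so
  -- the transpose of `E` times `η E` inverts `g`.
  rw [mul_eq_one_comm] at h4
  have h5 := congrFun (congrFun h4 a) c
  rw [Matrix.one_apply] at h5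
  rw [← h5, ← Matrix.mul_assoc, ← Matrix.mul_assoc, Matrix.mul_apply]
  refine Finset.sum_congr rfl fun b _ => ?_
  congr 1
  simp [Matrix.mul_apply, Fin.sum_univ_four, η, E]
  ring

namespace Fn

variable {D : Nbhd}

def ofR (f : Pt → ℝ) (h : ContDiffOn ℝ ∞ f D.dom) : Fn D :=
  mk (fun x => (f x : ℂ)) (Complex.ofRealCLM.contDiff.comp_contDiffOn h)

lemma ev_ofR {f : Pt → ℝ} (h : ContDiffOn ℝ ∞ f D.dom) {x : Pt} (hx : x ∈ D.dom) :
    (ofR f h).ev x = f x := ev_mk _ hx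

lemma ev_d_ofR {f : Pt → ℝ} (h : ContDiffOn ℝ ∞ f D.dom) (a : Fin 4) {x : Pt} (hx : x ∈ D.dom) :
    (d a (ofR f h)).ev x = (pd a f x : ℝ) := by
  rw [ev_d_of_eq a _ (fun y hy => ev_ofR h hy) hx, pd, pd]
  have h1 : DifferentiableAt ℝ f x :=
    ((h x hx).contDiffAt (D.dom_open.mem_nhds hx)).differentiableAt (by simp)
  have := (Complex.ofRealCLM.hasFDerivAt.comp x h1.hasFDerivAt).fderiv
  have e : (fun x => (f x : ℂ)) = ⇑Complex.ofRealCLM ∘ f := rfl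
  rw [e, this]; rfl

lemma cj_ofR {f : Pt → ℝ} (h : ContDiffOn ℝ ∞ f D.dom) : cj (ofR f h) = ofR f h :=
  ext_ev fun x hx => by rw [ev_cj _ hx, ev_ofR _ hx, Complex.conj_ofReal]

end Fn

open Fn

/-! ### Null charts as tetrads over the ring of smooth functions -/

namespace NullChart

/-- The part of the chart above `scri` with `r > 1`. -/
def nbhd (M : NullChart) (hM : M.IsNullChart) : Nbhd where
  scri := M.scri
  dom := {x | x ∈ M.region ∧ 1 < x 1 ∧ base x ∈ M.scri}
  scri_open := hM.scri_open
  dom_open := hM.region_open.inter (((isOpen_lt continuous_const (continuous_apply 1))).inter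
    (hM.scri_open.preimage contDiff_base.continuous))
  r_gt x hx := hx.2.1
  base_mem x hx := hx.2.2
  rays K hK hc := by
    obtain ⟨R, hR⟩ := hM.rays K hK hc
    refine ⟨max R 1, fun p hp r hr => ⟨hR p hp r ((le_max_left _ _).trans_lt hr), ?_, ?_⟩⟩
    · exact (le_max_right _ _).trans_lt hr
    · rw [base_pt]; exact hK hp

variable (M : NullChart) (hM : M.IsNullChart)

lemma nbhd_sub : (M.nbhd hM).dom ⊆ M.region := fun _ hx => hx.1

def gF (a b : Fin 4) : Fn (M.nbhd hM) := ofR (fun x => M.g x a b) ((hM.smooth_g a b).mono (M.nbhd_sub hM))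
def QF : Fn (M.nbhd hM) := ofR M.Q (hM.smooth_Q.mono (M.nbhd_sub hM))
def CF (i : Fin 2) : Fn (M.nbhd hM) := ofR (M.C i) ((hM.smooth_C i).mono (M.nbhd_sub hM))
def xiF (i : Fin 2) : Fn (M.nbhd hM) := Fn.mk (M.ξ i) ((hM.smooth_ξ i).mono (M.nbhd_sub hM))
def zetaF (i : Fin 2) : Fn (M.nbhd hM) := cj (M.xiF hM i)
def lF : Fin 4 → Fn (M.nbhd hM) := ![0, 1, 0, 0]
def nF : Fin 4 → Fn (M.nbhd hM) := ![1, M.QF hM, M.CF hM 0, M.CF hM 1]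
def mF : Fin 4 → Fn (M.nbhd hM) := ![0, 0, M.xiF hM 0, M.xiF hM 1]
def mbF : Fin 4 → Fn (M.nbhd hM) := ![0, 0, M.zetaF hM 0, M.zetaF hM 1]
def prodF (V W : Fin 4 → Fn (M.nbhd hM)) : Fn (M.nbhd hM) :=
  ∑ a, ∑ b, M.gF hM a b * V a * W b
/-- The inverse metric. -/
def hF (a b : Fin 4) : Fn (M.nbhd hM) :=
  M.lF hM a * M.nF hM b + M.nF hM a * M.lF hM b - M.mF hM a * M.mbF hM b - M.mbF hM a * M.mF hM b

section ev
variable {x : Pt} (hx : x ∈ (M.nbhd hM).dom)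
include hx

lemma ev_lF (a : Fin 4) : (M.lF hM a).ev x = lVec a := by
  fin_cases a <;> simp [lF, lVec, ev_zero, ev_one hx]
lemma ev_nF (a : Fin 4) : (M.nF hM a).ev x = M.nVec x a := by
  fin_cases a <;> simp [nF, nVec, ev_one hx, QF, CF, ev_ofR _ hx]
lemma ev_mF (a : Fin 4) : (M.mF hM a).ev x = M.mVec x a := by
  fin_cases a <;> simp [mF, mVec, ev_zero, xiF, ev_mk _ hx]
lemma ev_mbF (a : Fin 4) : (M.mbF hM a).ev x = M.mbarVec x a := by
  fin_cases a <;> simp [mbF, mVec, mbarVec, ev_zero, zetaF, xiF, ev_mk _ hx, ev_cj _ hx]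
lemma ev_gF (a b : Fin 4) : (M.gF hM a b).ev x = M.g x a b := ev_ofR _ hx
lemma ev_prodF (V W : Fin 4 → Fn (M.nbhd hM)) :
    (M.prodF hM V W).ev x = metricC M.g x (fun a => (V a).ev x) (fun a => (W a).ev x) := by
  simp only [prodF, metricC, ev_sum _ _ hx, ev_mul _ _ hx, M.ev_gF hM hx]

lemma ev_lF' : (fun a => (M.lF hM a).ev x) = lVec := funext (M.ev_lF hM hx)
lemma ev_nF' : (fun a => (M.nF hM a).ev x) = M.nVec x := funext (M.ev_nF hM hx)
lemma ev_mF' : (fun a => (M.mF hM a).ev x) = M.mVec x := funext (M.ev_mF hM hx)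
lemma ev_mbF' : (fun a => (M.mbF hM a).ev x) = M.mbarVec x := funext (M.ev_mbF hM hx)
end ev

lemma metricC_conj (x : Pt) (v w : Fin 4 → ℂ) :
    metricC M.g x (fun a => starRingEnd ℂ (v a)) (fun a => starRingEnd ℂ (w a))
      = starRingEnd ℂ (metricC M.g x v w) := by
  simp [metricC]
lemma lVec_real : (fun a => starRingEnd ℂ (lVec a)) = lVec := by
  ext a; fin_cases a <;> simp [lVec]
lemma nVec_real (x : Pt) : (fun a => starRingEnd ℂ (M.nVec x a)) = M.nVec x := by
  ext a; fin_cases a <;> simp [nVec]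

lemma ll : M.prodF hM (M.lF hM) (M.lF hM) = 0 := ext_ev fun x hx => by
  rw [M.ev_prodF hM hx, M.ev_lF' hM hx, ev_zero, hM.ll x hx.1]
lemma ln : M.prodF hM (M.lF hM) (M.nF hM) = 1 := ext_ev fun x hx => by
  rw [M.ev_prodF hM hx, M.ev_lF' hM hx, M.ev_nF' hM hx, ev_one hx, hM.ln x hx.1]
lemma nn : M.prodF hM (M.nF hM) (M.nF hM) = 0 := ext_ev fun x hx => by
  rw [M.ev_prodF hM hx, M.ev_nF' hM hx, ev_zero, hM.nn x hx.1]
lemma lm : M.prodF hM (M.lF hM) (M.mF hM) = 0 := ext_ev fun x hx => by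
  rw [M.ev_prodF hM hx, M.ev_lF' hM hx, M.ev_mF' hM hx, ev_zero, hM.lm x hx.1]
lemma lmb : M.prodF hM (M.lF hM) (M.mbF hM) = 0 := ext_ev fun x hx => by
  have := M.metricC_conj x lVec (M.mVec x)
  rw [lVec_real, hM.lm x hx.1, map_zero] at this
  rw [M.ev_prodF hM hx, M.ev_lF' hM hx, M.ev_mbF' hM hx, ev_zero]; exact this
lemma nm : M.prodF hM (M.nF hM) (M.mF hM) = 0 := ext_ev fun x hx => by
  rw [M.ev_prodF hM hx, M.ev_nF' hM hx, M.ev_mF' hM hx, ev_zero, hM.nm x hx.1]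
lemma nmb : M.prodF hM (M.nF hM) (M.mbF hM) = 0 := ext_ev fun x hx => by
  have := M.metricC_conj x (M.nVec x) (M.mVec x)
  rw [nVec_real, hM.nm x hx.1, map_zero] at this
  rw [M.ev_prodF hM hx, M.ev_nF' hM hx, M.ev_mbF' hM hx, ev_zero]; exact this
lemma mm : M.prodF hM (M.mF hM) (M.mF hM) = 0 := ext_ev fun x hx => by
  rw [M.ev_prodF hM hx, M.ev_mF' hM hx, ev_zero, hM.mm x hx.1]
lemma mbmb : M.prodF hM (M.mbF hM) (M.mbF hM) = 0 := ext_ev fun x hx => by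
  have := M.metricC_conj x (M.mVec x) (M.mVec x)
  rw [hM.mm x hx.1, map_zero] at this
  rw [M.ev_prodF hM hx, M.ev_mbF' hM hx, ev_zero]; exact this
lemma mmb : M.prodF hM (M.mF hM) (M.mbF hM) = -1 := ext_ev fun x hx => by
  rw [M.ev_prodF hM hx, M.ev_mF' hM hx, M.ev_mbF' hM hx, hM.mmbar x hx.1, ev_neg _ hx, ev_one hx]

lemma gF_symm (a b : Fin 4) : M.gF hM a b = M.gF hM b a := ext_ev fun x hx => by
  rw [M.ev_gF hM hx, M.ev_gF hM hx, (hM.symm x hx.1).apply]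

lemma hF_gF (a c : Fin 4) : ∑ b, M.hF hM a b * M.gF hM b c = if a = c then 1 else 0 :=
  tetrad_inverse (M.gF hM) (M.lF hM) (M.nF hM) (M.mF hM) (M.mbF hM) (M.gF_symm hM)
    (p := M.prodF hM) (fun _ _ => rfl) (M.ll hM) (M.ln hM) (M.nn hM) (M.lm hM) (M.lmb hM)
    (M.nm hM) (M.nmb hM) (M.mm hM) (M.mbmb hM) (M.mmb hM) a c

lemma inv_eq {x : Pt} (hx : x ∈ (M.nbhd hM).dom) :
    Matrix.of (fun a b => ((M.hF hM a b).ev x).re) * M.g x = 1 := by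
  ext a c
  have h := congrArg (fun f => (f.ev x).re) (M.hF_gF hM a c)
  simp only [ev_sum _ _ hx, ev_mul _ _ hx, M.ev_gF hM hx, Complex.re_sum, Complex.re_mul_ofReal] at h
  rw [Matrix.mul_apply, Matrix.one_apply]
  simp only [Matrix.of_apply]
  rw [h]
  split_ifs
  · rw [ev_one hx]; rfl
  · rw [ev_zero]; rfl

lemma g_inv {x : Pt} (hx : x ∈ (M.nbhd hM).dom) (a b : Fin 4) :
    (M.g x)⁻¹ a b = ((M.hF hM a b).ev x).re := by
  rw [Matrix.inv_eq_left_inv (M.inv_eq hM hx)]; rfl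

lemma g_mul_inv {x : Pt} (hx : x ∈ (M.nbhd hM).dom) : M.g x * (M.g x)⁻¹ = 1 := by
  rw [Matrix.inv_eq_left_inv (M.inv_eq hM hx), mul_eq_one_comm, M.inv_eq hM hx]

lemma smooth_inv (a b : Fin 4) : ContDiffOn ℝ ∞ (fun x => (M.g x)⁻¹ a b) (M.nbhd hM).dom := by
  refine ContDiffOn.congr ?_ (fun x hx => M.g_inv hM hx a b)
  exact Complex.reCLM.contDiff.comp_contDiffOn (M.hF hM a b).smooth

lemma smooth_christoffel (a b c : Fin 4) :
    ContDiffOn ℝ ∞ (christoffel M.g a b c) (M.nbhd hM).dom := by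
  have h : ∀ e i j, ContDiffOn ℝ ∞ (pd e (fun y => M.g y i j)) (M.nbhd hM).dom := fun e i j =>
    pd_contDiffOn (M.nbhd hM).dom_open ((hM.smooth_g i j).mono (M.nbhd_sub hM)) e
  exact contDiffOn_const.mul (ContDiffOn.sum fun e _ =>
    (M.smooth_inv hM a e).mul (((h _ _ _).add (h _ _ _)).sub (h _ _ _)))

def GamF (a b c : Fin 4) : Fn (M.nbhd hM) := ofR (christoffel M.g a b c) (M.smooth_christoffel hM a b c)

lemma pd_g_symm {x : Pt} (hx : x ∈ (M.nbhd hM).dom) (e a b : Fin 4) :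
    pd e (fun y => M.g y a b) x = pd e (fun y => M.g y b a) x :=
  pd_congr (M.nbhd hM).dom_open (fun y hy => (hM.symm y hy.1).apply b a) e hx

lemma christoffel_symm {x : Pt} (hx : x ∈ (M.nbhd hM).dom) (a b c : Fin 4) :
    christoffel M.g a b c x = christoffel M.g a c b x := by
  simp only [christoffel]
  congr 1
  refine Finset.sum_congr rfl fun e _ => ?_
  rw [M.pd_g_symm hM hx e b c]; ring

lemma christoffel_lower {x : Pt} (hx : x ∈ (M.nbhd hM).dom) (b c e : Fin 4) :
    ∑ a, M.g x b a * christoffel M.g a c e x = (1 / 2) * (pd c (fun y => M.g y b e) x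
      + pd e (fun y => M.g y b c) x - pd b (fun y => M.g y c e) x) := by
  have h := fun k => congrFun (congrFun (M.g_mul_inv hM hx) b) k
  simp only [Matrix.mul_apply, Matrix.one_apply] at h
  simp only [christoffel, Finset.mul_sum]
  rw [Finset.sum_comm]
  have : ∀ k ∈ Finset.univ, ∑ a, M.g x b a * (1 / 2 * ((M.g x)⁻¹ a k *
      (pd c (fun y => M.g y k e) x + pd e (fun y => M.g y k c) x - pd k (fun y => M.g y c e) x)))
      = (if b = k then 1 else 0) * (1 / 2 * (pd c (fun y => M.g y k e) x
        + pd e (fun y => M.g y k c) x - pd k (fun y => M.g y c e) x)) := fun k _ => by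
    rw [← h k, Finset.sum_mul]
    exact Finset.sum_congr rfl fun a _ => by ring
  rw [Finset.sum_congr rfl this]
  simp

/-- The geometry of a null chart. -/
def geo : Geo (Fn (M.nbhd hM)) where
  d := Fn.d
  d_comm := d_comm
  g := M.gF hM
  g_symm := M.gF_symm hM
  Γ := M.GamF hM
  Γ_symm a b c := ext_ev fun x hx => by
    rw [GamF, GamF, ev_ofR _ hx, ev_ofR _ hx, M.christoffel_symm hM hx]
  compat a b c := ext_ev fun x hx => by
    have h1 := M.christoffel_lower hM hx b c a
    have h2 := M.christoffel_lower hM hx a c b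
    rw [gF, ev_d_ofR _ _ hx]
    simp only [ev_sum _ _ hx, ev_mul _ _ hx, ev_add _ _ hx, M.ev_gF hM hx, GamF, ev_ofR _ hx]
    norm_cast
    rw [Finset.sum_add_distrib]
    have e1 : ∑ e, christoffel M.g e c a x * M.g x e b = ∑ e, M.g x b e * christoffel M.g e c a x :=
      Finset.sum_congr rfl fun e _ => by rw [(hM.symm x hx.1).apply, mul_comm]
    have e2 : ∑ e, christoffel M.g e c b x * M.g x a e = ∑ e, M.g x a e * christoffel M.g e c b x :=
      Finset.sum_congr rfl fun e _ => by rw [mul_comm]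
    rw [e1, e2, h1, h2, M.pd_g_symm hM hx c b a, M.pd_g_symm hM hx a b c, M.pd_g_symm hM hx b c a]
    ring

lemma ev_curv {x : Pt} (hx : x ∈ (M.nbhd hM).dom) (a b c e : Fin 4) :
    ((M.geo hM).curv a b c e).ev x = (riemannUp M.g a b c e x : ℝ) := by
  have h1 : ∀ i j k l, ((M.geo hM).d l ((M.geo hM).Γ i j k)).ev x
      = (pd l (christoffel M.g i j k) x : ℝ) := fun i j k l =>
    ev_d_ofR (M.smooth_christoffel hM i j k) l hx
  have h2 : ∀ i j k, ((M.geo hM).Γ i j k).ev x = (christoffel M.g i j k x : ℝ) :=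
    fun i j k => ev_ofR (M.smooth_christoffel hM i j k) hx
  simp only [Geo.curv, ev_add _ _ hx, ev_sub _ _ hx, ev_sum _ _ hx, ev_mul _ _ hx, h1, h2,
    riemannUp]
  push_cast
  rfl

lemma ricci_zero (hvac : M.IsVacuum) (b e : Fin 4) : ∑ a, (M.geo hM).curv a b a e = 0 :=
  ext_ev fun x hx => by
    simp only [ev_sum _ _ hx, M.ev_curv hM hx, ev_zero]
    have := hvac x hx.1 b e
    rw [ricci] at this
    exact_mod_cast this

/-- Contracting `V` with the metric and with its inverse in tetrad form returns `V`. -/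
lemma complete (V : Fin 4 → Fn (M.nbhd hM)) : V = (M.geo hM).gm V (M.nF hM) • M.lF hM
    + (M.geo hM).gm V (M.lF hM) • M.nF hM - (M.geo hM).gm V (M.mbF hM) • M.mF hM
    - (M.geo hM).gm V (M.mF hM) • M.mbF hM := by
  ext a
  have h : V a = ∑ c, (if a = c then 1 else 0) * V c := by simp
  rw [h]
  simp only [← M.hF_gF hM, Pi.add_apply, Pi.sub_apply, Pi.smul_apply, smul_eq_mul, Geo.gm, hF]
  change _ = (∑ c, ∑ b, M.gF hM c b * V c * M.nF hM b) * _ +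
    (∑ c, ∑ b, M.gF hM c b * V c * M.lF hM b) * _ - (∑ c, ∑ b, M.gF hM c b * V c * M.mbF hM b) * _
    - (∑ c, ∑ b, M.gF hM c b * V c * M.mF hM b) * _
  simp only [Finset.sum_mul, ← Finset.sum_add_distrib, ← Finset.sum_sub_distrib]
  refine Finset.sum_congr rfl fun c _ => Finset.sum_congr rfl fun b _ => ?_
  rw [M.gF_symm hM b c]; ring

/-- The combination of products of legs is the inverse metric (`key`), so the sum collapses to the
Ricci contraction of the curvature components. -/
lemma vac_contract (hvac : M.IsVacuum) (V W : Fin 4 → Fn (M.nbhd hM)) :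
    (M.geo hM).Rm (M.lF hM) W V (M.nF hM) + (M.geo hM).Rm (M.nF hM) W V (M.lF hM)
      - (M.geo hM).Rm (M.mF hM) W V (M.mbF hM) - (M.geo hM).Rm (M.mbF hM) W V (M.mF hM) = 0 := by
  have h : ∀ U Z : Fin 4 → Fn (M.nbhd hM), (M.geo hM).Rm U W V Z =
      ∑ b, ∑ e, ∑ a, ∑ c, (M.geo hM).curv a b c e * (V b * W e * (U c * ∑ z, M.gF hM a z * Z z)) := by
    intro U Z
    simp only [Geo.Rm, Geo.gm, Geo.Riem_apply]
    change ∑ a, ∑ z, M.gF hM a z * _ * Z z = _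
    have : ∀ a, ∑ z, M.gF hM a z * (∑ b, ∑ c, ∑ e, (M.geo hM).curv a b c e * V b * U c * W e) * Z z
        = ∑ b, ∑ e, ∑ c, (M.geo hM).curv a b c e * (V b * W e * (U c * ∑ z, M.gF hM a z * Z z)) := by
      intro a
      have h1 : ∑ z, M.gF hM a z * (∑ b, ∑ c, ∑ e, (M.geo hM).curv a b c e * V b * U c * W e) * Z z
          = (∑ b, ∑ c, ∑ e, (M.geo hM).curv a b c e * V b * U c * W e) * ∑ z, M.gF hM a z * Z z := by
        rw [Finset.mul_sum]
        exact Finset.sum_congr rfl fun z _ => by ring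
      rw [h1, Finset.sum_mul]
      refine Finset.sum_congr rfl fun b _ => ?_
      rw [Finset.sum_comm, Finset.sum_mul]
      refine Finset.sum_congr rfl fun e _ => ?_
      rw [Finset.sum_mul]
      exact Finset.sum_congr rfl fun c _ => by ring
    rw [Finset.sum_congr rfl fun a _ => this a, Finset.sum_comm]
    exact Finset.sum_congr rfl fun b _ => Finset.sum_comm
  have key : ∀ a c, M.lF hM c * (∑ z, M.gF hM a z * M.nF hM z)
      + M.nF hM c * (∑ z, M.gF hM a z * M.lF hM z) - M.mF hM c * (∑ z, M.gF hM a z * M.mbF hM z)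
      - M.mbF hM c * (∑ z, M.gF hM a z * M.mF hM z) = if c = a then 1 else 0 := by
    intro a c
    rw [← M.hF_gF hM]
    simp only [Finset.mul_sum, ← Finset.sum_add_distrib, ← Finset.sum_sub_distrib, hF]
    exact Finset.sum_congr rfl fun z _ => by rw [M.gF_symm hM z a]; ring
  rw [h, h, h, h]
  simp only [← Finset.sum_add_distrib, ← Finset.sum_sub_distrib]
  refine Finset.sum_eq_zero fun b _ => Finset.sum_eq_zero fun e _ => ?_
  have h2 : ∑ a, ∑ c, (M.geo hM).curv a b c e * (V b * W e * (if c = a then 1 else 0)) = 0 := by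
    have := M.ricci_zero hM hvac b e
    simp only [mul_ite, mul_one, mul_zero, Finset.sum_ite_eq', Finset.mem_univ, if_true]
    rw [← Finset.sum_mul, this, zero_mul]
  rw [← h2]
  refine Finset.sum_congr rfl fun a _ => Finset.sum_congr rfl fun c _ => ?_
  rw [← key]; ring

lemma eps : (M.geo hM).gm ((M.geo hM).nab (M.lF hM) (M.mF hM)) (M.mbF hM) = 0 := by
  have h : ∀ x (hx : x ∈ (M.nbhd hM).dom) a,
      ((M.geo hM).nab (M.lF hM) (M.mF hM) a).ev x = M.nablaLM x a := by
    intro x hx a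
    have e1 : (M.geo hM).nab (M.lF hM) (M.mF hM) a
        = d 1 (M.mF hM a) + ∑ b, M.GamF hM a 1 b * M.mF hM b := by
      simp only [Geo.nab, Fin.sum_univ_four, lF]
      simp [Geo.nabc, Fin.sum_univ_four]
      rfl
    rw [e1, ev_add _ _ hx, ev_d_of_eq 1 _ (fun y hy => M.ev_mF hM hy a) hx, nablaLM]
    simp only [ev_sum _ _ hx, ev_mul _ _ hx, GamF, ev_ofR _ hx, M.ev_mF hM hx]
  refine ext_ev fun x hx => ?_
  change (M.prodF hM _ _).ev x = _
  rw [M.ev_prodF hM hx, ev_zero, M.ev_mbF' hM hx, funext (h x hx), hM.epsilon x hx.1]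

/-- The null tetrad of a null chart. -/
def tetrad (hvac : M.IsVacuum) : Tetrad (M.geo hM) where
  Q := M.QF hM
  C := M.CF hM
  ξ := M.xiF hM
  ζ := M.zetaF hM
  l := M.lF hM
  n := M.nF hM
  m := M.mF hM
  mb := M.mbF hM
  l_eq := rfl
  n_eq := rfl
  m_eq := rfl
  mb_eq := rfl
  ll := M.ll hM
  ln := M.ln hM
  nn := M.nn hM
  lm := M.lm hM
  lmb := M.lmb hM
  nm := M.nm hM
  nmb := M.nmb hM
  mm := M.mm hM
  mbmb := M.mbmb hM
  mmb := M.mmb hM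
  eps := M.eps hM
  complete := M.complete hM
  vac := M.vac_contract hM hvac

lemma ev_Psi0 (hvac : M.IsVacuum) {x : Pt} (hx : x ∈ (M.nbhd hM).dom) :
    (M.tetrad hM hvac).Ψ0.ev x = M.Psi0 x := by
  have h1 : ∀ a b c e, weyl M.g a b c e x = riemann M.g a b c e x := fun a b c e => by
    have hr := hvac x hx.1
    simp [weyl, hr, scalarCurv]
  -- The operator form `Rm U V W Z` puts the last argument into the first index of `R_{abcd}`.
  -- Exchanging the last two arguments accounts for the minus sign in `Psi0`.
  have h2 : (M.tetrad hM hvac).Ψ0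
      = -(M.geo hM).Rm (M.lF hM) (M.mF hM) (M.mF hM) (M.lF hM) := Geo.Rm_anti₃₄ _ _ _ _ _
  have h3 : ((M.geo hM).Rm (M.lF hM) (M.mF hM) (M.mF hM) (M.lF hM)).ev x
      = ∑ z, ∑ b, ∑ c, ∑ e, (riemann M.g z b c e x : ℂ) * lVec z * M.mVec x b * lVec c * M.mVec x e := by
    simp only [Geo.Rm, Geo.gm, Geo.Riem_apply, ev_sum _ _ hx, ev_mul _ _ hx, M.ev_curv hM hx,
      M.ev_lF hM hx, M.ev_mF hM hx, riemann]
    rw [Finset.sum_comm]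
    refine Finset.sum_congr rfl fun z _ => ?_
    simp only [Finset.mul_sum, Finset.sum_mul]
    rw [Finset.sum_comm]
    refine Finset.sum_congr rfl fun b _ => ?_
    rw [Finset.sum_comm]
    refine Finset.sum_congr rfl fun c _ => ?_
    rw [Finset.sum_comm]
    refine Finset.sum_congr rfl fun e _ => ?_
    push_cast
    simp only [Finset.sum_mul]
    refine Finset.sum_congr rfl fun a _ => ?_
    have : ((M.geo hM).g a z).ev x = M.g x z a := by
      rw [(hM.symm x hx.1).apply]; exact M.ev_gF hM hx a z
    rw [this]; ring
  rw [h2, ev_neg _ hx, h3, Psi0]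
  simp only [h1]

end NullChart
end BoostRot
end

noncomputable section

namespace BoostRot

open Filter Asymptotics

/-! ### Polyhomogeneous expansions and the filtration -/

namespace Fn

variable {D : Nbhd}

lemma contDiffAt_slice (H : Fn D) {p : Scri} {r : ℝ} (h : pt p r ∈ D.dom) :
    ContDiffAt ℝ ∞ (fun q => H.ev (pt q r)) p := by
  have : ContDiff ℝ ∞ fun q : Scri => pt q r := by
    rw [contDiff_pi]
    intro i
    fin_cases i <;> simp [pt] <;> first | exact contDiff_apply ℝ ℝ _ | exact contDiff_const
  exact (H.contDiffAt h).comp p this.contDiffAt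

lemma eventually_slice {p : Scri} {r : ℝ} (h : pt p r ∈ D.dom) : ∀ᶠ q in 𝓝 p, pt q r ∈ D.dom :=
  (continuous_pt r).continuousAt.eventually (D.dom_open.mem_nhds h)

lemma fderiv_slice (H : Fn D) {p : Scri} {r : ℝ} (h : pt p r ∈ D.dom) {c : Fin 4} (hc : c ≠ 1) :
    fderiv ℝ (fun q => H.ev (pt q r)) p (baseDir c) = (d c H).ev (pt p r) := by
  rw [ev_d c H h, pd]
  let A : Scri →L[ℝ] Pt := LinearMap.toContinuousLinearMap
    { toFun := fun q => ![q 0, 0, q 1, q 2]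
      map_add' := fun x y => by ext i; fin_cases i <;> simp
      map_smul' := fun t x => by ext i; fin_cases i <;> simp }
  have e : (fun q => pt q r) = fun q => A q + Pi.single 1 r := by
    ext q i; fin_cases i <;> simp [pt, A]
  have h1 : HasFDerivAt (fun q => pt q r) A p := by
    rw [e]; exact A.hasFDerivAt.add_const _
  have h2 := ((H.diffAt h).hasFDerivAt.comp p h1).fderiv
  have e2 : (fun q => H.ev (pt q r)) = H.ev ∘ fun q => pt q r := rfl
  rw [e2, h2]
  change fderiv ℝ H.ev (pt p r) (A (baseDir c)) = _
  congr 1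
  ext i
  fin_cases c <;> fin_cases i <;> simp [A, baseDir, base] at hc ⊢

/-- Uniform bounds for all derivatives of a function of `(p, r)`. -/
def UBnd (n : ℤ) (E : Fn D) : Prop := ∀ K : Set Scri, K ⊆ D.scri → IsCompact K → ∀ i m : ℕ,
  ∃ C R : ℝ, ∀ p ∈ K, ∀ r, R < r →
    ‖iteratedFDeriv ℝ m (fun q => (((d 1)^[i]) E).ev (pt q r)) p‖ ≤ C * r ^ (-n - (i : ℤ))

lemma UBnd.d1 {n : ℤ} {E : Fn D} (h : UBnd n E) : UBnd (n + 1) (d 1 E) := by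
  intro K hK hc i m
  obtain ⟨C, R, hR⟩ := h K hK hc (i + 1) m
  refine ⟨C, R, fun p hp r hr => ?_⟩
  have := hR p hp r hr
  rw [Function.iterate_succ_apply] at this
  convert this using 3
  push_cast; ring

lemma iterate_d_comm (c : Fin 4) (i : ℕ) (E : Fn D) : (d 1)^[i] (d c E) = d c ((d 1)^[i] E) := by
  induction i generalizing E with
  | zero => rfl
  | succ i ih => rw [Function.iterate_succ_apply, Function.iterate_succ_apply, d_comm, ih]

lemma UBnd.d {n : ℤ} {E : Fn D} (h : UBnd n E) {c : Fin 4} (hc : c ≠ 1) : UBnd n (Fn.d c E) := by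
  intro K hK hcK i m
  obtain ⟨C, R, hR⟩ := h K hK hcK i (m + 1)
  obtain ⟨R', hR'⟩ := D.rays K hK hcK
  refine ⟨‖ContinuousLinearMap.apply ℝ ℂ (baseDir c)‖ * C, max (max R R') 0, fun p hp r hr => ?_⟩
  have hr1 : R < r := ((le_max_left _ _).trans (le_max_left _ _)).trans_lt hr
  have hr2 : R' < r := ((le_max_right _ _).trans (le_max_left _ _)).trans_lt hr
  have hd := hR' p hp r hr2
  have hb := hR p hp r hr1
  rw [iterate_d_comm]
  set H := (Fn.d 1)^[i] E with hH
  have e : (fun q => (Fn.d c H).ev (pt q r)) =ᶠ[𝓝 p]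
      (ContinuousLinearMap.apply ℝ ℂ (baseDir c)) ∘ fderiv ℝ (fun q => H.ev (pt q r)) := by
    filter_upwards [eventually_slice hd] with q hq
    exact (fderiv_slice H hq hc).symm
  rw [(e.iteratedFDeriv ℝ m).eq_of_nhds]
  have hs : ContDiffAt ℝ ∞ (fderiv ℝ (fun q => H.ev (pt q r))) p :=
    (contDiffAt_slice H hd).fderiv_right (by simp)
  refine (ContinuousLinearMap.norm_iteratedFDeriv_comp_left _ hs (by exact_mod_cast le_top)).trans ?_
  rw [norm_iteratedFDeriv_fderiv, mul_assoc]
  exact mul_le_mul_of_nonneg_left hb (norm_nonneg _)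

lemma UBnd.bnd {n : ℤ} {E : Fn D} (h : UBnd n E) : Bnd n E := by
  intro K hK hc a ha
  obtain ⟨C, R, hR⟩ := h K hK hc 0 0
  refine IsBigO.of_bound |C| ?_
  rw [eventually_end]
  refine ⟨max R 1, fun p hp r hr => ?_⟩
  have hr1 : 1 < r := (le_max_right _ _).trans_lt hr
  have := hR p hp r ((le_max_left _ _).trans_lt hr)
  rw [norm_iteratedFDeriv_zero] at this
  simp only [Function.iterate_zero, id, Nat.cast_zero, sub_zero] at this
  refine this.trans ?_
  have h0 : 0 < r ^ (-a) := Real.rpow_pos_of_pos (by linarith) _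
  rw [Real.norm_of_nonneg h0.le]
  have h2 : r ^ (-n) ≤ r ^ (-a) := by
    rw [← Real.rpow_intCast]
    exact Real.rpow_le_rpow_of_exponent_le hr1.le (by push_cast; linarith)
  have h3 : 0 ≤ r ^ (-n) := (zpow_pos (by linarith) _).le
  exact (mul_le_mul_of_nonneg_right (le_abs_self C) h3).trans
    (mul_le_mul_of_nonneg_left h2 (abs_nonneg _))

lemma UBnd.mem {n : ℤ} {E : Fn D} (h : UBnd n E) : E ∈ B D n := by
  intro k
  induction k generalizing n E with
  | zero => exact h.bnd
  | succ k ih =>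
    refine ⟨h.bnd, fun c => ?_⟩
    split_ifs with hc
    · subst hc; exact ih h.d1
    · simpa using ih (h.d hc)

section expansion

variable {F : Type*} [NormedAddCommGroup F] [NormedSpace ℝ F] (ι : F →ₗᵢ[ℝ] ℂ) (π : ℂ →L[ℝ] F)
  (hπ : ∀ v, π (ι v) = v)
include hπ

/-- The isometry `ι` with left inverse `π` covers real and complex expansions at once. `π` carries
differentiability in the ring back to the values in `F`. -/
lemma ev_iterate_d1 {E : Fn D} {e : Scri → ℝ → F}
    (hE : ∀ p r, pt p r ∈ D.dom → E.ev (pt p r) = ι (e p r)) (i : ℕ) {p : Scri} {r : ℝ}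
    (h : pt p r ∈ D.dom) : ((d 1)^[i] E).ev (pt p r) = ι (iteratedDeriv i (e p) r) := by
  induction i generalizing r with
  | zero => simpa using hE p r h
  | succ i ih =>
    rw [Function.iterate_succ_apply']
    have h1 := hasDerivAt_ray ((d 1)^[i] E) h
    have hev : ∀ᶠ t in 𝓝 r, pt p t ∈ D.dom :=
      (hasDerivAt_pt p r).continuousAt.eventually (D.dom_open.mem_nhds h)
    have h2 : HasDerivAt (fun t => ι (iteratedDeriv i (e p) t))
        ((d 1 ((d 1)^[i] E)).ev (pt p r)) r :=
      h1.congr_of_eventuallyEq (by filter_upwards [hev] with t ht using (ih ht).symm)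
    have h3 := π.hasFDerivAt.comp_hasDerivAt r h2
    have h4 : HasDerivAt (iteratedDeriv i (e p)) (π ((d 1 ((d 1)^[i] E)).ev (pt p r))) r := by
      refine h3.congr_of_eventuallyEq (Eventually.of_forall fun t => ?_)
      simp [hπ]
    have h5 := ι.toContinuousLinearMap.hasFDerivAt.comp_hasDerivAt r h4
    rw [iteratedDeriv_succ, h4.deriv]
    exact h2.unique h5

lemma mem_B_of_remainder {f : Scri → ℝ → F} {k₀ : ℤ} {N : ℤ → ℕ} {c : ℤ → ℕ → Scri → F}
    (h : HasPolyExpansion D.scri f k₀ N c) (n : ℤ) {E : Fn D}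
    (hE : ∀ p r, pt p r ∈ D.dom → E.ev (pt p r) = ι (f p r - polySum k₀ N c n p r)) :
    E ∈ B D n := by
  refine UBnd.mem fun K hK hc i m => ?_
  obtain ⟨R, hR⟩ := h.remainder K hK hc n i m 1 one_pos
  obtain ⟨R', hR'⟩ := D.rays K hK hc
  refine ⟨1, max R R', fun p hp r hr => ?_⟩
  have hd := hR' p hp r ((le_max_right _ _).trans_lt hr)
  have hb := hR p hp r ((le_max_left _ _).trans_lt hr)
  have e1 : (fun q => ((d 1)^[i] E).ev (pt q r)) =ᶠ[𝓝 p]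
      ι ∘ fun q => iteratedDeriv i (fun s => f q s - polySum k₀ N c n q s) r := by
    filter_upwards [eventually_slice hd] with q hq
    exact ev_iterate_d1 ι π hπ hE i hq
  have e2 : (fun q => iteratedDeriv i (fun s => f q s - polySum k₀ N c n q s) r) =ᶠ[𝓝 p]
      π ∘ fun q => ((d 1)^[i] E).ev (pt q r) := by
    filter_upwards [e1] with q hq
    simp [hq, hπ]
  have hs : ContDiffAt ℝ ∞
      (fun q => iteratedDeriv i (fun s => f q s - polySum k₀ N c n q s) r) p :=
    (π.contDiff.contDiffAt.comp p (contDiffAt_slice _ hd)).congr_of_eventuallyEq e2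
  rw [(e1.iteratedFDeriv ℝ m).eq_of_nhds,
    ι.norm_iteratedFDeriv_comp_left hs (by exact_mod_cast le_top)]
  exact hb

end expansion

open Classical in
/-- A coefficient of an expansion as an element of the ring. -/
def coeff (D : Nbhd) (c : Scri → ℂ) : Fn D := if h : ContDiffOn ℝ ∞ c D.scri then pf c h else 0

lemma isPf_coeff (c : Scri → ℂ) : IsPf (coeff D c) := by
  unfold coeff
  split_ifs with h
  · exact isPf_pf c h
  · exact ⟨fun _ => 0, contDiffOn_const, fun x _ => ev_zero⟩

lemma ev_coeff {c : Scri → ℂ} (h : ContDiffOn ℝ ∞ c D.scri) {p : Scri} {r : ℝ}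
    (hx : pt p r ∈ D.dom) : (coeff D c).ev (pt p r) = c p := by
  rw [coeff, dif_pos h, ev_pf h hx, base_pt]

lemma lnr_pow_mem (j : ℕ) : lnr D ^ j ∈ B D 0 := by
  induction j with
  | zero => rw [pow_zero]; exact one_mem
  | succ j ih => rw [pow_succ]; exact Bm ih lnr_mem

/-- The terms of order `r^{-k}`. -/
def layer (D : Nbhd) (N : ℤ → ℕ) (c : ℤ → ℕ → Scri → ℂ) (k : ℤ) : Fn D :=
  ∑ j ∈ Finset.range (N k + 1), rz D k * lnr D ^ j * coeff D (c k j)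

lemma layer_mem (N : ℤ → ℕ) (c : ℤ → ℕ → Scri → ℂ) (k : ℤ) : layer D N c k ∈ B D k :=
  sum_mem fun j _ => Bm (Bm (rz_mem k) (lnr_pow_mem j) le_rfl) (isPf_coeff _).mem

section expansion

variable {F : Type*} [NormedAddCommGroup F] [NormedSpace ℝ F] (ι : F →ₗᵢ[ℝ] ℂ) (π : ℂ →L[ℝ] F)
  (hπ : ∀ v, π (ι v) = v)
include hπ

/-- The remainder estimate at order `n` only gives `o(r^{-n})`. It is applied one order further, and
the layer `n + 1`, which is itself of that order, is then moved into the remainder. -/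
lemma sub_layers_mem {f : Scri → ℝ → F} {k₀ : ℤ} {N : ℤ → ℕ} {c : ℤ → ℕ → Scri → F}
    (h : HasPolyExpansion D.scri f k₀ N c) {E : Fn D}
    (hE : ∀ p r, pt p r ∈ D.dom → E.ev (pt p r) = ι (f p r)) (n : ℤ) :
    E - ∑ k ∈ Finset.Icc k₀ n, layer D N (fun k j p => ι (c k j p)) k ∈ B D (n + 1) := by
  have key : ∀ n, E - ∑ k ∈ Finset.Icc k₀ n, layer D N (fun k j p => ι (c k j p)) k ∈ B D n := by
    intro n
    refine mem_B_of_remainder ι π hπ h n fun p r hx => ?_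
    rw [ev_sub _ _ hx, hE p r hx, map_sub, ev_sum _ _ hx, polySum, map_sum]
    congr 1
    refine Finset.sum_congr rfl fun k hk => ?_
    rw [layer, ev_sum _ _ hx, map_sum]
    refine Finset.sum_congr rfl fun j hj => ?_
    have hs : ContDiffOn ℝ ∞ (fun p => ι (c k j p)) D.scri :=
      ι.contDiff.comp_contDiffOn (h.coeff_smooth k (Finset.mem_Icc.1 hk).1 j
        (Nat.lt_succ_iff.1 (Finset.mem_range.1 hj)))
    rw [ev_mul _ _ hx, ev_mul _ _ hx, ev_rz _ hx, ev_pow _ _ hx, ev_lnr hx, ev_coeff hs hx,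
      map_smul, Complex.real_smul]
    simp [pt]
  have h1 := key (n + 1)
  by_cases hn : k₀ ≤ n + 1
  · have e : Finset.Icc k₀ (n + 1) = insert (n + 1) (Finset.Icc k₀ n) := by
      ext k; simp only [Finset.mem_Icc, Finset.mem_insert]; omega
    rw [e, Finset.sum_insert (by simp)] at h1
    have := add_mem h1 (layer_mem N (fun k j p => ι (c k j p)) (n + 1))
    convert this using 1; ring
  · rw [Finset.Icc_eq_empty (by omega)] at h1 ⊢
    exact h1

lemma mem_B_of_poly {f : Scri → ℝ → F} {k₀ : ℤ} (h : IsPolyhomogeneous D.scri f k₀) {E : Fn D}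
    (hE : ∀ p r, pt p r ∈ D.dom → E.ev (pt p r) = ι (f p r)) : E ∈ B D k₀ := by
  obtain ⟨N, c, h⟩ := h
  have := sub_layers_mem ι π hπ h hE (k₀ - 1)
  rw [Finset.Icc_eq_empty (by omega)] at this
  simpa using this

end expansion

lemma mem_B_of_real {f : Scri → ℝ → ℝ} {k₀ : ℤ} (h : IsPolyhomogeneous D.scri f k₀) {E : Fn D}
    (hE : ∀ p r, pt p r ∈ D.dom → E.ev (pt p r) = f p r) : E ∈ B D k₀ :=
  mem_B_of_poly Complex.ofRealLI Complex.reCLM (fun v => by simp) h hE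

lemma mem_B_of_complex {f : Scri → ℝ → ℂ} {k₀ : ℤ} (h : IsPolyhomogeneous D.scri f k₀) {E : Fn D}
    (hE : ∀ p r, pt p r ∈ D.dom → E.ev (pt p r) = f p r) : E ∈ B D k₀ :=
  mem_B_of_poly LinearIsometry.id (ContinuousLinearMap.id ℝ ℂ) (fun v => by simp) h hE

end Fn
end BoostRot
end

/-! ### The limit of the Killing vector and the constants -/

noncomputable section

namespace BoostRot

open Filter Asymptotics Fn

/-- A polynomial in `ln r` that tends to zero vanishes. -/
lemma poly_log_eq_zero {P : Polynomial ℝ}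
    (h : Tendsto (fun r => P.eval (Real.log r)) atTop (𝓝 0)) : P = 0 := by
  have h1 : Tendsto (fun t => P.eval t) atTop (𝓝 0) := by
    have := h.comp Real.tendsto_exp_atTop
    refine this.congr fun t => ?_
    simp
  have h2 := (Polynomial.tendsto_nhds_iff (P := P) (c := 0)).1 h1
  exact Polynomial.leadingCoeff_eq_zero.1 h2.1

/-- Passage from the coordinate form of the Lie derivative to the Leibniz rule for brackets, by
relabelling summation indices. -/
lemma Geo.killing_of_lie {A : Type*} [CommRing A] [Algebra ℂ A] (G : Geo A) (X : Fin 4 → A)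
    (h : ∀ a b, ∑ c, (X c * G.d c (G.g a b) + G.g c b * G.d a (X c) + G.g a c * G.d b (X c)) = 0)
    (V W : Fin 4 → A) : G.Dv X (G.gm V W) = G.gm (G.br X V) W + G.gm V (G.br X W) := by
  have h1 : G.Dv X (G.gm V W) = ∑ a, ∑ b, (G.Dv X (G.g a b) * V a * W b
      + G.g a b * G.Dv X (V a) * W b + G.g a b * V a * G.Dv X (W b)) := by
    simp only [Geo.gm, Geo.Dv_sum, Geo.Dv_mul]
    exact Finset.sum_congr rfl fun a _ => Finset.sum_congr rfl fun b _ => by ring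
  have h2 : ∀ a b, G.Dv X (G.g a b) = -(∑ c, (G.g c b * G.d a (X c) + G.g a c * G.d b (X c))) := by
    intro a b
    have := h a b
    simp only [add_assoc] at this
    rw [Finset.sum_add_distrib] at this
    rw [Geo.Dv]; linear_combination this
  have h3 : ∑ a, ∑ b, G.g a b * G.Dv V (X a) * W b
      = ∑ a, ∑ b, (∑ c, G.g c b * G.d a (X c)) * V a * W b := by
    simp only [Geo.Dv, Finset.sum_mul, Finset.mul_sum]
    rw [Finset.sum_comm]
    conv_rhs => rw [Finset.sum_comm]
    refine Finset.sum_congr rfl fun b _ => ?_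
    rw [Finset.sum_comm]
    exact Finset.sum_congr rfl fun a _ => Finset.sum_congr rfl fun c _ => by ring
  have h4 : ∑ a, ∑ b, G.g a b * V a * G.Dv W (X b)
      = ∑ a, ∑ b, (∑ c, G.g a c * G.d b (X c)) * V a * W b := by
    simp only [Geo.Dv, Finset.sum_mul, Finset.mul_sum]
    refine Finset.sum_congr rfl fun a _ => ?_
    rw [Finset.sum_comm]
    exact Finset.sum_congr rfl fun a _ => Finset.sum_congr rfl fun c _ => by ring
  have h5 : G.gm (G.br X V) W + G.gm V (G.br X W)
      = (∑ a, ∑ b, (G.g a b * G.Dv X (V a) * W b + G.g a b * V a * G.Dv X (W b)))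
        - (∑ a, ∑ b, G.g a b * G.Dv V (X a) * W b) - ∑ a, ∑ b, G.g a b * V a * G.Dv W (X b) := by
    simp only [Geo.gm, Geo.br_apply, ← Finset.sum_add_distrib, ← Finset.sum_sub_distrib]
    exact Finset.sum_congr rfl fun a _ => Finset.sum_congr rfl fun b _ => by ring
  rw [h1, h5, h3, h4]
  simp only [← Finset.sum_add_distrib, ← Finset.sum_sub_distrib]
  refine Finset.sum_congr rfl fun a _ => Finset.sum_congr rfl fun b _ => ?_
  rw [h2, Finset.sum_add_distrib]
  ring

namespace Fn

variable {D : Nbhd}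

/-- The three coordinate directions on null infinity span, so the differential of the underlying
function vanishes on a connected open set. -/
lemma eq_const_of_d_zero (hD : IsPreconnected D.scri) {f : Fn D} (hf : IsPf f)
    (h : ∀ a, a ≠ 1 → d a f = 0) : ∃ C : ℂ, f = algebraMap ℂ _ C := by
  obtain ⟨c, hc, e⟩ := hf
  have hd : DifferentiableOn ℝ c D.scri := hc.differentiableOn (by simp)
  obtain ⟨C, hC⟩ := D.scri_open.exists_is_const_of_fderiv_eq_zero hD hd (fun p hp => by
    obtain ⟨r, hr⟩ := (eventually_ray D hp).exists
    have key : ∀ a, a ≠ 1 → fderiv ℝ c p (baseDir a) = 0 := fun a ha => by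
      have h1 := pd_base hc a hr
      rw [base_pt] at h1
      rw [← h1, ← ev_d_of_eq a f e hr, h a ha, ev_zero]
    ext v
    have hv : v = v 0 • baseDir 0 + v 1 • baseDir 2 + v 2 • baseDir 3 := by
      ext i; fin_cases i <;> simp [baseDir, base]
    rw [hv]
    simp only [map_add, map_smul, key 0 (by decide), key 2 (by decide), key 3 (by decide)]
    simp)
  exact ⟨C, ext_ev fun x hx => by rw [e x hx, hC _ (D.base_mem x hx), ev_algebraMap _ hx]⟩

lemma d_coeff_of_real {c : Scri → ℝ} {c' : ℝ} {a : Fin 4} {x : Pt} (hx : x ∈ D.dom)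
    (hc : ContDiffOn ℝ ∞ (fun p => (c p : ℂ)) D.scri)
    (h : HasFDerivAt c (c' • ContinuousLinearMap.proj 1 : Scri →L[ℝ] ℝ) (base x)) :
    (d a (pf _ hc)).ev x = if a = 2 then (c' : ℂ) else 0 := by
  rw [ev_d_of_eq a _ (fun y hy => ev_pf hc hy) hx, pd_base hc a hx]
  have h1 := (Complex.ofRealCLM.hasFDerivAt.comp (base x) h).fderiv
  have e : (fun p => (c p : ℂ)) = ⇑Complex.ofRealCLM ∘ c := rfl
  rw [e, h1]
  fin_cases a <;> simp [baseDir, base]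

end Fn

lemma hasFDerivAt_comp_theta {f : ℝ → ℝ} {f' : ℝ} {p : Scri} (h : HasDerivAt f f' (p 1)) :
    HasFDerivAt (fun q : Scri => f (q 1)) (f' • ContinuousLinearMap.proj 1 : Scri →L[ℝ] ℝ) p := by
  exact h.comp_hasFDerivAt p
    (ContinuousLinearMap.proj (R := ℝ) (φ := fun _ : Fin 3 => ℝ) 1).hasFDerivAt

lemma contDiff_theta {f : ℝ → ℝ} (h : ContDiff ℝ ∞ f) :
    ContDiff ℝ ∞ fun p : Scri => (f (p 1) : ℂ) :=
  Complex.ofRealCLM.contDiff.comp (h.comp (contDiff_apply ℝ ℝ (1 : Fin 3)))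

namespace NullChart

variable (M : NullChart) (hM : M.IsNullChart)

lemma sin_pos {p : Scri} (hM : M.IsNullChart) (hp : p ∈ M.scri) : 0 < Real.sin (p 1) :=
  Real.sin_pos_of_mem_Ioo (hM.scri_theta p hp)

def sinF : Fn (M.nbhd hM) := pf _ (contDiff_theta Real.contDiff_sin).contDiffOn
def cosF : Fn (M.nbhd hM) := pf _ (contDiff_theta Real.contDiff_cos).contDiffOn
def cscF : Fn (M.nbhd hM) := pf (fun p => ((Real.sin (p 1) : ℝ) : ℂ)⁻¹)
  ((contDiff_theta Real.contDiff_sin).contDiffOn.inv fun p hp => by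
    exact_mod_cast (M.sin_pos hM hp).ne')

lemma ev_sinF {x : Pt} (hx : x ∈ (M.nbhd hM).dom) : (M.sinF hM).ev x = Real.sin (x 2) := ev_pf _ hx
lemma ev_cscF {x : Pt} (hx : x ∈ (M.nbhd hM).dom) :
    (M.cscF hM).ev x = ((Real.sin (x 2) : ℝ) : ℂ)⁻¹ := ev_pf _ hx

lemma d_sinF (a : Fin 4) : d a (M.sinF hM) = if a = 2 then M.cosF hM else 0 := ext_ev fun x hx => by
  rw [sinF, d_coeff_of_real hx _ (hasFDerivAt_comp_theta (Real.hasDerivAt_sin _))]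
  split_ifs
  · rw [cosF, ev_pf _ hx]
  · exact ev_zero.symm

lemma sin_csc : M.sinF hM * M.cscF hM = 1 := ext_ev fun x hx => by
  rw [ev_mul _ _ hx, M.ev_sinF hM hx, M.ev_cscF hM hx, ev_one hx, mul_inv_cancel₀]
  exact_mod_cast (M.sin_pos hM hx.2.2).ne'

/-- Functions that are constant along the orbits of `∂_φ` have vanishing derivative. -/
lemma pd_three {E : Type*} [NormedAddCommGroup E] [NormedSpace ℝ E] {f : Pt → E} {s : Set Pt}
    (hs : IsOpen s) {x : Pt} (hx : x ∈ s) (hf : DifferentiableAt ℝ f x)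
    (h : ∀ x ∈ s, ∀ y ∈ s, SameOrbit x y → f x = f y) : pd 3 f x = 0 := by
  have h1 : HasDerivAt (fun t : ℝ => x + t • (Pi.single 3 1 : Pt)) (Pi.single 3 1) 0 := by
    simpa using ((hasDerivAt_id (0 : ℝ)).smul_const (Pi.single 3 1 : Pt)).const_add x
  have e0 : x + (0 : ℝ) • (Pi.single 3 1 : Pt) = x := by simp
  have h2 : HasDerivAt (fun t : ℝ => f (x + t • (Pi.single 3 1 : Pt))) (pd 3 f x) 0 := by
    have hf' : HasFDerivAt f (fderiv ℝ f x) (x + (0 : ℝ) • (Pi.single 3 1 : Pt)) := by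
      rw [e0]; exact hf.hasFDerivAt
    exact hf'.comp_hasDerivAt 0 h1
  have hev : ∀ᶠ t in 𝓝 (0 : ℝ), x + t • (Pi.single 3 1 : Pt) ∈ s :=
    h1.continuousAt.eventually (by simpa using hs.mem_nhds hx)
  have h3 : HasDerivAt (fun t : ℝ => f (x + t • (Pi.single 3 1 : Pt))) 0 0 := by
    refine (hasDerivAt_const (0 : ℝ) (f x)).congr_of_eventuallyEq ?_
    filter_upwards [hev] with t ht
    exact h _ ht _ hx ⟨by simp, by simp, by simp⟩
  exact h2.unique h3

/-- The relative corrections to the Minkowski legs: the difference from the leading term, multiplied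
by `r`. -/
def xF : Fin 2 → Fn (M.nbhd hM) := ![r _ * (M.xiF hM 0 - s _ * ca _),
  r _ * (M.xiF hM 1 + s _ * (cI _ * ca _ * M.cscF hM))]

/-- Beyond order five the remainder is negligible. The fifth layer consists of a logarithm-free
term, which lies in `L`, and the term `r⁻⁵ ln r`. -/
lemma minimal (hvac : M.IsVacuum) {ψ : ℤ → ℕ → Scri → ℂ} (hψ : M.HasMinimalPsi0 ψ) :
    (M.tetrad hM hvac).Minimal (coeff _ (ψ 4 0)) (coeff _ (ψ 5 1)) ∧
      (M.tetrad hM hvac).Ψ0 ∈ B (M.nbhd hM) 4 := by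
  obtain ⟨N, h4, h5, -, h⟩ := hψ
  have h1 := sub_layers_mem (D := M.nbhd hM) LinearIsometry.id (ContinuousLinearMap.id ℝ ℂ)
    (fun v => by simp) h (E := (M.tetrad hM hvac).Ψ0) (fun p r hx => M.ev_Psi0 hM hvac hx) 5
  have e4 : layer (M.nbhd hM) N ψ 4 = s _ ^ 4 * coeff _ (ψ 4 0) := by
    rw [layer, h4, s]; simp only [Finset.sum_range_one, pow_zero, mul_one, zero_add]
    rw [show rz (M.nbhd hM) 1 ^ 4 = rz _ 1 * (rz _ 1 * (rz _ 1 * rz _ 1)) by ring, rz_mul, rz_mul,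
      rz_mul]; norm_num
  have e5 : layer (M.nbhd hM) N ψ 5 = rz _ 5 * coeff _ (ψ 5 0)
      + s _ ^ 5 * (coeff _ (ψ 5 1) * lnr _) := by
    rw [layer, h5, s]
    simp only [Finset.sum_range_succ, Finset.sum_range_zero, pow_zero, mul_one, zero_add, pow_one]
    rw [show rz (M.nbhd hM) 1 ^ 5 = rz _ 1 * (rz _ 1 * (rz _ 1 * (rz _ 1 * rz _ 1))) by ring,
      rz_mul, rz_mul, rz_mul, rz_mul]; norm_num; ring
  have e : ∑ k ∈ Finset.Icc (4 : ℤ) 5, layer (M.nbhd hM) N ψ k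
      = layer _ N ψ 4 + layer _ N ψ 5 := by
    rw [show Finset.Icc (4 : ℤ) 5 = {4, 5} by decide, Finset.sum_pair (by norm_num)]
  simp only [LinearIsometry.id_apply] at h1
  rw [e] at h1
  refine ⟨⟨isPf_coeff _, isPf_coeff _, ?_⟩, ?_⟩
  · have h2 : rz _ 5 * coeff _ (ψ 5 0) ∈ L (M.nbhd hM) 5 := by
      have : s (M.nbhd hM) * (s _ * (s _ * (s _ * (s _ * coeff _ (ψ 5 0))))) ∈ L _ 5 :=
        Ls (k := 4) (Ls (k := 3) (Ls (k := 2) (Ls (k := 1) (Ls (k := 0) (isPf_coeff _).mem_L))))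
      convert this using 1
      simp only [s, ← mul_assoc, rz_mul]; norm_num
    have := add_mem (BL h1 (l := 5)) h2
    rw [e4, e5] at this
    convert this using 1; ring
  · have := add_mem (Bw h1 (l := 4)) (add_mem (layer_mem N ψ 4) (Bw (layer_mem N ψ 5) (l := 4)))
    rwa [sub_add_cancel] at this

lemma flat (hvac : M.IsVacuum) (hflat : M.IsPolyhomogeneousFlat) (hax : M.IsAxisymmetric)
    {ψ : ℤ → ℕ → Scri → ℂ} (hψ : M.HasMinimalPsi0 ψ) :
    (M.tetrad hM hvac).Flat (M.sinF hM) (M.cosF hM) (M.cscF hM) (M.xF hM) where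
  hd := rfl
  sn_pf := isPf_pf _ _
  cs_pf := isPf_pf _ _
  csc_pf := isPf_pf _ _
  sn_csc := M.sin_csc hM
  csc_real := ext_ev fun x hx => by
    rw [ev_cj _ hx, M.ev_cscF hM hx, ← Complex.ofReal_inv, Complex.conj_ofReal]
  d2_sn := by rw [d_sinF, if_pos rfl]
  d0_sn := by rw [d_sinF, if_neg (by decide)]
  d3_sn := by rw [d_sinF, if_neg (by decide)]
  Q_mem := mem_B_of_real hflat.Q_exp fun p r hx => by
    rw [ev_add _ _ hx, ev_algebraMap _ hx]
    change (M.QF hM).ev _ + _ = _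
    rw [QF, ev_ofR _ hx]; push_cast; rfl
  C_mem i := mem_B_of_real (hflat.C_exp i) fun p r hx => by
    change (M.CF hM i).ev _ = _
    rw [CF, ev_ofR _ hx]
  C_real i := by
    change cj (M.CF hM i) = M.CF hM i
    rw [CF, cj_ofR]
  zeta_eq i := rfl
  xi0 := by
    change M.xiF hM 0 = s _ * (ca _ + r _ * (M.xiF hM 0 - s _ * ca _))
    linear_combination (-(M.xiF hM 0) + s _ * ca _) * rs (D := M.nbhd hM)
  xi1 := by
    change M.xiF hM 1 = s _ * (-(cI _ * ca _ * M.cscF hM)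
      + r _ * (M.xiF hM 1 + s _ * (cI _ * ca _ * M.cscF hM)))
    linear_combination (-(M.xiF hM 1) - s _ * (cI _ * ca _ * M.cscF hM)) * rs (D := M.nbhd hM)
  x_mem i := by
    fin_cases i
    · refine r_mul_mem (k := 2) (mem_B_of_complex hflat.ξθ_exp fun p ρ hx => ?_)
      rw [ev_sub _ _ hx, ev_mul _ _ hx, xiF, ev_mk _ hx, s, ev_rz _ hx, ca, ev_algebraMap _ hx]
      congr 1
      simp only [pt, zpow_neg_one, Matrix.cons_val_one, Matrix.cons_val_zero]
      push_cast
      rw [one_div, one_div, mul_inv, mul_comm]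
    · refine r_mul_mem (k := 2) (mem_B_of_complex hflat.ξφ_exp fun p ρ hx => ?_)
      rw [ev_add _ _ hx, ev_mul _ _ hx, ev_mul _ _ hx, ev_mul _ _ hx, xiF, ev_mk _ hx, s,
        ev_rz _ hx, ca, ev_algebraMap _ hx, cI, ev_algebraMap _ hx, M.ev_cscF hM hx]
      congr 1
      simp [pt]
      ring
  d3_xi i := ext_ev fun x hx => by
    change (d 3 (M.xiF hM i)).ev x = _
    rw [xiF, ev_d_of_eq 3 _ (fun y hy => ev_mk _ hy) hx, ev_zero]
    exact pd_three hM.region_open hx.1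
      (((hM.smooth_ξ i).contDiffAt (hM.region_open.mem_nhds hx.1)).differentiableAt (by simp))
      fun x hx y hy hxy => hax.ξ_inv x hx y hy hxy i
  Psi0_mem := (M.minimal hM hvac hψ).2

section killing

variable {X : Fin 4 → Pt → ℝ} (hX : M.IsBoostRotationKilling X)

def XF (a : Fin 4) : Fn (M.nbhd hM) := ofR (X a) ((hX.smooth a).mono (M.nbhd_sub hM))

lemma killing (V W : Fin 4 → Fn (M.nbhd hM)) :
    (M.geo hM).Dv (M.XF hM hX) ((M.geo hM).gm V W)
      = (M.geo hM).gm ((M.geo hM).br (M.XF hM hX) V) W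
        + (M.geo hM).gm V ((M.geo hM).br (M.XF hM hX) W) := by
  refine Geo.killing_of_lie _ _ (fun a b => ext_ev fun x hx => ?_) V W
  have h := hX.killing x hx.1 a b
  change (∑ c, (M.XF hM hX c * d c (M.gF hM a b) + M.gF hM c b * d a (M.XF hM hX c)
    + M.gF hM a c * d b (M.XF hM hX c))).ev x = _
  have e1 : ∀ a c, (d a (M.XF hM hX c)).ev x = (pd a (X c) x : ℝ) := fun a c => ev_d_ofR _ _ hx
  have e2 : ∀ c, (d c (M.gF hM a b)).ev x = (pd c (fun y => M.g y a b) x : ℝ) :=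
    fun c => ev_d_ofR _ _ hx
  have e3 : ∀ c, (M.XF hM hX c).ev x = X c x := fun c => ev_ofR _ hx
  simp only [ev_sum _ _ hx, ev_add _ _ hx, ev_mul _ _ hx, e1, e2, e3, M.ev_gF hM hx, ev_zero]
  rw [lieMetric] at h
  exact_mod_cast h

/-- The assumption only makes `X^θ` polyhomogeneous of order `r⁰`, possibly with logarithms. The
Killing equations remove these, so that a limit `χ` exists. -/
lemma boost (hvac : M.IsVacuum) (hflat : M.IsPolyhomogeneousFlat) (hax : M.IsAxisymmetric)
    {ψ : ℤ → ℕ → Scri → ℂ} (hψ : M.HasMinimalPsi0 ψ) :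
    ∃ χ, (M.geo hM).Boost (M.XF hM hX) χ := by
  set D := M.nbhd hM with hD
  have F := M.flat hM hvac hflat hax hψ
  have hK := M.killing hM hX
  have hev : ∀ a p r, pt p r ∈ D.dom → (M.XF hM hX a).ev (pt p r) = X a (pt p r) :=
    fun a p r hx => ev_ofR _ hx
  have h1 : M.XF hM hX 1 ∈ B D (-1) := mem_B_of_real hX.Xr_exp (hev 1)
  obtain ⟨N, c, hc⟩ := hX.Xθ_exp
  have h2 := sub_layers_mem (D := D) Complex.ofRealLI Complex.reCLM (fun v => by simp) hc (hev 2) 0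
  rw [Finset.Icc_self, Finset.sum_singleton] at h2
  set c' : ℤ → ℕ → Scri → ℂ := fun k j p => Complex.ofRealLI (c k j p) with hc'
  have hs : ∀ j ∈ Finset.range (N 0 + 1), ContDiffOn ℝ ∞ (c' 0 j) D.scri := fun j hj =>
    Complex.ofRealLI.contDiff.comp_contDiffOn (hc.coeff_smooth 0 le_rfl j
      (Nat.lt_succ_iff.1 (Finset.mem_range.1 hj)))
  -- The Killing equation makes `∂_r X^θ` of order `r⁻²`, hence so is the `r`-derivative of the
  -- leading layer.
  have hd : d 1 (layer D N c' 0) ∈ B D 2 := by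
    have e0 : d 1 (M.XF hM hX 0) = 0 := (M.tetrad hM hvac).killing_d_X0 hK
    have hX0 : M.XF hM hX 0 ∈ B D 0 := B_of_d1 le_rfl (by rw [e0]; exact zero_mem _)
    have e2 : d 1 (M.XF hM hX 2) ∈ B D 2 := by
      have := (M.tetrad hM hvac).killing_d_X2 hK
      change d 1 (M.XF hM hX 2) = _ at this
      rw [this]
      exact add_mem (Bm (F.Dmb_B hX0 (l := 1)) (F.xi_mem 0)) (Bm (F.Dm_B hX0 (l := 1)) (F.zeta_mem 0))
    have := sub_mem e2 (Bd1 h2 (l := 2))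
    rwa [map_sub, sub_sub_cancel] at this
  have hz : ∀ p ∈ D.scri, ∀ j ∈ Finset.range (N 0 + 1), j ≠ 0 → c 0 j p = 0 := by
    intro p hp j hj hj0
    let P : Polynomial ℝ := ∑ j ∈ Finset.range (N 0 + 1), Polynomial.monomial j (c 0 j p)
    -- On a fixed generator the leading layer is `P(ln r)`, so `r ∂_r` of it is `P'(ln r)`, which
    -- tends to zero.
    have hP : Polynomial.derivative P = 0 := by
      refine poly_log_eq_zero ?_
      have ht := (Complex.continuous_re.tendsto 0).comp (tendsto_ray (r_mul_mem hd (l := 1)) hp)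
      rw [Complex.zero_re] at ht
      refine ht.congr' ?_
      filter_upwards [eventually_ray D hp] with t hx
      have hpos : 0 < t := r_pos hx
      have e1 : r D * d 1 (layer D N c' 0)
          = ∑ j ∈ Finset.range (N 0 + 1), (j : ℂ) • (lnr D ^ (j - 1) * coeff D (c' 0 j)) := by
        rw [layer, map_sum, Finset.mul_sum]
        refine Finset.sum_congr rfl fun j _ => ?_
        rw [rz_zero, one_mul, Derivation.leibniz, (isPf_coeff _).d1, Derivation.leibniz_pow, d1_lnr]
        simp only [smul_eq_mul, mul_zero, zero_add, nsmul_eq_mul, Algebra.smul_def, map_natCast]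
        linear_combination coeff D (c' 0 j) * j * lnr D ^ (j - 1) * rs (D := D)
      simp only [Function.comp, e1, P, map_sum, Polynomial.derivative_monomial,
        Polynomial.eval_finsetSum, Polynomial.eval_monomial, ev_sum _ _ hx, Complex.re_sum]
      refine Finset.sum_congr rfl fun j hj => ?_
      rw [ev_smul _ _ hx, ev_mul _ _ hx, ev_pow _ _ hx, ev_lnr hx, ev_coeff (hs j hj) hx]
      simp only [pt, Matrix.cons_val_one, Matrix.cons_val_zero, hc', Complex.ofRealLI_apply]
      norm_cast
      ring
    obtain ⟨i, rfl⟩ := Nat.exists_eq_succ_of_ne_zero hj0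
    have h := congrArg (fun q => q.coeff i) hP
    simp only [Polynomial.coeff_derivative, Polynomial.coeff_zero, P, Polynomial.finsetSum_coeff,
      Polynomial.coeff_monomial] at h
    rw [Finset.sum_ite_eq' , if_pos hj] at h
    rcases mul_eq_zero.1 h with h | h
    · exact h
    · exact absurd h (by positivity)
  have hl : layer D N c' 0 = coeff D (c' 0 0) := by
    rw [layer, Finset.sum_eq_single 0]
    · rw [rz_zero, pow_zero, one_mul, one_mul]
    · intro j hj hj0
      have : coeff D (c' 0 j) = 0 := ext_ev fun x hx => by
        have := ev_coeff (hs j hj) (p := base x) (r := x 1) (by rwa [pt_base])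
        rw [pt_base] at this
        rw [this, ev_zero, hc']
        simp [hz _ (D.base_mem x hx) j hj hj0]
      rw [this, mul_zero]
    · intro h; simp at h
  rw [hl, zero_add] at h2
  refine ⟨coeff D (c' 0 0), hK, h1, h2, fun a => ext_ev fun x hx => ?_, isPf_coeff _⟩
  rw [XF, ev_d_ofR _ _ hx, ev_zero, pd_three hM.region_open hx.1
      (((hX.smooth a).contDiffAt (hM.region_open.mem_nhds hx.1)).differentiableAt (by simp))
      fun x hx y hy hxy => hX.commutes x hx y hy hxy a]
  rfl

include hM hX in
/-- The coefficients `Ψ₀^{4,0}` and `Ψ₀^{5,1}`. -/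
theorem exists_constants (hvac : M.IsVacuum) (hflat : M.IsPolyhomogeneousFlat) (hax : M.IsAxisymmetric)
    {ψ : ℤ → ℕ → Scri → ℂ} (hψ : M.HasMinimalPsi0 ψ) : ∃ C₁ C₂ : ℂ,
      (∀ p ∈ M.scri, ψ 4 0 p = C₁ * ((1 / Real.sin (p 1)) ^ 2 : ℝ)) ∧
      (∀ p ∈ M.scri, ψ 5 1 p = C₂ * ((1 / Real.sin (p 1)) ^ 3 : ℝ)) := by
  have F := M.flat hM hvac hflat hax hψ
  obtain ⟨χ, K⟩ := M.boost hM hX hvac hflat hax hψ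
  have hconn : IsPreconnected (M.nbhd hM).scri := hM.scri_connected.isPreconnected
  obtain ⟨c0, c3, c2⟩ := F.d_chi K
  have hcsc := F.d_csc
  have hsc := M.sin_csc hM
  -- The equation `∂_θ χ = cot θ χ` says that `χ / sin θ` has no `θ`-derivative.
  obtain ⟨κ, hκ⟩ := eq_const_of_d_zero hconn (K.chi_pf.mul F.csc_pf) (fun a ha => by
    rw [Derivation.leibniz, hcsc, smul_eq_mul, smul_eq_mul]
    fin_cases a
    · change χ * -(_ * d 0 _) + _ * d 0 χ = 0
      rw [F.d0_sn, c0]; ring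
    · exact absurd rfl ha
    · change χ * -(_ * d 2 _) + _ * d 2 χ = 0
      rw [F.d2_sn, c2]; ring
    · change χ * -(_ * d 3 _) + _ * d 3 χ = 0
      rw [F.d3_sn, c3]; ring)
  have hχ : χ = algebraMap ℂ _ κ * M.sinF hM := by
    rw [← hκ]; linear_combination -χ * hsc
  -- If `κ = 0`, then `X^θ` tends to zero on every generator, contrary to the assumption on `X`.
  have hκ0 : κ ≠ 0 := by
    rintro rfl
    rw [map_zero, zero_mul] at hχ
    obtain ⟨p, hp, hb⟩ := hX.boost
    refine hb ?_
    have h2 := K.X2_mem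
    rw [hχ, sub_zero] at h2
    have ht := (Complex.continuous_re.tendsto 0).comp (tendsto_ray h2 hp)
    rw [Complex.zero_re] at ht
    refine ht.congr' ?_
    filter_upwards [eventually_ray (M.nbhd hM) hp] with t hx
    simp only [Function.comp, XF, ev_ofR _ hx, Complex.ofReal_re]
  have hk : χ * (algebraMap ℂ _ κ⁻¹ * M.cscF hM) = 1 := by
    have : algebraMap ℂ (Fn (M.nbhd hM)) κ * algebraMap ℂ _ κ⁻¹ = 1 := by
      rw [← map_mul, mul_inv_cancel₀ hκ0, map_one]
    rw [hχ]; linear_combination M.sinF hM * M.cscF hM * this + hsc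
  obtain ⟨⟨a0, a3, a2⟩, b0, b3, b2⟩ := F.coefficients K (M.minimal hM hvac hψ).1 hk
  obtain ⟨N, n4, n5, -, hexp⟩ := hψ
  have key : ∀ (f : Scri → ℂ) (n : ℕ), ContDiffOn ℝ ∞ f M.scri →
      (∃ C : ℂ, M.sinF hM ^ n * coeff _ f = algebraMap ℂ _ C) →
      ∃ C : ℂ, ∀ p ∈ M.scri, f p = C * ((1 / Real.sin (p 1)) ^ n : ℝ) := by
    rintro f n hf ⟨C, hC⟩
    refine ⟨C, fun p hp => ?_⟩
    obtain ⟨t, hx⟩ := (eventually_ray (M.nbhd hM) hp).exists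
    have h := congrArg (fun q => q.ev (pt p t)) hC
    simp only [ev_mul _ _ hx, ev_pow _ _ hx, M.ev_sinF hM hx, ev_algebraMap _ hx] at h
    rw [ev_coeff hf hx] at h
    have hs : ((Real.sin (p 1) : ℝ) : ℂ) ≠ 0 := by exact_mod_cast (M.sin_pos hM hp).ne'
    change ((Real.sin (p 1) : ℝ) : ℂ) ^ n * f p = C at h
    rw [← h]; push_cast
    rw [Complex.ofReal_sin] at hs
    rw [one_div, inv_pow]
    field_simp
  have hsn := F.sn_pf
  have e0 := F.d0_sn
  have e2 := F.d2_sn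
  have e3 := F.d3_sn
  have hpow : ∀ n : ℕ, IsPf (M.sinF hM ^ n) := fun n => by
    induction n with
    | zero => rw [pow_zero, ← map_one (algebraMap ℂ _)]; exact isPf_algebraMap 1
    | succ n ih => rw [pow_succ]; exact ih.mul hsn
  -- The factors `sin² θ` here and `sin³ θ` below integrate the two equations in `θ`.
  obtain ⟨C₁, h₁⟩ := key (ψ 4 0) 2 (hexp.coeff_smooth 4 le_rfl 0 (by omega)) <|
    eq_const_of_d_zero hconn ((hpow 2).mul (isPf_coeff _)) fun a ha => by
      rw [Derivation.leibniz, Derivation.leibniz_pow]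
      simp only [smul_eq_mul, nsmul_eq_mul]
      fin_cases a
      · change _ * d 0 _ + _ * (_ * (_ * d 0 _)) = 0
        rw [a0, e0]; ring
      · exact absurd rfl ha
      · change _ * d 2 _ + _ * (_ * (_ * d 2 _)) = 0
        rw [e2]; push_cast
        linear_combination M.sinF hM ^ 2 * a2
          - 2 * M.sinF hM * M.cosF hM * coeff _ (ψ 4 0) * hsc
      · change _ * d 3 _ + _ * (_ * (_ * d 3 _)) = 0
        rw [a3, e3]; ring
  obtain ⟨C₂, h₂⟩ := key (ψ 5 1) 3 (hexp.coeff_smooth 5 (by norm_num) 1 (by omega)) <|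
    eq_const_of_d_zero hconn ((hpow 3).mul (isPf_coeff _)) fun a ha => by
      rw [Derivation.leibniz, Derivation.leibniz_pow]
      simp only [smul_eq_mul, nsmul_eq_mul]
      fin_cases a
      · change _ * d 0 _ + _ * (_ * (_ * d 0 _)) = 0
        rw [b0, e0]; ring
      · exact absurd rfl ha
      · change _ * d 2 _ + _ * (_ * (_ * d 2 _)) = 0
        rw [e2]; push_cast
        linear_combination M.sinF hM ^ 3 * b2
          - 3 * M.sinF hM ^ 2 * M.cosF hM * coeff _ (ψ 5 1) * hsc
      · change _ * d 3 _ + _ * (_ * (_ * d 3 _)) = 0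
        rw [b3, e3]; ring
  exact ⟨C₁, C₂, h₁, h₂⟩

end killing

/-- A multiple of a power of `1 / sin θ` blows up at the poles. -/
lemma tendsto_pole (hM : M.IsNullChart) {f : Scri → ℂ} {C : ℂ} {n : ℕ} (hn : n ≠ 0)
    (hf : ∀ p ∈ M.scri, f p = C * ((1 / Real.sin (p 1)) ^ n : ℝ)) (hC : C ≠ 0) {θ₀ : ℝ}
    (hθ : θ₀ = 0 ∨ θ₀ = Real.pi) : Tendsto (fun p => ‖f p‖)
      (comap (fun p : Scri => p 1) (𝓝 θ₀) ⊓ 𝓟 M.scri) atTop := by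
  have hs : Tendsto (fun p : Scri => Real.sin (p 1))
      (comap (fun p : Scri => p 1) (𝓝 θ₀) ⊓ 𝓟 M.scri) (𝓝[>] 0) := by
    refine tendsto_nhdsWithin_iff.2 ⟨?_, ?_⟩
    · have h0 : Real.sin θ₀ = 0 := by rcases hθ with rfl | rfl <;> simp
      rw [← h0]
      exact ((Real.continuous_sin.tendsto θ₀).comp tendsto_comap).mono_left inf_le_left
    · filter_upwards [mem_inf_of_right (mem_principal_self _)] with p hp using M.sin_pos hM hp
  have h1 : Tendsto (fun p : Scri => ‖C‖ * ((Real.sin (p 1))⁻¹) ^ n)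
      (comap (fun p : Scri => p 1) (𝓝 θ₀) ⊓ 𝓟 M.scri) atTop :=
    ((tendsto_pow_atTop hn).comp (tendsto_inv_nhdsGT_zero.comp hs)).const_mul_atTop
      (norm_pos_iff.2 hC)
  refine h1.congr' ?_
  filter_upwards [mem_inf_of_right (mem_principal_self _)] with p hp
  rw [hf p hp, norm_mul, Complex.norm_real, Real.norm_of_nonneg, one_div]
  have := M.sin_pos hM hp
  positivity

end NullChart
end BoostRot
end

/-! ### The metric of the cuts in terms of a coframe -/

noncomputable section

namespace BoostRot

open Fn

namespace Fn

variable {D : Nbhd}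

/-- The derivation `r² ∂_r`. -/
def dr (f : Fn D) : Fn D := r D * (r D * d 1 f)

variable {f h : Fn D}

lemma dr_add : dr (f + h) = dr f + dr h := by simp only [dr, map_add]; ring
lemma dr_sub : dr (f - h) = dr f - dr h := by simp only [dr, map_sub]; ring
lemma dr_neg : dr (-f) = -dr f := by simp only [dr, map_neg]; ring
lemma dr_mul : dr (f * h) = f * dr h + h * dr f := by
  simp only [dr, Derivation.leibniz, smul_eq_mul]; ring
lemma dr_cj : dr (cj f) = cj (dr f) := by simp only [dr, d_cj, map_mul, cj_r]

/-- Functions without logarithms at the first two orders. -/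
def LL (D : Nbhd) : Subring (Fn D) where
  carrier := {f | f ∈ L D 0 ∧ dr f ∈ L D 0}
  mul_mem' {f h} hf hh := ⟨Lm hf.1 hh.1, by
    rw [dr_mul]; exact add_mem (Lm hf.1 hh.2) (Lm hh.1 hf.2)⟩
  one_mem' := ⟨by rw [← map_one (algebraMap ℂ _)]; exact (isPf_algebraMap 1).mem_L, by
    simp [dr]⟩
  add_mem' {f h} hf hh := ⟨add_mem hf.1 hh.1, by rw [dr_add]; exact add_mem hf.2 hh.2⟩
  zero_mem' := ⟨zero_mem _, by simp [dr]⟩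
  neg_mem' {f} hf := ⟨neg_mem hf.1, by rw [dr_neg]; exact neg_mem hf.2⟩

end Fn

variable {D : Nbhd} {G : Geo (Fn D)}

namespace Tetrad.Flat

variable {T : Tetrad G} {sn cs csc : Fn D} {x : Fin 2 → Fn D}
  (F : T.Flat sn cs csc x)
include F

/-- The coframe dual to `r m`, `r m̄` (in the components along `∂_θ`, `∂_φ / sin θ`). -/
lemma exists_coframe : ∃ a b : Fin 2 → Fn D,
    (∀ i, a i ∈ L D 0) ∧ (∀ i, b i ∈ L D 0) ∧
    (∀ i, dr (a i) = -(r D * (r D * (T.ρ + s D)) * a i) - r D * (r D * T.σb) * b i) ∧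
    (∀ i, dr (b i) = -(r D * (r D * (T.ρ + s D)) * b i) - r D * (r D * T.σ) * a i) ∧
    (a 0 - ca D ∈ B D 1 ∧ a 1 - cI D * ca D ∈ B D 1) ∧
    (b 0 - ca D ∈ B D 1 ∧ b 1 + cI D * ca D ∈ B D 1) ∧
    a 0 * b 0 + b 0 * a 0 = -(s D * s D * G.g 2 2) ∧
    a 0 * b 1 + b 0 * a 1 = -(s D * s D * csc * G.g 2 3) ∧
    a 1 * b 1 + b 1 * a 1 = -(s D * s D * csc * csc * G.g 3 3) := by
  obtain ⟨k, hk, hkL⟩ := F.det_inv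
  -- The logarithmic derivative of the determinant of the legs is the trace `2 ρ` of their transport
  -- equation; the shear drops out.
  have dk : d 1 k = -(2 * T.ρ * k) := by
    have h := congrArg (d 1) hk
    have hx := T.d_xi
    have hz := T.d_zeta
    rw [F.hd] at hx hz
    simp only [Derivation.leibniz, map_sub, hx, hz, smul_eq_mul, Derivation.map_one_eq_zero] at h
    linear_combination k * h - (d 1 k + 2 * T.ρ * k) * hk
  have hm := T.mm
  have hmb := T.mbmb
  have hmmb := T.mmb
  simp only [Geo.gm, T.m_eq, T.mb_eq, Fin.sum_univ_four] at hm hmb hmmb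
  simp [G.g_symm 3 2] at hm hmb hmmb
  have hx := T.d_xi
  have hz := T.d_zeta
  rw [F.hd] at hx hz
  have hxm := F.x_mem
  have hzm := fun i => B_cj (F.x_mem i)
  have ha : s D * (T.ζ 1 * k) ∈ L D 0 := Ls (k := -1) (Lm (F.zeta_L 1) hkL)
  have ha' : -(s D * csc * (T.ζ 0 * k)) ∈ L D 0 :=
    neg_mem (Lm (k := 1) (Lm s_L F.csc_pf.mem_L) (Lm (m := -1) (F.zeta_L 0) hkL))
  have hb : -(s D * (T.ξ 1 * k)) ∈ L D 0 := neg_mem (Ls (k := -1) (Lm (F.xi_L 1) hkL))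
  have hb' : s D * csc * (T.ξ 0 * k) ∈ L D 0 :=
    Lm (k := 1) (Lm s_L F.csc_pf.mem_L) (Lm (m := -1) (F.xi_L 0) hkL)
  have hd1c : d 1 csc = 0 := F.csc_pf.d1
  have hsn := F.sn_csc
  have hsB : ∀ {y : Fn D}, y ∈ B D 1 → sn * y ∈ B D 1 := fun hy => Bm F.sn_pf.mem hy
  -- The entries come from the cofactor inverse of the matrix of `m`, `mb`, divided by `r`; the
  -- `φ`-entries are also divided by `sin θ`.
  refine ⟨![s D * (T.ζ 1 * k), -(s D * csc * (T.ζ 0 * k))],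
    ![-(s D * (T.ξ 1 * k)), s D * csc * (T.ξ 0 * k)], ?_, ?_, ?_, ?_, ⟨?_, ?_⟩, ⟨?_, ?_⟩, ?_, ?_, ?_⟩
  · intro i; fin_cases i
    exacts [ha, ha']
  · intro i; fin_cases i
    exacts [hb, hb']
  · intro i; fin_cases i
    · simp [dr, Derivation.leibniz, dk, hz, hd1c, d1_s]; ring
    · simp [dr, Derivation.leibniz, dk, hz, hd1c, d1_s]; ring
  · intro i; fin_cases i
    · simp [dr, Derivation.leibniz, dk, hx, hd1c, d1_s]; ring
    · simp [dr, Derivation.leibniz, dk, hx, hd1c, d1_s]; ring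
  · change s D * (T.ζ 1 * k) - ca D ∈ _
    have e : s D * (T.ζ 1 * k) - ca D = -ca D * ((x 0 + cj (x 0)) * (s D * (T.ζ 1 * k))
        + sn * (x 1 + cj (x 1)) * -(s D * csc * (T.ζ 0 * k))) := by
      have h1 := hk
      rw [F.xi0, F.xi1] at h1
      have h2 : T.ζ 0 * (T.ζ 1 * k) - T.ζ 1 * (T.ζ 0 * k) = 0 := by ring
      nth_rewrite 1 [F.zeta0] at h2
      nth_rewrite 2 [F.zeta1] at h2
      linear_combination ca D * h1 + ca D * h2 - s D * T.ζ 1 * k * ca_sq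
        - ca D * s D * T.ζ 0 * k * (x 1 + cj (x 1)) * hsn
    rw [e]
    exact Bm (k := 0) (neg_mem ca_mem) (add_mem (Bm (k := 1) (l := 0) (m := 1) (add_mem (hxm 0) (hzm 0)) (LB ha (l := 0)))
      (Bm (k := 1) (l := 0) (m := 1) (hsB (add_mem (hxm 1) (hzm 1))) (LB ha' (l := 0))))
  · change -(s D * csc * (T.ζ 0 * k)) - cI D * ca D ∈ _
    have e : -(s D * csc * (T.ζ 0 * k)) - cI D * ca D
        = cI D * ca D * ((cj (x 0) - x 0) * (s D * (T.ζ 1 * k))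
        + sn * (cj (x 1) - x 1) * -(s D * csc * (T.ζ 0 * k))) := by
      have h1 := hk
      rw [F.xi0, F.xi1] at h1
      have h2 : T.ζ 0 * (T.ζ 1 * k) - T.ζ 1 * (T.ζ 0 * k) = 0 := by ring
      nth_rewrite 1 [F.zeta0] at h2
      nth_rewrite 2 [F.zeta1] at h2
      linear_combination cI D * ca D * (h1 - h2) - (s D * csc * (T.ζ 0 * k)) * (cI D ^ 2 * ca_sq + cI_sq)
        + cI D * ca D * s D * T.ζ 0 * k * (cj (x 1) - x 1) * hsn
    rw [e]
    exact Bm (k := 0) (Bm cI_mem ca_mem) (add_mem (Bm (k := 1) (l := 0) (m := 1) (sub_mem (hzm 0) (hxm 0)) (LB ha (l := 0)))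
      (Bm (k := 1) (l := 0) (m := 1) (hsB (sub_mem (hzm 1) (hxm 1))) (LB ha' (l := 0))))
  · change -(s D * (T.ξ 1 * k)) - ca D ∈ _
    have e : -(s D * (T.ξ 1 * k)) - ca D = -ca D * ((x 0 + cj (x 0)) * -(s D * (T.ξ 1 * k))
        + sn * (x 1 + cj (x 1)) * (s D * csc * (T.ξ 0 * k))) := by
      have h1 := hk
      rw [F.zeta0, F.zeta1] at h1
      have h2 : T.ξ 0 * (T.ξ 1 * k) - T.ξ 1 * (T.ξ 0 * k) = 0 := by ring
      nth_rewrite 1 [F.xi0] at h2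
      nth_rewrite 2 [F.xi1] at h2
      linear_combination ca D * (h1 - h2) + (s D * (T.ξ 1 * k)) * ca_sq
        + ca D * s D * T.ξ 0 * k * (x 1 + cj (x 1)) * hsn
    rw [e]
    exact Bm (k := 0) (neg_mem ca_mem) (add_mem (Bm (k := 1) (l := 0) (m := 1) (add_mem (hxm 0) (hzm 0)) (LB hb (l := 0)))
      (Bm (k := 1) (l := 0) (m := 1) (hsB (add_mem (hxm 1) (hzm 1))) (LB hb' (l := 0))))
  · change s D * csc * (T.ξ 0 * k) + cI D * ca D ∈ _
    have e : s D * csc * (T.ξ 0 * k) + cI D * ca D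
        = cI D * ca D * ((cj (x 0) - x 0) * -(s D * (T.ξ 1 * k))
        + sn * (cj (x 1) - x 1) * (s D * csc * (T.ξ 0 * k))) := by
      have h1 := hk
      rw [F.zeta0, F.zeta1] at h1
      have h2 : T.ξ 0 * (T.ξ 1 * k) - T.ξ 1 * (T.ξ 0 * k) = 0 := by ring
      nth_rewrite 1 [F.xi0] at h2
      nth_rewrite 2 [F.xi1] at h2
      linear_combination -cI D * ca D * (h1 + h2) + (s D * csc * (T.ξ 0 * k)) * (cI D ^ 2 * ca_sq + cI_sq)
        - cI D * ca D * s D * T.ξ 0 * k * (cj (x 1) - x 1) * hsn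
    rw [e]
    exact Bm (k := 0) (Bm cI_mem ca_mem) (add_mem (Bm (k := 1) (l := 0) (m := 1) (sub_mem (hzm 0) (hxm 0)) (LB hb (l := 0)))
      (Bm (k := 1) (l := 0) (m := 1) (hsB (sub_mem (hzm 1) (hxm 1))) (LB hb' (l := 0))))
  · simp only [Matrix.cons_val_zero, Matrix.cons_val_one, Matrix.cons_val_fin_one]
    linear_combination s D ^ 2 * (k ^ 2 * (T.ζ 1 ^ 2 * hm + T.ξ 1 ^ 2 * hmb - 2 * T.ξ 1 * T.ζ 1 * hmmb)
      - G.g 2 2 * ((T.ξ 0 * T.ζ 1 - T.ξ 1 * T.ζ 0) * k + 1) * hk)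
  · simp only [Matrix.cons_val_zero, Matrix.cons_val_one, Matrix.cons_val_fin_one]
    linear_combination s D ^ 2 * csc * (k ^ 2 * (-T.ζ 0 * T.ζ 1 * hm - T.ξ 0 * T.ξ 1 * hmb
      + (T.ξ 0 * T.ζ 1 + T.ξ 1 * T.ζ 0) * hmmb)
      - G.g 2 3 * ((T.ξ 0 * T.ζ 1 - T.ξ 1 * T.ζ 0) * k + 1) * hk)
  · simp only [Matrix.cons_val_zero, Matrix.cons_val_one, Matrix.cons_val_fin_one]
    linear_combination s D ^ 2 * csc ^ 2 * (k ^ 2 * (T.ζ 0 ^ 2 * hm + T.ξ 0 ^ 2 * hmb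
      - 2 * T.ξ 0 * T.ζ 0 * hmmb)
      - G.g 3 3 * ((T.ξ 0 * T.ζ 1 - T.ξ 1 * T.ζ 0) * k + 1) * hk)

end Tetrad.Flat
end BoostRot
end

/-! ### The expansion of the metric of the cuts -/

noncomputable section

namespace BoostRot

open Fn

namespace Fn

variable {D : Nbhd}

lemma dr_s_mul {f : Fn D} (hf : IsPf f) : dr (s D * f) = -f := by
  simp only [dr, Derivation.leibniz, d1_s, hf.d1, smul_eq_mul, mul_zero, zero_add]
  linear_combination (-f) * (r D * s D + 1) * rs

lemma dr_ofNat : dr (2 : Fn D) = 0 := by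
  rw [dr, ← one_add_one_eq_two, map_add, Derivation.map_one_eq_zero]; simp

lemma cj_lnr : cj (lnr D) = lnr D := ext_ev fun y hy => by
  rw [ev_cj _ hy, ev_lnr hy, Complex.conj_ofReal]

lemma IsPf.cj {f : Fn D} (hf : IsPf f) : IsPf (Fn.cj f) := by
  obtain ⟨c, hc, e⟩ := hf
  exact ⟨fun p => starRingEnd ℂ (c p), Complex.conjCLE.contDiff.comp_contDiffOn hc,
    fun x hx => by rw [ev_cj _ hx, e x hx]⟩

lemma dr_lnr : dr (lnr D) = r D := by
  rw [dr, d1_lnr, rs, mul_one]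

/-- Applied to `f₀ / r` the operator gives `-f₀`, and the rest of `f` contributes only at order
`r⁻¹`. -/
lemma dr_L_one {f : Fn D} (hf : f ∈ L D 1) : dr f ∈ L D 0 := by
  have h1 : r D * (r D * (d 1 f + (1 : ℤ) * (s D * f))) ∈ L D 0 :=
    BL (k := 1) (r_mul_mem (k := 2) (r_mul_mem (k := 3) hf.2))
  have h2 : r D * f ∈ L D 0 := Lr hf
  have : dr f = r D * (r D * (d 1 f + (1 : ℤ) * (s D * f))) - r D * f := by
    rw [dr]; push_cast; linear_combination (-r D * f) * rs
  rw [this]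
  exact sub_mem h1 h2

/-- `K`, `r² ∂_r K`, `(r² ∂_r)² K` have limits, and `(r² ∂_r)³ K` is `α ln r` up to a function
with a limit. -/
def Jet (K α : Fn D) : Prop :=
  K ∈ L D 0 ∧ dr K ∈ L D 0 ∧ dr (dr K) ∈ L D 0 ∧ dr (dr (dr K)) - lnr D * α ∈ L D 0

/-- Products agree at leading order if the factors do. -/
lemma mul_sub_mul_mem {f f' h h' : Fn D} (hf : f - f' ∈ B D 1) (hh : h - h' ∈ B D 1)
    (h0 : h ∈ B D 0) (h0' : f' ∈ B D 0) : f * h - f' * h' ∈ B D 1 := by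
  have : f * h - f' * h' = (f - f') * h + f' * (h - h') := by ring
  rw [this]
  exact add_mem (Bm (k := 1) (l := 0) hf h0) (Bm (k := 0) (l := 1) h0' hh)

/-- The leading terms of a quadratic expression in the coframe. -/
lemma jet_of_coframe {ε S Sb P Pb A Ab K A0 Ab0 K0 p4 p4b p5 p5b : Fn D}
    (hε : dr ε = ε * ε + S * Sb) (hS : dr S = 2 * (ε * S) + P) (hSb : dr Sb = 2 * (ε * Sb) + Pb)
    (hA : dr A = -(2 * (ε * A)) - Sb * K) (hAb : dr Ab = -(2 * (ε * Ab)) - S * K)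
    (hK : dr K = -(2 * (ε * K)) - 2 * (S * A) - 2 * (Sb * Ab))
    (Lε : ε ∈ L D 0) (LS : S ∈ L D 0) (LSb : Sb ∈ L D 0) (LP : P ∈ L D 0) (LPb : Pb ∈ L D 0)
    (LA : A ∈ L D 0) (LAb : Ab ∈ L D 0) (LK : K ∈ L D 0)
    (hA0 : A - A0 ∈ B D 1) (hAb0 : Ab - Ab0 ∈ B D 1) (hK0 : K - K0 ∈ B D 1)
    (hP : P - p4 ∈ B D 1) (hPb : Pb - p4b ∈ B D 1) (pf4 : IsPf p4) (pf4b : IsPf p4b)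
    (hP5 : dr P + p5 * lnr D ∈ L D 0) (hPb5 : dr Pb + p5b * lnr D ∈ L D 0)
    (pf5 : IsPf p5) (pf5b : IsPf p5b) :
    Jet K (2 * (p5 * A0) + 2 * (p5b * Ab0)) ∧
    dr K - (-(2 * (ε * K0)) - 2 * (S * A0) - 2 * (Sb * Ab0)) ∈ B D 1 ∧
    dr (dr K) - (2 * ((S * Sb - ε * ε) * K0)
      - 2 * (ε * (-(2 * (ε * K0)) - 2 * (S * A0) - 2 * (Sb * Ab0)))
      - 2 * (p4 * A0) - 2 * (p4b * Ab0)) ∈ B D 1 := by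
  -- All unknowns except the source `P` lie in the subring `LL`, because their derivatives are
  -- polynomials in each other and in `P`, which has no leading logarithm.
  have two : (2 : Fn D) ∈ LL D := by rw [← one_add_one_eq_two]; exact add_mem (Subring.one_mem _) (Subring.one_mem _)
  have mε : ε ∈ LL D := ⟨Lε, by rw [hε]; exact add_mem (Lm Lε Lε) (Lm LS LSb)⟩
  have mS : S ∈ LL D := ⟨LS, by rw [hS]; exact add_mem (Ln 2 (Lm Lε LS)) LP⟩
  have mSb : Sb ∈ LL D := ⟨LSb, by rw [hSb]; exact add_mem (Ln 2 (Lm Lε LSb)) LPb⟩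
  have mA : A ∈ LL D := ⟨LA, by rw [hA]; exact sub_mem (neg_mem (Ln 2 (Lm Lε LA))) (Lm LSb LK)⟩
  have mAb : Ab ∈ LL D := ⟨LAb, by rw [hAb]; exact sub_mem (neg_mem (Ln 2 (Lm Lε LAb))) (Lm LS LK)⟩
  have hT : dr K ∈ L D 0 := by
    rw [hK]
    exact sub_mem (sub_mem (neg_mem (Ln 2 (Lm Lε LK))) (Ln 2 (Lm LS LA))) (Ln 2 (Lm LSb LAb))
  have mK : K ∈ LL D := ⟨LK, hT⟩
  have mT : dr K ∈ LL D := by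
    rw [hK]
    exact sub_mem (sub_mem (neg_mem (mul_mem two (mul_mem mε mK))) (mul_mem two (mul_mem mS mA)))
      (mul_mem two (mul_mem mSb mAb))
  have hU : dr (dr K) = (2 * ((S * Sb - ε * ε) * K) - 2 * (ε * dr K))
      - (2 * (P * A) + 2 * (Pb * Ab)) := by
    conv_lhs => rw [hK]
    simp only [dr_sub, dr_neg, dr_mul, dr_ofNat, hε, hS, hSb, hA, hAb]
    ring
  -- The derivatives of `P` and `Pb` appear for the first time at third order. They are the only
  -- origin of a logarithm, and the factors `A`, `Ab` in front may be replaced by their leading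
  -- values.
  have hV : dr (dr (dr K)) = dr (2 * ((S * Sb - ε * ε) * K) - 2 * (ε * dr K))
      - (2 * (P * dr A) + 2 * (Pb * dr Ab)) - 2 * (A * dr P) - 2 * (Ab * dr Pb) := by
    conv_lhs => rw [hU]
    rw [dr_sub (f := 2 * ((S * Sb - ε * ε) * K) - 2 * (ε * dr K))]
    simp only [dr_add, dr_mul, dr_ofNat]
    ring
  have mW : 2 * ((S * Sb - ε * ε) * K) - 2 * (ε * dr K) ∈ LL D :=
    sub_mem (mul_mem two (mul_mem (sub_mem (mul_mem mS mSb) (mul_mem mε mε)) mK))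
      (mul_mem two (mul_mem mε mT))
  have bA0 : A0 ∈ B D 0 := by
    have := sub_mem (LB LA (l := 0)) (Bw hA0 (l := 0)); simpa using this
  have bAb0 : Ab0 ∈ B D 0 := by
    have := sub_mem (LB LAb (l := 0)) (Bw hAb0 (l := 0)); simpa using this
  have bK0 : K0 ∈ B D 0 := by
    have := sub_mem (LB LK (l := 0)) (Bw hK0 (l := 0)); simpa using this
  have hz : ∀ f : Fn D, f - f ∈ B D 1 := fun f => by rw [sub_self]; exact zero_mem _
  have cm : ∀ {f h h' : Fn D}, f ∈ L D 0 → h ∈ L D 0 → h - h' ∈ B D 1 →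
      2 * (f * h) - 2 * (f * h') ∈ B D 1 := fun {f h h'} hf hh e => by
    rw [← mul_sub]; exact Bnat 2 (mul_sub_mul_mem (hz f) e (LB hh) (LB hf))
  have hT0 : dr K - (-(2 * (ε * K0)) - 2 * (S * A0) - 2 * (Sb * Ab0)) ∈ B D 1 := by
    have := add_mem (add_mem (cm Lε LK hK0) (cm LS LA hA0)) (cm LSb LAb hAb0)
    rw [hK]
    convert neg_mem this using 1
    ring
  refine ⟨⟨LK, hT, mT.2, ?_⟩, hT0, ?_⟩
  · have e1 : A * (dr P + p5 * lnr D) ∈ L D 0 := Lm LA hP5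
    have e2 : Ab * (dr Pb + p5b * lnr D) ∈ L D 0 := Lm LAb hPb5
    have e3 : (A - A0) * (p5 * lnr D) ∈ L D 0 :=
      BL (k := 1) (Bm (k := 1) (l := 0) hA0 (Bm (k := 0) (l := 0) pf5.mem lnr_mem))
    have e4 : (Ab - Ab0) * (p5b * lnr D) ∈ L D 0 :=
      BL (k := 1) (Bm (k := 1) (l := 0) hAb0 (Bm (k := 0) (l := 0) pf5b.mem lnr_mem))
    have e5 : 2 * (P * dr A) + 2 * (Pb * dr Ab) ∈ L D 0 :=
      add_mem (Ln 2 (Lm LP mA.2)) (Ln 2 (Lm LPb mAb.2))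
    have := add_mem (sub_mem (sub_mem (sub_mem mW.2 e5) (Ln 2 e1)) (Ln 2 e2))
      (add_mem (Ln 2 e3) (Ln 2 e4))
    rw [hV]
    convert this using 1
    ring
  · have e1 := cm (sub_mem (Lm (m := 0) LS LSb) (Lm (m := 0) Lε Lε)) LK hK0
    have e2 := cm Lε hT hT0
    have e3 : 2 * (P * A - p4 * A0) ∈ B D 1 :=
      Bnat 2 (mul_sub_mul_mem hP hA0 (LB LA) pf4.mem)
    have e4 : 2 * (Pb * Ab - p4b * Ab0) ∈ B D 1 :=
      Bnat 2 (mul_sub_mul_mem hPb hAb0 (LB LAb) pf4b.mem)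
    rw [hU]
    convert sub_mem (sub_mem (sub_mem e1 e2) e3) e4 using 1
    ring

end Fn

variable {D : Nbhd} {G : Geo (Fn D)}

namespace Tetrad.Flat

variable {T : Tetrad G} {sn cs csc : Fn D} {x : Fin 2 → Fn D}
  (F : T.Flat sn cs csc x)
include F

/-- After rescaling by `r²` and removal of the Minkowski value `-1/r`, the equations for `ρ` and `σ`
form a Riccati system in `1/r` that is regular at infinity. -/
lemma dr_eps : dr (r D * (r D * (T.ρ + s D))) = r D * (r D * (T.ρ + s D)) * (r D * (r D * (T.ρ + s D)))
    + r D * (r D * T.σ) * (r D * (r D * T.σb)) := by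
  have h := T.d_rho
  rw [F.hd] at h
  simp only [dr, Derivation.leibniz, map_add, d1_r, d1_s, h, smul_eq_mul]
  linear_combination (-2 * r D ^ 3 * (T.ρ + s D)) * rs

lemma dr_shear : dr (r D * (r D * T.σ)) = 2 * (r D * (r D * (T.ρ + s D)) * (r D * (r D * T.σ)))
    + r D * (r D * (r D * (r D * T.Ψ0))) := by
  have h := T.d_sigma
  rw [F.hd] at h
  simp only [dr, Derivation.leibniz, map_add, d1_r, d1_s, h, smul_eq_mul]
  linear_combination (-2 * r D ^ 3 * T.σ) * rs

/-- In `z = 1/r` the rescaled scalar is `ψ4 - ψ5 z ln z` up to a term of order `z` without a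
logarithm, and differentiating once exposes `ln z`. -/
lemma Psi0_jet {ψ4 ψ5 : Fn D} (M : T.Minimal ψ4 ψ5) :
    r D * (r D * (r D * (r D * T.Ψ0))) ∈ L D 0 ∧
    r D * (r D * (r D * (r D * T.Ψ0))) - ψ4 ∈ B D 1 ∧
    dr (r D * (r D * (r D * (r D * T.Ψ0)))) + ψ5 * lnr D ∈ L D 0 := by
  obtain ⟨h5, h4⟩ := F.Psi0_L M
  refine ⟨Lr (k := 1) (Lr (k := 2) (Lr (k := 3) (Lr h4))), ?_, ?_⟩
  · have := r_mul_mem (l := 1) (r_mul_mem (l := 2) (r_mul_mem (l := 3) (r_mul_mem (l := 4) h5)))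
    convert this using 1
    linear_combination ψ4 * (r D * s D + 1) * ((r D * s D) ^ 2 + 1) * rs
  · have h := M.mem
    have hE := Lr (l := 1) (Lr (l := 2) (Lr (l := 3) (Lr (l := 4) h)))
    have e : r D * (r D * (r D * (r D * T.Ψ0))) = ψ4 + (s D * ψ5) * lnr D +
        r D * (r D * (r D * (r D * (T.Ψ0 - s D ^ 4 * ψ4 - s D ^ 5 * (ψ5 * lnr D))))) := by
      linear_combination (ψ4 + s D * ψ5 * lnr D) * (r D * s D + 1) * ((r D * s D) ^ 2 + 1) * rs
    have h0 : dr ψ4 = 0 := by simp [dr, M.pf4.d1]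
    rw [e, dr_add, dr_add, dr_mul, dr_s_mul M.pf5, h0, dr_lnr]
    convert add_mem (M.pf5.mem_L) (dr_L_one hE) using 1
    linear_combination ψ5 * rs

/-- The expansion of the metric of the cuts along the generators. -/
lemma metric_jets {ψ4 ψ5 : Fn D} (M : T.Minimal ψ4 ψ5) {K00 K01 K11 : Fn D}
    (h00 : K00 = -(s D * s D * G.g 2 2)) (h01 : K01 = -(s D * s D * csc * G.g 2 3))
    (h11 : K11 = -(s D * s D * csc * csc * G.g 3 3)) :
    (Jet K00 (ψ5 + cj ψ5) ∧ Jet K01 (cI D * (ψ5 - cj ψ5)) ∧ Jet K11 (-(ψ5 + cj ψ5))) ∧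
    2 * (dr (dr K00) - dr (dr K11)) - (dr K00 + dr K11) * (dr K00 - dr K11)
      + 4 * (ψ4 + cj ψ4) ∈ B D 1 ∧
    2 * dr (dr K01) - (dr K00 + dr K11) * dr K01 + 2 * (cI D * (ψ4 - cj ψ4)) ∈ B D 1 := by
  obtain ⟨a, b, La, Lb, da, db, ⟨a0, a1⟩, ⟨b0, b1⟩, e00, e01, e11⟩ := F.exists_coframe
  obtain ⟨LP, hP, hP5⟩ := F.Psi0_jet M
  rw [← e00] at h00
  rw [← e01] at h01
  rw [← e11] at h11
  obtain ⟨hsb, -⟩ := F.sigb_rho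
  have hε := F.dr_eps
  have hS := F.dr_shear
  have Lε : r D * (r D * (T.ρ + s D)) ∈ L D 0 := Lr (k := 1) (Lr F.rho_L)
  have LS : r D * (r D * T.σ) ∈ L D 0 := Lr (k := 1) (Lr F.sigma_L)
  have LSb : r D * (r D * T.σb) ∈ L D 0 := by
    rw [hsb]; exact Lr (k := 1) (Lr (L_cj F.sigma_L))
  have hcε : cj (r D * (r D * (T.ρ + s D))) = r D * (r D * (T.ρ + s D)) := by
    simp only [map_mul, map_add, cj_r, cj_s, ← F.sigb_rho.2]
  have hSb : dr (r D * (r D * T.σb)) = 2 * (r D * (r D * (T.ρ + s D)) * (r D * (r D * T.σb)))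
      + cj (r D * (r D * (r D * (r D * T.Ψ0)))) := by
    have := congrArg cj hS
    rw [← dr_cj] at this
    rw [map_add, map_mul cj 2, map_mul cj (r D * _), hcε] at this
    simpa only [map_mul, cj_r, hsb, map_ofNat] using this
  generalize hge : r D * (r D * (T.ρ + s D)) = ε at *
  generalize hgS : r D * (r D * T.σ) = S at *
  generalize hgSb : r D * (r D * T.σb) = Sb at *
  generalize hgP : r D * (r D * (r D * (r D * T.Ψ0))) = P at *
  have pf4b : IsPf (cj ψ4) := M.pf4.cj
  have pf5b : IsPf (cj ψ5) := M.pf5.cj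
  have hPb : cj P - cj ψ4 ∈ B D 1 := by rw [← map_sub]; exact B_cj hP
  have hPb5 : dr (cj P) + cj ψ5 * lnr D ∈ L D 0 := by
    have := L_cj hP5
    rw [map_add, map_mul, cj_lnr, ← dr_cj] at this
    exact this
  -- One application for each of the components `00`, `01`, `11`, with the quadratic expressions `a
  -- a`, `b b` and `a b + b a` as unknowns.
  have key : ∀ (i j : Fin 2) {ai aj bi bj : Fn D} (hai : a i - ai ∈ B D 1) (haj : a j - aj ∈ B D 1)
      (hbi : b i - bi ∈ B D 1) (hbj : b j - bj ∈ B D 1) (pi : ai ∈ B D 0) (qi : bi ∈ B D 0), _ :=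
    fun i j {ai aj bi bj} hai haj hbi hbj pi qi => jet_of_coframe (A := a i * a j) (Ab := b i * b j)
      (K := a i * b j + b i * a j) (A0 := ai * aj) (Ab0 := bi * bj) (K0 := ai * bj + bi * aj)
      hε hS hSb
      (by rw [dr_mul, da, da]; ring) (by rw [dr_mul, db, db]; ring)
      (by rw [dr_add, dr_mul, dr_mul, da, da, db, db]; ring) Lε LS LSb LP (L_cj LP)
      (Lm (La i) (La j)) (Lm (Lb i) (Lb j)) (add_mem (Lm (La i) (Lb j)) (Lm (Lb i) (La j)))
      (mul_sub_mul_mem hai haj (LB (La j)) pi) (mul_sub_mul_mem hbi hbj (LB (Lb j)) qi)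
      (by
        have := add_mem (mul_sub_mul_mem hai hbj (LB (Lb j)) pi)
          (mul_sub_mul_mem hbi haj (LB (La j)) qi)
        convert this using 1
        ring) hP hPb M.pf4 pf4b hP5 hPb5 M.pf5 pf5b
  have hca := ca_sq (D := D)
  have hcI := cI_sq (D := D)
  have b1' : b 1 - -(cI D * ca D) ∈ B D 1 := by rwa [sub_neg_eq_add]
  have mI : cI D * ca D ∈ B D 0 := Bm cI_mem ca_mem
  obtain ⟨J00, T00, U00⟩ := key 0 0 a0 a0 b0 b0 ca_mem ca_mem
  obtain ⟨J01, T01, U01⟩ := key 0 1 a0 a1 b0 b1' ca_mem ca_mem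
  obtain ⟨J11, T11, U11⟩ := key 1 1 a1 a1 b1' b1' mI (neg_mem mI)
  rw [← h00] at J00 T00 U00
  rw [← h01] at J01 T01 U01
  rw [← h11] at J11 T11 U11
  have k0 : ca D * ca D + ca D * ca D = 1 := by linear_combination hca
  have k1 : ca D * -(cI D * ca D) + ca D * (cI D * ca D) = 0 := by ring
  have k2 : cI D * ca D * -(cI D * ca D) + -(cI D * ca D) * (cI D * ca D) = 1 := by
    linear_combination (-cI D ^ 2) * hca - hcI
  have k3 : cI D * ca D * (cI D * ca D) = -(ca D * ca D) := by linear_combination ca D ^ 2 * hcI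
  rw [k0] at T00 U00
  rw [k1] at T01 U01
  rw [k2, neg_mul_neg, k3] at T11 U11
  -- The trace of the first derivative determines the expansion and its trace-free part the shear.
  -- Both can be eliminated from the second derivative, which isolates `Ψ₀^{4,0}` in the trace-free
  -- part.
  have hs : dr K00 + dr K11 - -(4 * (r D * (r D * (T.ρ + s D)))) ∈ B D 1 := by
    convert add_mem T00 T11 using 1
    rw [hge]; ring
  have hs0 : -(4 * (r D * (r D * (T.ρ + s D)))) ∈ B D 0 := by
    rw [hge]; exact neg_mem (Bnat 4 (LB Lε))
  have hd := sub_mem T00 T11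
  rw [sub_sub_sub_comm] at hd
  rw [hge] at hs hs0
  refine ⟨⟨?_, ?_, ?_⟩, ?_, ?_⟩
  · convert J00 using 1
    linear_combination (-(ψ5 + cj ψ5)) * hca
  · convert J01 using 1
    linear_combination (-cI D * (ψ5 - cj ψ5)) * hca
  · convert J11 using 1
    linear_combination (-(ψ5 + cj ψ5) * cI D ^ 2) * hca - (ψ5 + cj ψ5) * hcI
  · have e1 := mul_sub_mul_mem hs hd (LB (sub_mem J00.2.1 J11.2.1)) hs0
    convert sub_mem (Bnat 2 (sub_mem U00 U11)) e1 using 1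
    linear_combination (-4 * (ψ4 + cj ψ4)) * hca
  · have e1 := mul_sub_mul_mem hs T01 (LB J01.2.1) hs0
    convert sub_mem (Bnat 2 U01) e1 using 1
    linear_combination (-2 * cI D * (ψ4 - cj ψ4)) * hca

end Tetrad.Flat
end BoostRot
end

noncomputable section

namespace BoostRot

open Fn Filter

/-! ### Expansions along a generator -/

lemma tendsto_eval_log_div (P : Polynomial ℝ) :
    Tendsto (fun r : ℝ => P.eval (Real.log r) / r) atTop (𝓝 0) := by
  refine ((Polynomial.tendsto_div_exp_atTop P).comp Real.tendsto_log_atTop).congr' ?_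
  filter_upwards [eventually_gt_atTop 0] with r hr
  simp [Real.exp_log hr]

/-- The coefficients of an expansion in powers of `r` and `ln r` are unique. -/
lemma eq_zero_of_tendsto_log_sum (n : ℕ) (R : ℕ → Polynomial ℝ)
    (h : Tendsto (fun r : ℝ => ∑ k ∈ Finset.range (n + 1), r ^ (n - k) * (R k).eval (Real.log r))
      atTop (𝓝 0)) : ∀ k ≤ n, R k = 0 := by
  induction n with
  | zero =>
    intro k hk
    obtain rfl : k = 0 := by omega
    exact poly_log_eq_zero (by simpa using h)
  | succ n ih =>
    have h1 : ∀ k ≤ n, R k = 0 := by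
      -- Dividing by `r` reduces the degree by one, since the last summand then tends to zero.
      refine ih ?_
      have := (h.mul tendsto_inv_atTop_zero).sub (tendsto_eval_log_div (R (n + 1)))
      rw [mul_zero, sub_zero] at this
      refine this.congr' ?_
      filter_upwards [eventually_gt_atTop 0] with r hr
      rw [Finset.sum_range_succ, Nat.sub_self, pow_zero, one_mul, add_mul, ← div_eq_mul_inv _ r,
        ← div_eq_mul_inv _ r, add_sub_cancel_right, Finset.sum_div]
      refine Finset.sum_congr rfl fun k hk => ?_
      rw [Finset.mem_range] at hk
      rw [show n + 1 - k = n - k + 1 by omega, pow_succ]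
      field_simp
    intro k hk
    rcases Nat.lt_or_ge k (n + 1) with hk' | hk'
    · exact h1 k (by omega)
    obtain rfl : k = n + 1 := by omega
    refine poly_log_eq_zero (h.congr fun r => ?_)
    rw [Finset.sum_range_succ, Finset.sum_eq_zero]
    · simp
    · intro k hk
      rw [h1 k (by rw [Finset.mem_range] at hk; omega)]
      simp

section Jets

variable {f T U V : ℝ → ℝ} {f0 T0 U0 α β : ℝ}
  (hf : ∀ᶠ r in atTop, HasDerivAt f (T r / r ^ 2) r)
  (hT : ∀ᶠ r in atTop, HasDerivAt T (U r / r ^ 2) r)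
  (hU : ∀ᶠ r in atTop, HasDerivAt U (V r / r ^ 2) r)
  (lf : Tendsto f atTop (𝓝 f0)) (lT : Tendsto T atTop (𝓝 T0)) (lU : Tendsto U atTop (𝓝 U0))
  (lV : Tendsto (fun r => V r - α * Real.log r) atTop (𝓝 β))
include hf hT hU lf lT lU lV

/-- Three integrations along a generator. -/
lemma tendsto_of_jet : Tendsto (fun r => r ^ 3 * (f r - f0 + T0 * r⁻¹ - U0 / 2 * r⁻¹ ^ 2
    + α / 6 * (Real.log r * r⁻¹ ^ 3))) atTop (𝓝 (-(β + 11 * α / 6) / 6)) := by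
  have hi : ∀ r : ℝ, 0 < r → HasDerivAt (fun r => r⁻¹) (-(r ^ 2)⁻¹) r := fun r hr =>
    hasDerivAt_inv hr.ne'
  have hl : ∀ r : ℝ, 0 < r → HasDerivAt Real.log r⁻¹ r := fun r hr => Real.hasDerivAt_log hr.ne'
  have t1 := tendsto_inv_atTop_zero (𝕜 := ℝ)
  have tp : ∀ k : ℕ, Tendsto (fun r : ℝ => r⁻¹ ^ (k + 1)) atTop (𝓝 0) := fun k => by
    simpa using t1.pow (k + 1)
  have tl : ∀ k : ℕ, Tendsto (fun r : ℝ => Real.log r * r⁻¹ ^ (k + 1)) atTop (𝓝 0) := fun k => by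
    have h := (tendsto_eval_log_div Polynomial.X).mul (t1.pow k)
    rw [zero_mul] at h
    refine h.congr fun r => ?_
    rw [Polynomial.eval_X, pow_succ]
    ring
  -- the three remainders
  have l2 : Tendsto (fun r => (U r - U0 + α / 6 * (6 * (Real.log r * r⁻¹ ^ 1) - 5 * r⁻¹ ^ 1)) / r⁻¹)
      atTop (𝓝 (-(β + 11 * α / 6))) := by
    -- L'Hôpital's rule is applied to three successive remainders. In `z = 1/r` the threefold
    -- primitive of `ln z` is `z³ ln z / 6 - 11 z³ / 36`, which is where the number `11` comes from.
    refine HasDerivAt.lhopital_zero_atTop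
      (f' := fun r => (V r - α * Real.log r + 11 * α / 6) / r ^ 2) (g' := fun r => -(r ^ 2)⁻¹) ?_ ?_ ?_ ?_ t1 ?_
    · filter_upwards [hU, eventually_gt_atTop 0] with r h hr
      refine HasDerivAt.congr_deriv ((h.sub_const U0).add (((((hl r hr).mul ((hi r hr).pow 1)).const_mul 6).sub
        (((hi r hr).pow 1).const_mul 5)).const_mul (α / 6))) ?_
      simp only [pow_one, Nat.add_one_sub_one, Pi.pow_apply]
      field_simp
      ring
    · filter_upwards [eventually_gt_atTop 0] with r hr using hi r hr
    · filter_upwards [eventually_gt_atTop 0] with r hr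
      exact neg_ne_zero.mpr (inv_ne_zero (pow_pos hr 2).ne')
    · simpa using (lU.sub_const U0).add ((((tl 0).const_mul 6).sub ((tp 0).const_mul 5)).const_mul (α / 6))
    · refine (lV.add_const (11 * α / 6)).neg.congr' ?_
      filter_upwards [eventually_gt_atTop 0] with r hr
      field_simp
  have l1 : Tendsto (fun r => (T r - T0 + U0 * r⁻¹ ^ 1 + α / 6 * (r⁻¹ ^ 2 - 3 * (Real.log r * r⁻¹ ^ 2)))
      / r⁻¹ ^ 2) atTop (𝓝 ((β + 11 * α / 6) / 2)) := by
    refine HasDerivAt.lhopital_zero_atTop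
      (f' := fun r => (U r - U0 + α / 6 * (6 * (Real.log r * r⁻¹ ^ 1) - 5 * r⁻¹ ^ 1)) / r ^ 2)
      (g' := fun r => -(2 * (r ^ 3)⁻¹)) ?_ ?_ ?_ ?_ (tp 1) ?_
    · filter_upwards [hT, eventually_gt_atTop 0] with r h hr
      refine HasDerivAt.congr_deriv (((h.sub_const T0).add (((hi r hr).pow 1).const_mul U0)).add ((((hi r hr).pow 2).sub
        (((hl r hr).mul ((hi r hr).pow 2)).const_mul 3)).const_mul (α / 6))) ?_
      simp only [pow_one, Nat.add_one_sub_one, Pi.pow_apply]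
      field_simp
      ring
    · filter_upwards [eventually_gt_atTop 0] with r hr
      refine ((hi r hr).pow 2).congr_deriv ?_
      field_simp
      norm_num
      field_simp
    · filter_upwards [eventually_gt_atTop 0] with r hr
      have := (pow_pos hr 3).ne'
      simp [hr.ne']
    · simpa using ((lT.sub_const T0).add ((tp 0).const_mul U0)).add
        (((tp 1).sub ((tl 1).const_mul 3)).const_mul (α / 6))
    · have := l2.const_mul (-1 / 2)
      rw [show -1 / 2 * (-(β + 11 * α / 6)) = (β + 11 * α / 6) / 2 by ring] at this
      refine this.congr' ?_
      filter_upwards [eventually_gt_atTop 0] with r hr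
      field_simp
  have l0 : Tendsto (fun r => (f r - f0 + T0 * r⁻¹ ^ 1 - U0 / 2 * r⁻¹ ^ 2
      + α / 6 * (Real.log r * r⁻¹ ^ 3)) / r⁻¹ ^ 3) atTop (𝓝 (-(β + 11 * α / 6) / 6)) := by
    refine HasDerivAt.lhopital_zero_atTop
      (f' := fun r => (T r - T0 + U0 * r⁻¹ ^ 1 + α / 6 * (r⁻¹ ^ 2 - 3 * (Real.log r * r⁻¹ ^ 2))) / r ^ 2)
      (g' := fun r => -(3 * (r ^ 4)⁻¹)) ?_ ?_ ?_ ?_ (tp 2) ?_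
    · filter_upwards [hf, eventually_gt_atTop 0] with r h hr
      refine HasDerivAt.congr_deriv ((((h.sub_const f0).add (((hi r hr).pow 1).const_mul T0)).sub
        (((hi r hr).pow 2).const_mul (U0 / 2))).add
        (((hl r hr).mul ((hi r hr).pow 3)).const_mul (α / 6))) ?_
      simp only [pow_one, Nat.add_one_sub_one, Pi.pow_apply]
      field_simp
      ring
    · filter_upwards [eventually_gt_atTop 0] with r hr
      refine ((hi r hr).pow 3).congr_deriv ?_
      field_simp
      norm_num
      field_simp
    · filter_upwards [eventually_gt_atTop 0] with r hr
      simp [hr.ne']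
    · simpa using (((lf.sub_const f0).add ((tp 0).const_mul T0)).sub ((tp 1).const_mul (U0 / 2))).add
        ((tl 2).const_mul (α / 6))
    · have := l1.const_mul (-1 / 3)
      rw [show -1 / 3 * ((β + 11 * α / 6) / 2) = -(β + 11 * α / 6) / 6 by ring] at this
      refine this.congr' ?_
      filter_upwards [eventually_gt_atTop 0] with r hr
      field_simp
  refine l0.congr' ?_
  filter_upwards [eventually_gt_atTop 0] with r hr
  rw [pow_one, inv_pow r 3, div_inv_eq_mul, mul_comm]

/-- The limits are read off from an expansion in powers of `r` and `ln r`. -/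
lemma coeff_of_jet {P : ℕ → Polynomial ℝ}
    (hP : Tendsto (fun r => r ^ 3 * (f r - ∑ k ∈ Finset.range 4, r⁻¹ ^ k * (P k).eval (Real.log r)))
      atTop (𝓝 0)) :
    T0 = -(P 1).coeff 0 ∧ U0 = 2 * (P 2).coeff 0 ∧ α = -6 * (P 3).coeff 1 := by
  have h := (tendsto_of_jet hf hT hU lf lT lU lV).sub hP
  open Polynomial in
  -- The expansion found by integration and the given one differ by `o(r⁻³)`, so they agree
  -- coefficient by coefficient.
  have hz := eq_zero_of_tendsto_log_sum 3
    (fun k => P k - if k = 0 then C f0 else if k = 1 then C (-T0) else if k = 2 then C (U0 / 2) else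
      C (-(α / 6)) * X + C (-(β + 11 * α / 6) / 6)) (by
    have h' := h.sub_const (-(β + 11 * α / 6) / 6)
    rw [sub_zero, sub_self] at h'
    refine h'.congr' ?_
    filter_upwards [eventually_gt_atTop 0] with r hr
    simp [Finset.sum_range_succ]
    field_simp
    ring)
  have h1 := congrArg (fun p => p.coeff 0) (hz 1 (by norm_num))
  have h2 := congrArg (fun p => p.coeff 0) (hz 2 (by norm_num))
  have h3 := congrArg (fun p => p.coeff 1) (hz 3 (by norm_num))
  simp [Polynomial.coeff_C] at h1 h2 h3
  exact ⟨by linarith, by linarith, by linarith⟩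

end Jets

namespace Fn

variable {D : Nbhd}

/-- At order zero the condition makes the derivative `O(r^{-3/2})`, which is integrable, so the
values along the generator form a Cauchy net. -/
lemma tendsto_of_L {f : Fn D} (h : f ∈ L D 0) {p : Scri} (hp : p ∈ D.scri) :
    ∃ ℓ, Tendsto (fun r => f.ev (pt p r)) atTop (𝓝 ℓ) := by
  have h2 : d 1 f ∈ B D (1 + 1) := by simpa using h.2
  obtain ⟨R, C, hR, hC, hd, hb⟩ := ray_bound (k := 1) (h2 0) (K := {p}) (by simpa using hp)
    isCompact_singleton (a := 1 / 2) (by norm_num)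
  refine cauchySeq_tendsto_of_complete (Metric.cauchySeq_iff'.2 fun e he => ?_)
  have h0 : Tendsto (fun r : ℝ => C / (1 / 2) * r ^ (-(1 / 2) : ℝ)) atTop (𝓝 0) := by
    simpa using (tendsto_rpow_neg_atTop (show (0 : ℝ) < 1 / 2 by norm_num)).const_mul (C / (1 / 2))
  obtain ⟨N, hN, hNR⟩ := ((h0.eventually_lt_const he).and (eventually_ge_atTop R)).exists
  refine ⟨N, fun n hn => ?_⟩
  rw [dist_eq_norm]
  refine lt_of_le_of_lt (norm_sub_le_rpow (a := 1 / 2) (C := C) (zero_lt_one.trans hR) (by norm_num)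
    (fun s hs => hasDerivAt_ray f (hd p rfl s hs)) (fun s hs => hb p rfl s hs) hNR hn) (lt_of_le_of_lt ?_ hN)
  refine mul_le_mul_of_nonneg_left ?_ (by positivity)
  have : 0 ≤ n ^ (-(1 / 2) : ℝ) := Real.rpow_nonneg (by linarith) _
  linarith

end Fn

end BoostRot
end

noncomputable section

namespace BoostRot

open Fn Filter

namespace Fn

variable {D : Nbhd}

lemma ev_dr (f : Fn D) {p : Scri} {t : ℝ} (hx : pt p t ∈ D.dom) :
    (dr f).ev (pt p t) = ((t ^ 2 : ℝ) : ℂ) * (d 1 f).ev (pt p t) := by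
  rw [dr, ev_mul _ _ hx, ev_mul _ _ hx, r, ev_rz _ hx]
  simp [pt]
  ring

lemma im_ev_of_cj {f : Fn D} (hf : cj f = f) {x : Pt} (hx : x ∈ D.dom) : (f.ev x).im = 0 := by
  have h := ev_cj f hx
  rw [hf] at h
  exact Complex.conj_eq_iff_im.1 h.symm

lemma hasDerivAt_re (f : Fn D) {p : Scri} {t : ℝ} (hx : pt p t ∈ D.dom) :
    HasDerivAt (fun s => (f.ev (pt p s)).re) (((dr f).ev (pt p t)).re / t ^ 2) t := by
  have h := Complex.reCLM.hasFDerivAt.comp_hasDerivAt t (hasDerivAt_ray f hx)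
  refine h.congr_deriv ?_
  have ht : (t ^ 2) ≠ 0 := pow_ne_zero 2 (r_pos hx).ne'
  rw [ev_dr f hx, Complex.re_ofReal_mul, mul_div_cancel_left₀ _ ht, Complex.reCLM_apply]

/-- The jet of a function is read off from an expansion along a generator. -/
lemma Jet.limits {K α : Fn D} (hJ : Jet K α) (hK : cj K = K) {p : Scri} (hp : p ∈ D.scri) {A : ℂ}
    (hα : ∀ t, pt p t ∈ D.dom → α.ev (pt p t) = A) {P : ℕ → Polynomial ℝ}
    (hP : Tendsto (fun t => t ^ 3 * ((K.ev (pt p t)).re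
      - ∑ k ∈ Finset.range 4, t⁻¹ ^ k * (P k).eval (Real.log t))) atTop (𝓝 0)) :
    Tendsto (fun t => (dr K).ev (pt p t)) atTop (𝓝 ((-(P 1).coeff 0 : ℝ) : ℂ)) ∧
    Tendsto (fun t => (dr (dr K)).ev (pt p t)) atTop (𝓝 ((2 * (P 2).coeff 0 : ℝ) : ℂ)) ∧
    A.re = -6 * (P 3).coeff 1 := by
  obtain ⟨l0, h0⟩ := tendsto_of_L hJ.1 hp
  obtain ⟨l1, h1⟩ := tendsto_of_L hJ.2.1 hp
  obtain ⟨l2, h2⟩ := tendsto_of_L hJ.2.2.1 hp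
  obtain ⟨l3, h3⟩ := tendsto_of_L hJ.2.2.2 hp
  have hr : ∀ {u : ℝ → ℂ} {l : ℂ}, Tendsto u atTop (𝓝 l) →
      Tendsto (fun t => (u t).re) atTop (𝓝 l.re) := fun h => (Complex.continuous_re.tendsto _).comp h
  have hdK : cj (dr K) = dr K := by rw [← dr_cj, hK]
  have hdd : cj (dr (dr K)) = dr (dr K) := by rw [← dr_cj, hdK]
  -- The given expansion is one of the real part. As the functions are real, so are their limits,
  -- and nothing is lost.
  have hreal : ∀ {f : Fn D} {l : ℂ}, cj f = f → Tendsto (fun t => f.ev (pt p t)) atTop (𝓝 l) →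
      l = (l.re : ℂ) := fun {f l} hf h => by
    have h' : Tendsto (fun t => (f.ev (pt p t)).im) atTop (𝓝 l.im) :=
      (Complex.continuous_im.tendsto _).comp h
    have h'' : Tendsto (fun t => (f.ev (pt p t)).im) atTop (𝓝 0) := by
      refine tendsto_const_nhds.congr' ?_
      filter_upwards [eventually_ray D hp] with t hx using (im_ev_of_cj hf hx).symm
    exact Complex.ext rfl (by simpa using tendsto_nhds_unique h' h'')
  have hdom := eventually_ray D hp
  have hV : Tendsto (fun t => ((dr (dr (dr K))).ev (pt p t)).re - A.re * Real.log t) atTop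
      (𝓝 l3.re) := by
    refine (hr h3).congr' ?_
    filter_upwards [hdom] with t hx
    rw [ev_sub _ _ hx, ev_mul _ _ hx, ev_lnr hx, hα t hx, Complex.sub_re, Complex.re_ofReal_mul,
      mul_comm A.re]
    simp [pt]
  obtain ⟨e1, e2, e3⟩ := coeff_of_jet (hdom.mono fun t hx => hasDerivAt_re K hx)
    (hdom.mono fun t hx => hasDerivAt_re (dr K) hx)
    (hdom.mono fun t hx => hasDerivAt_re (dr (dr K)) hx) (hr h0) (hr h1) (hr h2) hV hP
  rw [hreal hdK h1, e1] at h1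
  rw [hreal hdd h2, e2] at h2
  exact ⟨h1, h2, e3⟩

end Fn

/-! ### Expansions of the metric in Cartesian coordinates -/

/-- The coefficient of `r⁻ᵏ` in an expansion, as a polynomial in `ln r`. -/
def logPoly {P : Type*} (N : ℤ → ℕ) (c : ℤ → ℕ → P → ℝ) (q : P) (k : ℕ) : Polynomial ℝ :=
  ∑ j ∈ Finset.range (N k + 1), Polynomial.monomial j (c k j q)

lemma coeff_logPoly {P : Type*} (N : ℤ → ℕ) (c : ℤ → ℕ → P → ℝ) (q : P) (k j : ℕ) :
    (logPoly N c q k).coeff j = if j ∈ Finset.range (N k + 1) then c k j q else 0 := by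
  simp only [logPoly, Polynomial.finsetSum_coeff, Polynomial.coeff_monomial, Finset.sum_ite_eq']

section

variable {P : Type*} [NormedAddCommGroup P] [NormedSpace ℝ P] {S : Set P} {h : P → ℝ → ℝ}
  {N : ℤ → ℕ} {c : ℤ → ℕ → P → ℝ} (H : HasPolyExpansion S h 0 N c)
include H

lemma HasPolyExpansion.tendsto_sub_logPoly {q : P} (hq : q ∈ S) :
    Tendsto (fun t => t ^ 3 * (h q t
      - ∑ k ∈ Finset.range 4, t⁻¹ ^ k * (logPoly N c q k).eval (Real.log t))) atTop (𝓝 0) := by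
  rw [Metric.tendsto_atTop]
  intro e he
  obtain ⟨R, hR⟩ := H.remainder {q} (by simpa using hq) isCompact_singleton 3 0 0 (e / 2) (by linarith)
  refine ⟨max R 0 + 1, fun t ht => ?_⟩
  have h0 : 0 < t := by linarith [le_max_right R 0]
  have h1 := hR q rfl t (by linarith [le_max_left R 0])
  rw [norm_iteratedFDeriv_zero, iteratedDeriv_zero] at h1
  have h2 : polySum 0 N c 3 q t
      = ∑ k ∈ Finset.range 4, t⁻¹ ^ k * (logPoly N c q k).eval (Real.log t) := by
    rw [polySum, show Finset.Icc (0 : ℤ) 3 = (Finset.range 4).map Nat.castEmbedding by decide,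
      Finset.sum_map]
    refine Finset.sum_congr rfl fun k _ => ?_
    rw [logPoly, Polynomial.eval_finsetSum, Finset.mul_sum]
    refine Finset.sum_congr rfl fun j _ => ?_
    simp only [Nat.castEmbedding_apply, Polynomial.eval_monomial, smul_eq_mul, zpow_neg,
      zpow_natCast, inv_pow]
    ring
  rw [h2] at h1
  rw [dist_zero_right, norm_mul, Real.norm_of_nonneg (pow_pos h0 3).le]
  have h3 : t ^ 3 * t ^ (-3 - ((0 : ℕ) : ℤ)) = 1 := by
    rw [← zpow_natCast, ← zpow_add₀ h0.ne']; norm_num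
  calc _ ≤ t ^ 3 * (e / 2 * t ^ (-3 - ((0 : ℕ) : ℤ))) := mul_le_mul_of_nonneg_left h1 (pow_pos h0 3).le
    _ = e / 2 := by rw [mul_left_comm, h3, mul_one]
    _ < e := by linarith

lemma HasPolyExpansion.continuousOn_coeff_logPoly {γ : ℝ → P} {I : Set ℝ} (hγ : ContinuousOn γ I)
    (hI : ∀ x ∈ I, γ x ∈ S) (k j : ℕ) : ContinuousOn (fun x => (logPoly N c (γ x) k).coeff j) I := by
  simp only [coeff_logPoly]
  split_ifs with hj
  · exact (H.coeff_smooth k (by positivity) j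
      (Nat.lt_succ_iff.1 (Finset.mem_range.1 hj))).continuousOn.comp hγ hI
  · exact continuousOn_const

end

lemma tendsto_sum_sub_logPoly {ι : Type*} (s : Finset ι) (a : ι → ℝ) (h : ι → ℝ → ℝ)
    (P : ι → ℕ → Polynomial ℝ)
    (hP : ∀ i, Tendsto (fun t => t ^ 3 * (h i t
      - ∑ k ∈ Finset.range 4, t⁻¹ ^ k * (P i k).eval (Real.log t))) atTop (𝓝 0)) :
    Tendsto (fun t => t ^ 3 * (∑ i ∈ s, a i * h i t
      - ∑ k ∈ Finset.range 4, t⁻¹ ^ k * (∑ i ∈ s, Polynomial.C (a i) * P i k).eval (Real.log t)))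
      atTop (𝓝 0) := by
  have := tendsto_finsetSum s fun i _ => (hP i).const_mul (a i)
  simp only [mul_zero, Finset.sum_const_zero] at this
  refine this.congr fun t => ?_
  simp only [Finset.sum_range_succ, Finset.sum_range_zero, Polynomial.eval_finsetSum,
    Polynomial.eval_mul, Polynomial.eval_C, zero_add, Finset.mul_sum, ← Finset.sum_add_distrib,
    ← Finset.sum_sub_distrib]
  refine Finset.sum_congr rfl fun i _ => ?_
  ring

/-- The unit vectors along `∂_θ` and `∂_φ` in Cartesian coordinates. -/
def sphDir (p : Scri) : Fin 2 → Fin 4 → ℝ :=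
  ![![0, Real.cos (p 1) * Real.cos (p 2), Real.cos (p 1) * Real.sin (p 2), -Real.sin (p 1)],
    ![0, -Real.sin (p 2), Real.cos (p 2), 0]]

lemma sphJac_two (p : Scri) (t : ℝ) (μ : Fin 4) :
    NullChart.sphJac p t μ 2 = t * sphDir p 0 μ := by
  fin_cases μ <;> simp [NullChart.sphJac, sphDir]

lemma sphJac_three (p : Scri) (t : ℝ) (μ : Fin 4) :
    NullChart.sphJac p t μ 3 = t * Real.sin (p 1) * sphDir p 1 μ := by
  fin_cases μ <;> simp [NullChart.sphJac, sphDir] <;> ring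

end BoostRot
end

/-! ### Null infinity with complete spherical cuts -/

noncomputable section

namespace BoostRot

open Fn Filter

namespace NullChart

variable (M : NullChart) (hM : M.IsNullChart)

/-- The point with polar angle `θ` on the cut `u`, at longitude zero. -/
def meridian (u θ : ℝ) : Scri := ![u, θ, 0]

lemma continuous_sphPt_meridian (u : ℝ) : Continuous fun θ => sphPt (meridian u θ) := by
  refine continuous_pi fun i => ?_
  fin_cases i <;> simp [sphPt, meridian] <;> fun_prop

lemma continuous_sphDir_meridian (u : ℝ) (i : Fin 2) (μ : Fin 4) :
    Continuous fun θ => sphDir (meridian u θ) i μ := by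
  fin_cases i <;> fin_cases μ <;> simp [sphDir, meridian] <;> fun_prop

section expansion

variable {H : Fin 4 → Fin 4 → (Fin 4 → ℝ) → ℝ → ℝ} {N : Fin 4 → Fin 4 → ℤ → ℕ}
  {c : Fin 4 → Fin 4 → ℤ → ℕ → (Fin 4 → ℝ) → ℝ} {S : Set (Fin 4 → ℝ)}
  (hH : ∀ μ ν, HasPolyExpansion S (H μ ν) 0 (N μ ν) (c μ ν))

/-- The expansion of a component of the metric of the cuts, along a meridian. -/
def cutPoly (N : Fin 4 → Fin 4 → ℤ → ℕ) (c : Fin 4 → Fin 4 → ℤ → ℕ → (Fin 4 → ℝ) → ℝ) (u : ℝ)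
    (i j : Fin 2) (θ : ℝ) (k : ℕ) : Polynomial ℝ :=
  ∑ μν : Fin 4 × Fin 4,
    Polynomial.C (-(sphDir (meridian u θ) i μν.1 * sphDir (meridian u θ) j μν.2)) *
      logPoly (N μν.1 μν.2) (c μν.1 μν.2) (sphPt (meridian u θ)) k

include hH

/-- The Cartesian coefficients are smooth across the poles, and along a fixed meridian the unit
vectors in the directions of `θ` and `φ` extend continuously to the poles. The interval may
therefore be closed. -/
lemma continuousOn_cutPoly {u : ℝ} {I : Set ℝ} (hI : ∀ θ ∈ I, sphPt (meridian u θ) ∈ S)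
    (i j : Fin 2) (k m : ℕ) : ContinuousOn (fun θ => (cutPoly N c u i j θ k).coeff m) I := by
  simp only [cutPoly, Polynomial.finsetSum_coeff, Polynomial.coeff_C_mul]
  refine continuousOn_finsetSum _ fun μν _ => ContinuousOn.mul ?_ ?_
  · exact ((continuous_sphDir_meridian u i _).mul (continuous_sphDir_meridian u j _)).neg.continuousOn
  · exact (hH _ _).continuousOn_coeff_logPoly (continuous_sphPt_meridian u).continuousOn hI k m

/-- The frame vectors do not depend on `r`, so the expansion of a cut component is the corresponding
linear combination of the Cartesian expansions. -/
lemma tendsto_cutPoly {u θ : ℝ} (hθ : sphPt (meridian u θ) ∈ S) (i j : Fin 2) {K : ℝ → ℝ}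
    (hK : ∀ᶠ t in atTop, K t = -∑ μ, ∑ ν, sphDir (meridian u θ) i μ * sphDir (meridian u θ) j ν
      * H μ ν (sphPt (meridian u θ)) t) :
    Tendsto (fun t => t ^ 3 * (K t
      - ∑ k ∈ Finset.range 4, t⁻¹ ^ k * (cutPoly N c u i j θ k).eval (Real.log t))) atTop (𝓝 0) := by
  have h := tendsto_sum_sub_logPoly Finset.univ
    (fun μν : Fin 4 × Fin 4 => -(sphDir (meridian u θ) i μν.1 * sphDir (meridian u θ) j μν.2))
    (fun μν t => H μν.1 μν.2 (sphPt (meridian u θ)) t)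
    (fun μν k => logPoly (N μν.1 μν.2) (c μν.1 μν.2) (sphPt (meridian u θ)) k)
    fun μν => (hH μν.1 μν.2).tendsto_sub_logPoly hθ
  refine h.congr' ?_
  filter_upwards [hK] with t ht
  rw [ht, Fintype.sum_prod_type]
  simp only [neg_mul, Finset.sum_neg_distrib]
  rfl

end expansion

/-- The coefficient `Ψ₀^{4,0}` in terms of the expansion of the metric of the cuts. -/
def cutWeyl₄ (P : Fin 2 → Fin 2 → ℕ → Polynomial ℝ) : ℂ :=
  ((((P 0 0 1).coeff 0 + (P 1 1 1).coeff 0) * ((P 0 0 1).coeff 0 - (P 1 1 1).coeff 0)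
    - 4 * ((P 0 0 2).coeff 0 - (P 1 1 2).coeff 0)) / 8 : ℝ)
  + ((4 * (P 0 1 2).coeff 0 - ((P 0 0 1).coeff 0 + (P 1 1 1).coeff 0) * (P 0 1 1).coeff 0) / 4 : ℝ)
    * Complex.I

/-- The coefficient `Ψ₀^{5,1}` in terms of the expansion of the metric of the cuts. -/
def cutWeyl₅ (P : Fin 2 → Fin 2 → ℕ → Polynomial ℝ) : ℂ :=
  (-3 * (P 0 0 3).coeff 1 : ℝ) + (3 * (P 0 1 3).coeff 1 : ℝ) * Complex.I

section continuity

variable {P : ℝ → Fin 2 → Fin 2 → ℕ → Polynomial ℝ} {I : Set ℝ}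
  (hc : ∀ i j k m, ContinuousOn (fun θ => (P θ i j k).coeff m) I)
include hc

lemma continuousOn_cutWeyl₄ : ContinuousOn (fun θ => cutWeyl₄ (P θ)) I := by
  have hs := (hc 0 0 1 0).add (hc 1 1 1 0)
  refine (Complex.continuous_ofReal.comp_continuousOn (ContinuousOn.div_const ?_ 8)).add
    ((Complex.continuous_ofReal.comp_continuousOn (ContinuousOn.div_const ?_ 4)).mul
      continuousOn_const)
  · exact (hs.mul ((hc 0 0 1 0).sub (hc 1 1 1 0))).sub
      (continuousOn_const.mul ((hc 0 0 2 0).sub (hc 1 1 2 0)))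
  · exact (continuousOn_const.mul (hc 0 1 2 0)).sub (hs.mul (hc 0 1 1 0))

lemma continuousOn_cutWeyl₅ : ContinuousOn (fun θ => cutWeyl₅ (P θ)) I :=
  (Complex.continuous_ofReal.comp_continuousOn (continuousOn_const.mul (hc 0 0 3 1))).add
    ((Complex.continuous_ofReal.comp_continuousOn (continuousOn_const.mul (hc 0 1 3 1))).mul
      continuousOn_const)

end continuity

/-- The components of the metric of the cuts along `r⁻¹ ∂_θ` and `(r sin θ)⁻¹ ∂_φ`. -/
lemma cut_component {p : Scri} (hp : Real.sin (p 1) ≠ 0) {t : ℝ} (ht : t ≠ 0)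
    {H : Fin 4 → Fin 4 → ℝ}
    (hg : ∀ a b, M.g (pt p t) a b = ∑ μ, ∑ ν, sphJac p t μ a * sphJac p t ν b * H μ ν)
    (i j : Fin 2) : (t⁻¹ * (![1, (Real.sin (p 1))⁻¹] : Fin 2 → ℝ) i)
        * (t⁻¹ * (![1, (Real.sin (p 1))⁻¹] : Fin 2 → ℝ) j) * M.g (pt p t) (![2, 3] i) (![2, 3] j)
      = ∑ μ, ∑ ν, sphDir p i μ * sphDir p j ν * H μ ν := by
  have hJ : ∀ (i : Fin 2) (μ : Fin 4), (t⁻¹ * (![1, (Real.sin (p 1))⁻¹] : Fin 2 → ℝ) i)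
      * sphJac p t μ (![2, 3] i) = sphDir p i μ := by
    intro i μ
    fin_cases i
    · change (t⁻¹ * 1) * sphJac p t μ 2 = sphDir p 0 μ
      rw [sphJac_two]
      field_simp
    · change (t⁻¹ * (Real.sin (p 1))⁻¹) * sphJac p t μ 3 = sphDir p 1 μ
      rw [sphJac_three]
      field_simp
  rw [hg, Finset.mul_sum]
  refine Finset.sum_congr rfl fun μ _ => ?_
  rw [Finset.mul_sum]
  refine Finset.sum_congr rfl fun ν _ => ?_
  rw [← hJ i μ, ← hJ j ν]
  ring

include hM in
/-- The coefficients of `Ψ₀` are read off from the expansion of the metric of the cuts. -/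
lemma coefficients_of_cut (hvac : M.IsVacuum) (hflat : M.IsPolyhomogeneousFlat)
    (hax : M.IsAxisymmetric) {ψ : ℤ → ℕ → Scri → ℂ} (hψ : M.HasMinimalPsi0 ψ) {p : Scri}
    (hp : p ∈ M.scri) {P : Fin 2 → Fin 2 → ℕ → Polynomial ℝ}
    (hP : ∀ i j, Tendsto (fun t => t ^ 3 * (-((t⁻¹ * (![1, (Real.sin (p 1))⁻¹] : Fin 2 → ℝ) i)
        * (t⁻¹ * (![1, (Real.sin (p 1))⁻¹] : Fin 2 → ℝ) j) * M.g (pt p t) (![2, 3] i) (![2, 3] j))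
      - ∑ k ∈ Finset.range 4, t⁻¹ ^ k * (P i j k).eval (Real.log t))) atTop (𝓝 0)) :
    ψ 4 0 p = cutWeyl₄ P ∧ ψ 5 1 p = cutWeyl₅ P := by
  have F := M.flat hM hvac hflat hax hψ
  have hmin := (M.minimal hM hvac hψ).1
  obtain ⟨N', n4, n5, -, hexp⟩ := hψ
  obtain ⟨K00, hK00⟩ : ∃ K, K = -(s (M.nbhd hM) * s _ * (M.geo hM).g 2 2) := ⟨_, rfl⟩
  obtain ⟨K01, hK01⟩ : ∃ K, K = -(s (M.nbhd hM) * s _ * M.cscF hM * (M.geo hM).g 2 3) := ⟨_, rfl⟩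
  obtain ⟨K11, hK11⟩ : ∃ K, K = -(s (M.nbhd hM) * s _ * M.cscF hM * M.cscF hM * (M.geo hM).g 3 3) :=
    ⟨_, rfl⟩
  obtain ⟨⟨J00, J01, J11⟩, E1, E2⟩ := F.metric_jets hmin hK00 hK01 hK11
  have rg : ∀ a b, cj ((M.geo hM).g a b) = (M.geo hM).g a b := fun a b => cj_ofR _
  have rc := F.csc_real
  have r00 : cj K00 = K00 := by rw [hK00]; simp only [map_neg, map_mul, cj_s, rg]
  have r01 : cj K01 = K01 := by rw [hK01]; simp only [map_neg, map_mul, cj_s, rg, rc]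
  have r11 : cj K11 = K11 := by rw [hK11]; simp only [map_neg, map_mul, cj_s, rg, rc]
  have hdom := eventually_ray (M.nbhd hM) hp
  have evg : ∀ a b t, pt p t ∈ (M.nbhd hM).dom →
      ((M.geo hM).g a b).ev (pt p t) = M.g (pt p t) a b := fun a b t hx => ev_ofR _ hx
  have evs : ∀ t, pt p t ∈ (M.nbhd hM).dom → (s (M.nbhd hM)).ev (pt p t) = ((t⁻¹ : ℝ) : ℂ) :=
    fun t hx => by rw [s, ev_rz _ hx]; simp [pt]
  have evc : ∀ t, pt p t ∈ (M.nbhd hM).dom →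
      (M.cscF hM).ev (pt p t) = (((Real.sin (p 1))⁻¹ : ℝ) : ℂ) :=
    fun t hx => by rw [M.ev_cscF hM hx, Complex.ofReal_inv]; rfl
  have e00 := (hP 0 0).congr' (f₂ := fun t => t ^ 3 * ((K00.ev (pt p t)).re
      - ∑ k ∈ Finset.range 4, t⁻¹ ^ k * (P 0 0 k).eval (Real.log t))) (by
    filter_upwards [hdom] with t hx
    rw [hK00, ev_neg _ hx, ev_mul _ _ hx, ev_mul _ _ hx, evs t hx, evg _ _ t hx]
    simp only [← Complex.ofReal_mul, ← Complex.ofReal_neg, Complex.ofReal_re]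
    simp)
  have e01 := (hP 0 1).congr' (f₂ := fun t => t ^ 3 * ((K01.ev (pt p t)).re
      - ∑ k ∈ Finset.range 4, t⁻¹ ^ k * (P 0 1 k).eval (Real.log t))) (by
    filter_upwards [hdom] with t hx
    rw [hK01, ev_neg _ hx, ev_mul _ _ hx, ev_mul _ _ hx, ev_mul _ _ hx, evs t hx, evc t hx,
      evg _ _ t hx]
    simp only [← Complex.ofReal_mul, ← Complex.ofReal_neg, Complex.ofReal_re]
    simp [mul_assoc])
  have e11 := (hP 1 1).congr' (f₂ := fun t => t ^ 3 * ((K11.ev (pt p t)).re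
      - ∑ k ∈ Finset.range 4, t⁻¹ ^ k * (P 1 1 k).eval (Real.log t))) (by
    filter_upwards [hdom] with t hx
    rw [hK11, ev_neg _ hx, ev_mul _ _ hx, ev_mul _ _ hx, ev_mul _ _ hx, ev_mul _ _ hx, evs t hx,
      evc t hx, evg _ _ t hx]
    simp only [← Complex.ofReal_mul, ← Complex.ofReal_neg, Complex.ofReal_re]
    simp [mul_assoc, mul_left_comm])
  have s4 : ∀ t, pt p t ∈ (M.nbhd hM).dom → (coeff (M.nbhd hM) (ψ 4 0)).ev (pt p t) = ψ 4 0 p :=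
    fun t hx => ev_coeff (hexp.coeff_smooth 4 le_rfl 0 (by omega)) hx
  have s5 : ∀ t, pt p t ∈ (M.nbhd hM).dom → (coeff (M.nbhd hM) (ψ 5 1)).ev (pt p t) = ψ 5 1 p :=
    fun t hx => ev_coeff (hexp.coeff_smooth 5 (by norm_num) 1 (by omega)) hx
  generalize coeff (M.nbhd hM) (ψ 4 0) = w4 at *
  generalize coeff (M.nbhd hM) (ψ 5 1) = w5 at *
  generalize ψ 4 0 p = z4 at *
  generalize ψ 5 1 p = z5 at *
  -- The logarithmic coefficients of the diagonal components carry the real part of `Ψ₀^{5,1}`, and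
  -- that of the mixed component carries the imaginary part.
  obtain ⟨T00, U00, A00⟩ := J00.limits r00 hp (A := ((2 * z5.re : ℝ) : ℂ))
    (fun t hx => by rw [ev_add _ _ hx, ev_cj _ hx, s5 t hx, Complex.add_conj]) e00
  obtain ⟨T01, U01, A01⟩ := J01.limits r01 hp (A := ((-2 * z5.im : ℝ) : ℂ)) (fun t hx => by
    rw [ev_mul _ _ hx, cI, ev_algebraMap _ hx, ev_sub _ _ hx, ev_cj _ hx, s5 t hx, Complex.sub_conj]
    push_cast
    linear_combination (2 * (z5.im : ℂ)) * Complex.I_mul_I) e01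
  obtain ⟨T11, U11, -⟩ := J11.limits r11 hp (A := ((-(2 * z5.re) : ℝ) : ℂ)) (fun t hx => by
    rw [ev_neg _ hx, ev_add _ _ hx, ev_cj _ hx, s5 t hx, Complex.add_conj, Complex.ofReal_neg]) e11
  rw [Complex.ofReal_re] at A00 A01
  have ev2 : ∀ t, pt p t ∈ (M.nbhd hM).dom → (2 : Fn (M.nbhd hM)).ev (pt p t) = 2 := fun t hx => by
    rw [← map_ofNat (algebraMap ℂ (Fn (M.nbhd hM))) 2]; exact ev_algebraMap 2 hx
  have ev4 : ∀ t, pt p t ∈ (M.nbhd hM).dom → (4 : Fn (M.nbhd hM)).ev (pt p t) = 4 := fun t hx => by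
    rw [← map_ofNat (algebraMap ℂ (Fn (M.nbhd hM))) 4]; exact ev_algebraMap 4 hx
  -- The limits of the two relations in `metric_jets` give the real part of `Ψ₀^{4,0}` here and its
  -- imaginary part in `x2`.
  have x1 := tendsto_nhds_unique (((((U00.sub U11).const_mul 2).sub
      ((T00.add T11).mul (T00.sub T11))).add_const (4 * ((2 * z4.re : ℝ) : ℂ))).congr' (by
    filter_upwards [hdom] with t hx
    rw [ev_add _ _ hx, ev_sub _ _ hx, ev_mul _ _ hx, ev_mul _ _ hx, ev_mul _ _ hx, ev_sub _ _ hx,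
      ev_add _ _ hx, ev_sub _ _ hx, ev_add _ _ hx, ev_cj _ hx, s4 t hx, Complex.add_conj,
      ev2 t hx, ev4 t hx])) (tendsto_ray E1 hp)
  have x2 := tendsto_nhds_unique ((((U01.const_mul 2).sub ((T00.add T11).mul T01)).add_const
      ((-(4 * z4.im) : ℝ) : ℂ)).congr' (by
    filter_upwards [hdom] with t hx
    rw [ev_add _ _ hx, ev_sub _ _ hx, ev_mul _ _ hx, ev_mul _ _ hx, ev_mul _ _ hx, ev_mul _ _ hx,
      ev_add _ _ hx, ev_sub _ _ hx, ev_cj _ hx, s4 t hx, Complex.sub_conj, ev2 t hx, cI,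
      ev_algebraMap _ hx]
    push_cast
    linear_combination (-4 * (z4.im : ℂ)) * Complex.I_mul_I)) (tendsto_ray E2 hp)
  norm_cast at x1 x2
  have hre : ∀ {z : ℂ} {a b : ℝ}, z.re = a → z.im = b → z = (a : ℂ) + (b : ℂ) * Complex.I :=
    fun {z a b} ha hb => by rw [← ha, ← hb, Complex.re_add_im]
  refine ⟨hre ?_ ?_, hre ?_ ?_⟩ <;> linarith

include hM in
/-- Near a piece of null infinity with spherical cuts the coefficients `Ψ₀^{4,0}` and `Ψ₀^{5,1}`
extend continuously to the poles. -/
lemma exists_continuousOn_of_sphericalPiece (hvac : M.IsVacuum) (hflat : M.IsPolyhomogeneousFlat)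
    (hax : M.IsAxisymmetric) {ψ : ℤ → ℕ → Scri → ℂ} (hψ : M.HasMinimalPsi0 ψ)
    (hS : M.HasSphericalPiece) : ∃ (u : ℝ) (F₄ F₅ : ℝ → ℂ),
      ContinuousOn F₄ (Set.Icc 0 Real.pi) ∧ ContinuousOn F₅ (Set.Icc 0 Real.pi) ∧
      ∀ θ ∈ Set.Ioo 0 Real.pi, meridian u θ ∈ M.scri ∧ ψ 4 0 (meridian u θ) = F₄ θ ∧
        ψ 5 1 (meridian u θ) = F₅ θ := by
  obtain ⟨u₁, u₂, H, hu, hscri, hpoly, hreg⟩ := hS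
  choose N c hH using hpoly
  -- A single cut inside the piece suffices.
  obtain ⟨u, hu1, hu2⟩ := exists_between hu
  obtain ⟨R, hR⟩ := hreg u u hu1 hu2
  have hI : ∀ θ ∈ Set.Icc 0 Real.pi, sphPt (meridian u θ) ∈
      {q : Fin 4 → ℝ | q 0 ∈ Set.Ioo u₁ u₂ ∧ ¬ (q 1 = 0 ∧ q 2 = 0 ∧ q 3 = 0)} := by
    intro θ _
    refine ⟨⟨hu1, hu2⟩, fun ⟨h1, _, h3⟩ => ?_⟩
    have h := Real.sin_sq_add_cos_sq θ
    simp [sphPt, meridian] at h1 h3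
    rw [h1, h3] at h
    norm_num at h
  have hc := continuousOn_cutPoly hH hI
  refine ⟨u, _, _, continuousOn_cutWeyl₄ (P := fun θ i j => cutPoly N c u i j θ) hc,
    continuousOn_cutWeyl₅ (P := fun θ i j => cutPoly N c u i j θ) hc, fun θ hθ => ?_⟩
  have hp : meridian u θ ∈ M.scri := hscri _ ⟨hu1, hu2⟩ hθ
  refine ⟨hp, M.coefficients_of_cut hM hvac hflat hax hψ hp fun i j => ?_⟩
  refine tendsto_cutPoly hH (hI θ ⟨hθ.1.le, hθ.2.le⟩) i j ?_
  filter_upwards [eventually_gt_atTop (max R 0)] with t ht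
  rw [M.cut_component (M.sin_pos hM hp).ne' ((le_max_right R 0).trans_lt ht).ne'
    (hR (meridian u θ) ⟨le_rfl, le_rfl⟩ hθ t ((le_max_left R 0).trans_lt ht)).2]

/-- If null infinity has spherical cuts, a coefficient that is a power of `csc θ` vanishes. -/
lemma eq_zero_of_continuousOn {C : ℂ} {F : ℝ → ℂ} {n : ℕ} (hn : n ≠ 0)
    (hF : ContinuousOn F (Set.Icc 0 Real.pi))
    (h : ∀ θ ∈ Set.Ioo 0 Real.pi, F θ = C * ((1 / Real.sin θ) ^ n : ℝ)) : C = 0 := by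
  have h0 : (0 : ℝ) ∈ Set.Icc 0 Real.pi := ⟨le_rfl, Real.pi_pos.le⟩
  -- Multiplied by `sin^n θ`, the function tends to `F 0 · 0 = 0` at the pole, while in the interior
  -- the product is the constant `C`.
  have h1 : Tendsto (fun θ => F θ * ((Real.sin θ ^ n : ℝ) : ℂ)) (𝓝[Set.Ioo 0 Real.pi] 0) (𝓝 0) := by
    have h2 : Continuous fun θ : ℝ => ((Real.sin θ ^ n : ℝ) : ℂ) := by fun_prop
    have := ((hF 0 h0).mono Set.Ioo_subset_Icc_self).tendsto.mul
      (h2.continuousWithinAt (s := Set.Ioo 0 Real.pi) (x := 0)).tendsto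
    simpa [hn] using this
  have : NeBot (𝓝[Set.Ioo 0 Real.pi] (0 : ℝ)) := left_nhdsWithin_Ioo_neBot Real.pi_pos
  refine tendsto_nhds_unique (tendsto_const_nhds.congr' ?_) h1
  filter_upwards [self_mem_nhdsWithin] with θ hθ
  have hs : Real.sin θ ≠ 0 := (Real.sin_pos_of_mem_Ioo hθ).ne'
  rw [h θ hθ, mul_assoc, ← Complex.ofReal_mul, ← mul_pow, one_div_mul_cancel hs]
  simp

end NullChart
end BoostRot
end

/-! ### The theorem -/

theorem mainTheorem8 (M : BoostRot.NullChart) (hM : M.IsNullChart) (hvac : M.IsVacuum)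
    (hflat : M.IsPolyhomogeneousFlat) (hsym : M.IsBoostRotationSymmetric)
    (ψ : ℤ → ℕ → BoostRot.Scri → ℂ) (hψ : M.HasMinimalPsi0 ψ) :
    ∃ C₁ C₂ : ℂ,
      (∀ p ∈ M.scri, ψ 4 0 p = C₁ * ((1 / Real.sin (p 1)) ^ 2 : ℝ)) ∧
      (∀ p ∈ M.scri, ψ 5 1 p = C₂ * ((1 / Real.sin (p 1)) ^ 3 : ℝ)) ∧
      (C₁ ≠ 0 → ∀ θ₀ : ℝ, θ₀ = 0 ∨ θ₀ = Real.pi →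
        Filter.Tendsto (fun p => ‖ψ 4 0 p‖)
          (Filter.comap (fun p : BoostRot.Scri => p 1) (𝓝 θ₀) ⊓ Filter.principal M.scri)
          Filter.atTop) ∧
      (C₂ ≠ 0 → ∀ θ₀ : ℝ, θ₀ = 0 ∨ θ₀ = Real.pi →
        Filter.Tendsto (fun p => ‖ψ 5 1 p‖)
          (Filter.comap (fun p : BoostRot.Scri => p 1) (𝓝 θ₀) ⊓ Filter.principal M.scri)
          Filter.atTop) ∧
      (M.HasSphericalPiece → C₁ = 0 ∧ C₂ = 0) := by
  obtain ⟨hax, X, hX⟩ := hsym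
  obtain ⟨C₁, C₂, h₁, h₂⟩ := M.exists_constants hM hX hvac hflat hax hψ
  refine ⟨C₁, C₂, h₁, h₂, fun hC θ₀ hθ => M.tendsto_pole hM two_ne_zero h₁ hC hθ,
    fun hC θ₀ hθ => M.tendsto_pole hM three_ne_zero h₂ hC hθ, fun hS => ?_⟩
  obtain ⟨u, F₄, F₅, c₄, c₅, h⟩ :=
    M.exists_continuousOn_of_sphericalPiece hM hvac hflat hax hψ hS
  exact ⟨BoostRot.NullChart.eq_zero_of_continuousOn two_ne_zero c₄ fun θ hθ => by
      rw [← (h θ hθ).2.1, h₁ _ (h θ hθ).1]; rfl,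
    BoostRot.NullChart.eq_zero_of_continuousOn three_ne_zero c₅ fun θ hθ => by
      rw [← (h θ hθ).2.2, h₂ _ (h θ hθ).1]; rfl⟩
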